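/- Let $M$ be a compact (Hausdorff) smooth manifold of dimension $n$, possibly with boundary or corners, and let $p,q\ge 0$ with $p+q=n$. For a smooth vector bundle $V\to M$ let $\Gamma(V)$ be the space of smooth sections with its Fréchet topology (uniform convergence, on compact subsets of the chart domains, of the partial derivatives of every order of the local expressions). Let $\mathcal{M}^{p,q}\subset\Gamma(S^2T^*M)$ be the set of (pseudo-)Riemannian metrics of signature $(p,q)$, i.e. of the smooth fields of symmetric bilinear forms on $TM$ that are nondegenerate of inertia $(p,q)$ at every point; $(p,q)=(n,0)$ gives the Riemannian metrics. A map $f:U\to Y$ from an open subset $U$ of a Fréchet space $X$ to a Fréchet space $Y$ is called smooth if its iterated directional derivatives $D^kf(x)(h_1,\dots,h_k)$ exist for all $k\in\mathbb{N}$, $x\in U$, $h_1,\dots,h_k\in X$, and each $D^kf:U\times X^k\to Y$ is continuous. Then $\mathcal{M}^{p,q}$ is open in $\Gamma(S^2T^*M)$, and the following maps are well defined and smooth on $\mathcal{M}^{p,q}$: 1. the inverse metric $g\mapsto g^{-1}\in\Gamma(S^2TM)$; 2. for every orientation of $M$, the volume form $g\mapsto d\mathrm{vol}_g\in\Gamma(\Lambda^nT^*M)$,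 i.e. the positively oriented $n$-form with $d\mathrm{vol}_g(v_1,\dots,v_n)^2=|\det(g(v_i,v_j))|$; 3. the Christoffel symbols: (a) for every chart $U$ of the given atlas of $M$ (the preferred chart at a point), the coordinate Christoffel symbols $g\mapsto (\Gamma_{ij}^k(g))\in C^\infty(U)$ given by the Koszul formula $2\,g_{kl}\Gamma_{ij}^k=\partial_ig_{jl}+\partial_jg_{il}-\partial_lg_{ij}$; (b) for every smooth background connection $\nabla^0$ on $TM$, the difference $g\mapsto\nabla^g-\nabla^0\in\Gamma(T^*M\otimes\mathrm{End}(TM))$, where $\nabla^g$ is the Levi-Civita connection of $g$ (the torsion-free $g$-compatible connection on $TM$); 4. the Levi-Civita connection on the cotangent bundle: for every smooth background connection $\nabla^0$ on $T^*M$, the difference $g\mapsto\nabla^{g}-\nabla^0\in\Gamma(T^*M\otimes\mathrm{End}(T^*M))$, where $\nabla^g$ is now the connection on $T^*M$ given by $(\nabla^g_X\alpha)(Y)=X(\alpha(Y))-\alpha(\nabla^g_XY)$; 5. the Riemann curvature $g\mapsto\mathrm{Riem}(g)\in\Gamma(T^*M\otimes T^*M\otimes\mathrm{End}(TM))$, $\mathrm{Riem}(X,Y)Z=\nabla^g_X\nabla^g_YZ-\nabla^g_Y\nabla^g_XZ-\nabla^g_{[X,Y]}Z$;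 the Ricci curvature $g\mapsto\mathrm{Ric}(g)\in\Gamma(S^2T^*M)$, $\mathrm{Ric}(Y,Z)=\mathrm{tr}(X\mapsto\mathrm{Riem}(X,Y)Z)$; and the scalar curvature $g\mapsto\mathrm{Scal}(g)=\mathrm{tr}_g\mathrm{Ric}(g)\in C^\infty(M)$. -/

import Mathlib

set_option maxSynthPendingDepth 3
set_option synthInstance.maxHeartbeats 200000

open scoped Manifold ContDiff Topology Bundle

noncomputable section

namespace MetricOps

/-! ### Smooth maps between topological vector spaces -/

/-- `f` is smooth, in the sense of the differential calculus on Fréchet spaces, on the open set `U`: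
the iterated directional derivatives
`D (k+1) x (h₁, …, hₖ₊₁) = lim_{t → 0} (D k (x + t hₖ₊₁) (h₁, …, hₖ) - D k x (h₁, …, hₖ)) / t`
of `f = D 0` exist for all `k`, all `x ∈ U` and all directions, and each `D k` is jointly
continuous on `U × Xᵏ`. -/
def IsFrechetSmoothOn {X Y : Type*} [AddCommGroup X] [Module ℝ X] [TopologicalSpace X]
    [AddCommGroup Y] [Module ℝ Y] [TopologicalSpace Y] (f : X → Y) (U : Set X) : Prop :=
  IsOpen U ∧ ∃ D : (k : ℕ) → X → (Fin k → X) → Y,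
    (∀ x ∈ U, ∀ h : Fin 0 → X, D 0 x h = f x) ∧
    (∀ k, ContinuousOn (fun z : X × (Fin k → X) => D k z.1 z.2) (U ×ˢ Set.univ)) ∧
    ∀ k, ∀ x ∈ U, ∀ (h : Fin k → X) (w : X),
      Filter.Tendsto (fun t : ℝ => t⁻¹ • (D k (x + t • w) h - D k x h)) (𝓝[≠] 0)
        (𝓝 (D (k + 1) x (Fin.snoc (α := fun _ => X) h w)))

/-- An operation given by the specification `P` (where `P g s` says that `s` is the outcome of the
operation at `g`) is well defined on `U` with values in `Y`, and it is smooth on `U`. -/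
def IsSmoothOperation {X Y : Type*} [AddCommGroup X] [Module ℝ X] [TopologicalSpace X]
    [AddCommGroup Y] [Module ℝ Y] [TopologicalSpace Y] (U : Set X) (P : X → Y → Prop) : Prop :=
  ∃ f : X → Y, (∀ g ∈ U, P g (f g)) ∧ IsFrechetSmoothOn f U

/-! ### The Fréchet space of smooth sections of a vector bundle -/

section Sections

variable {E : Type*} [NormedAddCommGroup E] [NormedSpace ℝ E]
  {H : Type*} [TopologicalSpace H] (I : ModelWithCorners ℝ E H)
  {M : Type*} [TopologicalSpace M] [ChartedSpace H M]
  (F : Type*) [NormedAddCommGroup F] [NormedSpace ℝ F]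
  (V : M → Type*) [TopologicalSpace (Bundle.TotalSpace F V)]
  [∀ x, TopologicalSpace (V x)] [FiberBundle F V]

/-- The part of the image of the chart at `x₀` over which the preferred trivialization of `V` at
`x₀` is defined. -/
def localDomain (x₀ : M) : Set E :=
  (extChartAt I x₀).target ∩ (extChartAt I x₀).symm ⁻¹' (trivializationAt F V x₀).baseSet

variable {F V}

/-- The expression of a section `s` in the chart and the trivialization at `x₀`; it is meaningful on
`localDomain I F V x₀`. -/
def localRep (x₀ : M) (s : (x : M) → V x) (y : E) : F :=
  (trivializationAt F V x₀
    (Bundle.TotalSpace.mk' F ((extChartAt I x₀).symm y) (s ((extChartAt I x₀).symm y)))).2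

variable {I}

/-- The standard (Fréchet) topology on the space of smooth sections of `V`: uniform convergence, on
the compact subsets of the chart domains, of the partial derivatives of every order of the local
expressions. -/
instance instTopologicalSpaceSection : TopologicalSpace Cₛ^∞⟮I; F, V⟯ :=
  ⨅ (x₀ : M) (k : ℕ), TopologicalSpace.induced
    (fun s : Cₛ^∞⟮I; F, V⟯ =>
      UniformOnFun.ofFun {K : Set E | IsCompact K ∧ K ⊆ localDomain I F V x₀}
        (iteratedFDerivWithin ℝ k (localRep (F := F) I x₀ (fun x => s x)) (localDomain I F V x₀)))
    inferInstance

end Sections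

/-! ### Tensor bundles -/

section Tensors

variable {E : Type*} [NormedAddCommGroup E] [NormedSpace ℝ E]
  {H : Type*} [TopologicalSpace H] (I : ModelWithCorners ℝ E H)
  (M : Type*) [TopologicalSpace M] [ChartedSpace H M] [IsManifold I ∞ M]

/- Shortcuts for the instance search. -/

instance (x : M) : IsTopologicalAddGroup (TangentSpace I x →L[ℝ] Bundle.Trivial M ℝ x) :=
  ContinuousLinearMap.topologicalAddGroup

instance (x : M) : ContinuousAdd (TangentSpace I x →L[ℝ] Bundle.Trivial M ℝ x) :=
  IsTopologicalAddGroup.toContinuousAdd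

instance (x : M) : ContinuousSMul ℝ (TangentSpace I x →L[ℝ] Bundle.Trivial M ℝ x) :=
  ContinuousLinearMap.continuousSMul

instance (x : M) : IsTopologicalAddGroup (TangentSpace I x →L[ℝ] TangentSpace I x) :=
  ContinuousLinearMap.topologicalAddGroup

instance (x : M) : ContinuousAdd (TangentSpace I x →L[ℝ] TangentSpace I x) :=
  IsTopologicalAddGroup.toContinuousAdd

instance (x : M) : ContinuousSMul ℝ (TangentSpace I x →L[ℝ] TangentSpace I x) :=
  ContinuousLinearMap.continuousSMul

/-- Smooth functions on `M`, as the smooth sections of the trivial line bundle. -/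
abbrev ScalarField : Type _ := Cₛ^∞⟮I; ℝ, Bundle.Trivial M ℝ⟯

/-- `Γ(T*M ⊗ T*M)`, as fields of bilinear forms on `TM`. -/
abbrev BilinField : Type _ :=
  Cₛ^∞⟮I; E →L[ℝ] E →L[ℝ] ℝ,
    fun x : M => TangentSpace I x →L[ℝ] TangentSpace I x →L[ℝ] Bundle.Trivial M ℝ x⟯

/-- `Γ(TM ⊗ TM)`, as fields of bilinear forms on `T*M`. -/
abbrev CobilinField : Type _ :=
  Cₛ^∞⟮I; (E →L[ℝ] ℝ) →L[ℝ] (E →L[ℝ] ℝ) →L[ℝ] ℝ,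
    fun x : M => (TangentSpace I x →L[ℝ] Bundle.Trivial M ℝ x) →L[ℝ] (TangentSpace I x →L[ℝ] Bundle.Trivial M ℝ x) →L[ℝ] Bundle.Trivial M ℝ x⟯

/-- `Γ(T*M ⊗ End(TM))`. -/
abbrev EndTangentOneForm : Type _ :=
  Cₛ^∞⟮I; E →L[ℝ] E →L[ℝ] E,
    fun x : M => TangentSpace I x →L[ℝ] TangentSpace I x →L[ℝ] TangentSpace I x⟯

/-- `Γ(T*M ⊗ End(T*M))`. -/
abbrev EndCotangentOneForm : Type _ :=
  Cₛ^∞⟮I; E →L[ℝ] (E →L[ℝ] ℝ) →L[ℝ] (E →L[ℝ] ℝ),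
    fun x : M => TangentSpace I x →L[ℝ] (TangentSpace I x →L[ℝ] Bundle.Trivial M ℝ x) →L[ℝ] (TangentSpace I x →L[ℝ] Bundle.Trivial M ℝ x)⟯

/-- `Γ(T*M ⊗ T*M ⊗ End(TM))`. -/
abbrev CurvatureField : Type _ :=
  Cₛ^∞⟮I; E →L[ℝ] E →L[ℝ] E →L[ℝ] E,
    fun x : M => TangentSpace I x →L[ℝ] TangentSpace I x →L[ℝ]
      TangentSpace I x →L[ℝ] TangentSpace I x⟯

/-- `Γ(Λⁿ T*M)`, `n = dim M`. -/
abbrev TopForm : Type _ :=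
  Cₛ^∞⟮I; E [⋀^Fin (Module.finrank ℝ E)]→L[ℝ] ℝ,
    fun x : M => TangentSpace I x [⋀^Fin (Module.finrank ℝ E)]→L[ℝ] Bundle.Trivial M ℝ x⟯

/- Shortcuts for the instance search. -/

instance : AddCommGroup (BilinField I M) := ContMDiffSection.instAddCommGroup

instance : Module ℝ (BilinField I M) := ContMDiffSection.instModule

instance : TopologicalSpace (BilinField I M) := instTopologicalSpaceSection

instance : AddCommGroup (CobilinField I M) := ContMDiffSection.instAddCommGroup

instance : Module ℝ (CobilinField I M) := ContMDiffSection.instModule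

instance : TopologicalSpace (CobilinField I M) := instTopologicalSpaceSection

instance : AddCommGroup (EndTangentOneForm I M) := ContMDiffSection.instAddCommGroup

instance : Module ℝ (EndTangentOneForm I M) := ContMDiffSection.instModule

instance : TopologicalSpace (EndTangentOneForm I M) := instTopologicalSpaceSection

instance : AddCommGroup (EndCotangentOneForm I M) := ContMDiffSection.instAddCommGroup

instance : Module ℝ (EndCotangentOneForm I M) := ContMDiffSection.instModule

instance : TopologicalSpace (EndCotangentOneForm I M) := instTopologicalSpaceSection

instance : AddCommGroup (CurvatureField I M) := ContMDiffSection.instAddCommGroup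

instance : Module ℝ (CurvatureField I M) := ContMDiffSection.instModule

instance : TopologicalSpace (CurvatureField I M) := instTopologicalSpaceSection

instance : AddCommGroup (TopForm I M) := ContMDiffSection.instAddCommGroup

instance : Module ℝ (TopForm I M) := ContMDiffSection.instModule

instance : TopologicalSpace (TopForm I M) := instTopologicalSpaceSection

/-- `Γ(S²T*M)`. -/
def symBilin : Submodule ℝ (BilinField I M) where
  carrier := {g | ∀ x (u v : TangentSpace I x), g x u v = g x v u}
  add_mem' := fun ha hb x u v => congrArg₂ (· + ·) (ha x u v) (hb x u v)
  zero_mem' := fun _ _ _ => rfl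
  smul_mem' := fun c _ ha x u v => congrArg (c • ·) (ha x u v)

/-- `Γ(S²TM)`. -/
def symCobilin : Submodule ℝ (CobilinField I M) where
  carrier := {g | ∀ x (α β : TangentSpace I x →L[ℝ] Bundle.Trivial M ℝ x), g x α β = g x β α}
  add_mem' := fun ha hb x u v => congrArg₂ (· + ·) (ha x u v) (hb x u v)
  zero_mem' := fun _ _ _ => rfl
  smul_mem' := fun c _ ha x u v => congrArg (c • ·) (ha x u v)

variable {I M}

/-- The quadratic form `v ↦ g_x(v, v)` on `T_xM`. -/
def quadForm (g : BilinField I M) (x : M) : QuadraticForm ℝ (TangentSpace I x) :=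
  LinearMap.BilinMap.toQuadraticMap
    (LinearMap.mk₂ ℝ (fun u v : TangentSpace I x => (g x u v : ℝ)) (by simp) (by simp) (by simp)
      (by simp))

variable (I M) in
/-- The (pseudo-)Riemannian metrics of signature `(p, q)`: the smooth sections of `S²T*M` which are
nondegenerate of inertia `(p, q)` at each point. For `p = dim M`, `q = 0` these are the Riemannian
metrics. -/
def pseudoMetrics (p q : ℕ) : Set (symBilin I M) :=
  {g | ∀ x, (∀ u : TangentSpace I x, (∀ v : TangentSpace I x, g.1 x u v = 0) → u = 0) ∧
    sigPos (quadForm g.1 x) = p ∧ sigNeg (quadForm g.1 x) = q}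

/-! ### The operations -/

/-- `h` is the inverse metric of `g`: `h(α, g(v, ·)) = α(v)`. -/
def IsInverseMetric (g : BilinField I M) (h : CobilinField I M) : Prop :=
  ∀ x (α : TangentSpace I x →L[ℝ] Bundle.Trivial M ℝ x) (v : TangentSpace I x), h x α (g x v) = α v

/-- The alternating form `vol` represents the orientation `o` of `T_xM`. -/
def Represents {x : M} (vol : TangentSpace I x [⋀^Fin (Module.finrank ℝ E)]→L[ℝ] ℝ)
    (o : Orientation ℝ (TangentSpace I x) (Fin (Module.finrank ℝ E))) : Prop :=
  ∃ h : vol.toAlternatingMap ≠ 0, o = rayOfNeZero ℝ vol.toAlternatingMap h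

/-- A choice of orientations of the tangent spaces is an orientation of `M` if it is locally
represented by smooth `n`-forms. -/
def IsOrientation
    (o : (x : M) → Orientation ℝ (TangentSpace I x) (Fin (Module.finrank ℝ E))) : Prop :=
  ∀ x₀, ∃ vol : TopForm I M, ∀ᶠ x in 𝓝 x₀, Represents (vol x) (o x)

/-- `vol` is the volume form of `g` on `(M, o)`: it represents `o`, and
`vol(v₁, …, vₙ)² = |det (g(vᵢ, vⱼ))|`. -/
def IsVolumeForm (o : (x : M) → Orientation ℝ (TangentSpace I x) (Fin (Module.finrank ℝ E)))
    (g : BilinField I M) (vol : TopForm I M) : Prop :=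
  ∀ x, Represents (vol x) (o x) ∧ ∀ v : Fin (Module.finrank ℝ E) → TangentSpace I x,
    (vol x v) ^ 2 = |Matrix.det (Matrix.of fun i j => (g x (v i) (v j) : ℝ))|

variable (I) in
/-- The domain of the preferred chart at `x₀`, as an open submanifold of `M`. -/
def chartDomain (x₀ : M) : TopologicalSpace.Opens M :=
  ⟨(chartAt H x₀).source, (chartAt H x₀).open_source⟩

variable (I) in
/-- The Christoffel symbols in a chart are a smooth function on the chart domain with values in the
bilinear maps `E × E → E`. -/
abbrev ChristoffelField (x₀ : M) : Type _ :=
  Cₛ^∞⟮I; E →L[ℝ] E →L[ℝ] E, Bundle.Trivial (chartDomain (H := H) x₀) (E →L[ℝ] E →L[ℝ] E)⟯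

/-- `Γ` are the Christoffel symbols of `g` in the chart at `x₀`, by the Koszul formula for coordinate
vector fields: `2 g(Γ(u, v), w) = ∂ᵤ g(v, w) + ∂ᵥ g(u, w) - ∂_w g(u, v)`. -/
def IsChristoffel (x₀ : M) (g : BilinField I M) (Γ : ChristoffelField I x₀) : Prop :=
  ∀ (x : chartDomain (H := H) x₀) (u v w : E),
    let G : E → E →L[ℝ] E →L[ℝ] ℝ := localRep I x₀ (fun x => g x)
    let y : E := extChartAt I x₀ x
    let dG : E →L[ℝ] E →L[ℝ] E →L[ℝ] ℝ := fderivWithin ℝ G (extChartAt I x₀).target y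
    2 * G y (Γ x u v) w = dG u v w + dG v u w - dG w u v

variable (I M) in
/-- Affine connections on `M`. -/
abbrev TangentConnection : Type _ := CovariantDerivative I E (fun x : M => TangentSpace I x)

variable (I M) in
/-- Connections on the cotangent bundle. -/
abbrev CotangentConnection : Type _ :=
  CovariantDerivative I (E →L[ℝ] ℝ) (fun x : M => TangentSpace I x →L[ℝ] Bundle.Trivial M ℝ x)

/-- `cov` is the Levi-Civita connection of `g`: it is torsion free, and
`X g(Y, Z) = g(∇_X Y, Z) + g(Y, ∇_X Z)`. -/
def IsLeviCivita [FiniteDimensional ℝ E] (g : BilinField I M)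
    (cov : TangentConnection I M) : Prop :=
  haveI : CompleteSpace E := FiniteDimensional.complete ℝ E
  cov.torsion = 0 ∧
  ∀ (Y Z : (x : M) → TangentSpace I x) (x : M) (X : TangentSpace I x),
    MDiffAt (T% Y) x → MDiffAt (T% Z) x →
    mvfderiv I (fun x' => (g x' (Y x') (Z x') : ℝ)) x X =
      g x (cov Y x X) (Z x) + g x (Y x) (cov Z x X)

/-- `cov'` is the connection on `T*M` induced by the connection `cov` on `TM`:
`(∇_X α)(Y) = X (α(Y)) - α(∇_X Y)`. -/
def IsDualConnection (cov : TangentConnection I M) (cov' : CotangentConnection I M) : Prop :=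
  ∀ (α : (x : M) → TangentSpace I x →L[ℝ] Bundle.Trivial M ℝ x)
    (Y : (x : M) → TangentSpace I x) (x : M) (X : TangentSpace I x),
    MDifferentiableAt I (I.prod 𝓘(ℝ, E →L[ℝ] ℝ))
      (fun x' => Bundle.TotalSpace.mk' (E →L[ℝ] ℝ)
        (E := fun x : M => TangentSpace I x →L[ℝ] Bundle.Trivial M ℝ x) x' (α x')) x →
    MDiffAt (T% Y) x →
    cov' α x X (Y x) = mvfderiv I (fun x' => (α x' (Y x') : ℝ)) x X - α x (cov Y x X)

/-- `A = ∇^g - cov₀` in `Γ(T*M ⊗ End(TM))`, where `∇^g` is the Levi-Civita connection of `g`. -/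
def IsLeviCivitaTangent [FiniteDimensional ℝ E] (cov₀ : TangentConnection I M)
    (g : BilinField I M) (A : EndTangentOneForm I M) : Prop :=
  ∃ cov : TangentConnection I M, IsLeviCivita g cov ∧
    ∀ (Y : (x : M) → TangentSpace I x) (x : M) (X : TangentSpace I x), MDiffAt (T% Y) x →
      cov Y x X = cov₀ Y x X + A x X (Y x)

/-- `A = ∇^g - cov₀` in `Γ(T*M ⊗ End(T*M))`, where `∇^g` is the Levi-Civita connection of `g` on the
cotangent bundle. -/
def IsLeviCivitaCotangent [FiniteDimensional ℝ E]
    (cov₀ : CotangentConnection I M) (g : BilinField I M) (A : EndCotangentOneForm I M) : Prop :=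
  ∃ (cov : TangentConnection I M) (cov' : CotangentConnection I M),
    IsLeviCivita g cov ∧ IsDualConnection cov cov' ∧
    ∀ (α : (x : M) → TangentSpace I x →L[ℝ] Bundle.Trivial M ℝ x) (x : M) (X : TangentSpace I x),
    MDifferentiableAt I (I.prod 𝓘(ℝ, E →L[ℝ] ℝ))
      (fun x' => Bundle.TotalSpace.mk' (E →L[ℝ] ℝ)
        (E := fun x : M => TangentSpace I x →L[ℝ] Bundle.Trivial M ℝ x) x' (α x')) x →
      cov' α x X = cov₀ α x X + A x X (α x)

/-- `R` is the curvature tensor of `g`: `R(X, Y)Z = ∇_X ∇_Y Z - ∇_Y ∇_X Z - ∇_[X, Y] Z` for the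
Levi-Civita connection. -/
def IsRiem [FiniteDimensional ℝ E] (g : BilinField I M)
    (R : CurvatureField I M) : Prop :=
  ∃ cov : TangentConnection I M, IsLeviCivita g cov ∧
    ∀ (X Y Z : Cₛ^∞⟮I; E, fun x : M => TangentSpace I x⟯) (x : M),
      R x (X x) (Y x) (Z x) =
        cov (fun x' => cov Z x' (Y x')) x (X x) - cov (fun x' => cov Z x' (X x')) x (Y x)
          - cov Z x (VectorField.mlieBracket I X Y x)

/-- The endomorphism `u ↦ R(u, v)w` of `T_xM`. -/
def ricciEndo (R : CurvatureField I M) (x : M) (v w : TangentSpace I x) :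
    TangentSpace I x →ₗ[ℝ] TangentSpace I x where
  toFun u := R x u v w
  map_add' := by simp
  map_smul' := by simp

/-- `S` is the Ricci tensor of `g`: `S(v, w) = tr (u ↦ R(u, v)w)`. -/
def IsRic [FiniteDimensional ℝ E] (g S : BilinField I M) : Prop :=
  ∃ R : CurvatureField I M, IsRiem g R ∧
    ∀ x (v w : TangentSpace I x), S x v w = LinearMap.trace ℝ (TangentSpace I x) (ricciEndo R x v w)

/-- `f` is the scalar curvature of `g`: the trace of the endomorphism field `A` corresponding to the
Ricci tensor under `g`. -/
def IsScal [FiniteDimensional ℝ E] (g : BilinField I M)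
    (f : ScalarField I M) : Prop :=
  ∃ S : BilinField I M, IsRic g S ∧
    ∀ x, ∃ A : TangentSpace I x →ₗ[ℝ] TangentSpace I x,
      (∀ u v : TangentSpace I x, g x (A u) v = S x u v) ∧
      f x = LinearMap.trace ℝ (TangentSpace I x) A

end Tensors

end MetricOps

end

/-!
# Smooth dependence of the operations of Riemannian geometry on the metric

Why the operations are smooth: each of them is local, and in every chart it is a smooth function
`Ψ(c, j²g)` of the 2-jet `j²g = (g, Dg, D²g)` of the local expression of the metric, and possibly of
some smooth functions `c` which do not depend on the metric.

*Local formulas are smooth maps of Fréchet spaces.* Convergence of sections is convergence of the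
local expressions with all derivatives (`SmoothTendsto`, `tendsto_section_iff`). This notion of
convergence is compatible with composition (`SmoothTendsto.comp`), and difference quotients of
`Ψ(a + t b)` converge in this sense to `DΨ(a) b` (`smoothTendsto_slope`). Hence the functions
`DᵏΨ(j²g)(j²h₁, …, j²hₖ)` are the local expressions of the directional derivatives of the operation.
They transform like sections, being limits of difference quotients of such, so they glue to
sections (`IsLocalFormula.isCompatible_localDeriv`, `IsLocalFormula.isFrechetSmoothOn`). It
suffices that the outcome of an operation is characterized, at each point and in every chart, by the
local formula: `IsLocalFormula.exists_isFrechetSmoothOn`, and for metrics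
`exists_isFrechetSmoothOn_of_jet`. An operation with symmetric values is smooth as an operation with
values in the closed subspace of symmetric tensors (`IsFrechetSmoothOn.codRestrict`).

*Metrics are an open set* (`isOpen_pseudoMetrics`). The positive and the negative index of a
quadratic form are lower semicontinuous, and if they add up to the dimension they are locally
constant; the manifold is compact.

*The local formulas.* The inverse metric is given by inversion of linear maps
(`isInverse_iff_localRep`), the Christoffel symbols by the Koszul formula (`christoffel`). At each
point the Levi-Civita connection is defined by the Christoffel symbols in the preferred chart. The
connection with these Christoffel symbols is torsion-free and metric (`isLeviCivitaAt_chartCov`),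
and at each point such a connection is unique (`IsLeviCivitaAt.unique`); so the Christoffel symbols
give the Levi-Civita connection in all charts (`localRep_leviCivita`), also at points other than the
base point. Its difference to a background connection is the difference of the connection forms
(`cov_eq_add_iff`), and the connection form of a smooth connection is smooth
(`contDiffOn_connectionForm`). On the cotangent bundle, the connection form is minus the transpose.
The Riemann curvature is the usual expression in the Christoffel symbols and their derivatives
(`localRep_curvatureOperator`), the Ricci and the scalar curvature are its traces. The symmetry of
the Ricci curvature also holds for the local formula (`IsLocalMetric.jetRic_symm`). Finally, the
volume form is `± √|det gᵢⱼ| dx¹ ∧ … ∧ dxⁿ` with a locally constant sign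
(`eventually_chartSign_eq`).
-/

set_option linter.unusedSectionVars false

noncomputable section

namespace MetricOps

/-! ### Convergence of smooth functions with all derivatives -/

section SmoothTendsto

open Filter Set

variable {E F G : Type*} [NormedAddCommGroup E] [NormedSpace ℝ E]
  [NormedAddCommGroup F] [NormedSpace ℝ F] [NormedAddCommGroup G] [NormedSpace ℝ G]
  {T : Type*} {l : Filter T} {Ω : Set E}

/-- The smooth functions `φ t` converge to `ψ` on `Ω` along `l`, together with all derivatives,
continuously: `∂ᵐ (φ t) y → ∂ᵐ ψ y₀` as `t → l` and `y → y₀` in `Ω`. On a locally compact `Ω` this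
is convergence of all derivatives, uniformly on compact sets. -/
def SmoothTendsto (l : Filter T) (Ω : Set E) (φ : T → E → F) (ψ : E → F) : Prop :=
  (∀ᶠ t in l, ContDiffOn ℝ ∞ (φ t) Ω) ∧ ContDiffOn ℝ ∞ ψ Ω ∧
  ∀ m : ℕ, ∀ y ∈ Ω, Tendsto (fun p : T × E => iteratedFDerivWithin ℝ m (φ p.1) Ω p.2)
    (l ×ˢ 𝓝[Ω] y) (𝓝 (iteratedFDerivWithin ℝ m ψ Ω y))

omit [NormedSpace ℝ E] in
lemma eventually_prod_nhdsWithin {P : T → Prop} (h : ∀ᶠ t in l, P t) (y : E) :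
    ∀ᶠ p : T × E in l ×ˢ 𝓝[Ω] y, P p.1 ∧ p.2 ∈ Ω :=
  h.prod_mk (eventually_mem_nhdsWithin)

lemma SmoothTendsto.tendsto {φ : T → E → F} {ψ : E → F} (h : SmoothTendsto l Ω φ ψ) {y : E}
    (hy : y ∈ Ω) : Tendsto (fun p : T × E => φ p.1 p.2) (l ×ˢ 𝓝[Ω] y) (𝓝 (ψ y)) := by
  have := ((continuousMultilinearCurryFin0 ℝ E F).continuous.tendsto _).comp (h.2.2 0 y hy)
  refine (this.congr fun p => ?_).trans (le_of_eq ?_)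
  · simp
  · simp

lemma SmoothTendsto.tendsto_apply {φ : T → E → F} {ψ : E → F} (h : SmoothTendsto l Ω φ ψ) {y : E}
    (hy : y ∈ Ω) : Tendsto (fun t => φ t y) l (𝓝 (ψ y)) :=
  (h.tendsto hy).comp (tendsto_id.prodMk
    (tendsto_nhdsWithin_iff.2 ⟨tendsto_const_nhds, Eventually.of_forall fun _ => hy⟩))

lemma SmoothTendsto.congr {φ φ' : T → E → F} {ψ ψ' : E → F} (h : SmoothTendsto l Ω φ ψ)
    (hφ : ∀ᶠ t in l, EqOn (φ' t) (φ t) Ω) (hψ : EqOn ψ' ψ Ω) : SmoothTendsto l Ω φ' ψ' := by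
  refine ⟨?_, h.2.1.congr hψ, fun m y hy => ?_⟩
  · filter_upwards [h.1, hφ] with t h1 h2 using h1.congr h2
  · rw [iteratedFDerivWithin_congr hψ hy]
    refine (h.2.2 m y hy).congr' ?_
    filter_upwards [eventually_prod_nhdsWithin hφ y] with p hp
    exact (iteratedFDerivWithin_congr hp.1 hp.2 m).symm

lemma SmoothTendsto.comp_tendsto {S : Type*} {l' : Filter S} {φ : T → E → F} {ψ : E → F}
    (h : SmoothTendsto l Ω φ ψ) {k : S → T} (hk : Tendsto k l' l) :
    SmoothTendsto l' Ω (fun s => φ (k s)) ψ :=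
  ⟨hk.eventually h.1, h.2.1, fun m y hy =>
    (h.2.2 m y hy).comp (hk.prodMap (tendsto_id (x := 𝓝[Ω] y)))⟩

lemma smoothTendsto_const (hΩ : UniqueDiffOn ℝ Ω) {ψ : E → F} (h : ContDiffOn ℝ ∞ ψ Ω) :
    SmoothTendsto l Ω (fun _ => ψ) ψ := by
  refine ⟨Eventually.of_forall fun _ => h, h, fun m y hy => ?_⟩
  have : ContinuousWithinAt (iteratedFDerivWithin ℝ m ψ Ω) Ω y :=
    h.continuousOn_iteratedFDerivWithin (by exact_mod_cast le_top) hΩ y hy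
  exact this.tendsto.comp tendsto_snd

/-- Composition is continuous for smooth convergence: by the formula of Faà di Bruno, the
derivatives of a composition are polynomials in the derivatives of the factors. -/
lemma SmoothTendsto.comp {Ω' : Set G} (hΩ : UniqueDiffOn ℝ Ω) (hΩ' : UniqueDiffOn ℝ Ω')
    {Φ : T → G → F} {Ψ : G → F} {u : T → E → G} {v : E → G}
    (hΦ : SmoothTendsto l Ω' Φ Ψ) (hu : SmoothTendsto l Ω u v)
    (hm : ∀ᶠ t in l, MapsTo (u t) Ω Ω') (hv : MapsTo v Ω Ω') :
    SmoothTendsto l Ω (fun t y => Φ t (u t y)) (fun y => Ψ (v y)) := by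
  refine ⟨?_, hΦ.2.1.comp hu.2.1 hv, fun m y hy => ?_⟩
  · filter_upwards [hΦ.1, hu.1, hm] with t h1 h2 h3 using h1.comp h2 h3
  -- the formula of Faà di Bruno
  have key : ∀ {f : G → F} {g : E → G}, ContDiffOn ℝ ∞ f Ω' → ContDiffOn ℝ ∞ g Ω → MapsTo g Ω Ω' →
      ∀ z ∈ Ω, iteratedFDerivWithin ℝ m (fun y => f (g y)) Ω z =
        ∑ c : OrderedFinpartition m, c.compAlongOrderedFinpartitionL ℝ E G F
          (iteratedFDerivWithin ℝ c.length f Ω' (g z))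
          (fun i => iteratedFDerivWithin ℝ (c.partSize i) g Ω z) := by
    intro f g hf hg hfg z hz
    have := iteratedFDerivWithin_comp (hf.contDiffWithinAt (hfg hz)) (hg.contDiffWithinAt hz)
      hΩ' hΩ hz hfg (i := m) (by exact_mod_cast le_top)
    exact this
  rw [key hΦ.2.1 hu.2.1 hv y hy]
  have hu' : Tendsto (fun p : T × E => (p.1, u p.1 p.2)) (l ×ˢ 𝓝[Ω] y) (l ×ˢ 𝓝[Ω'] (v y)) := by
    refine tendsto_fst.prodMk (tendsto_nhdsWithin_iff.2 ⟨hu.tendsto hy, ?_⟩)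
    filter_upwards [eventually_prod_nhdsWithin hm y] with p hp using hp.1 hp.2
  have : Tendsto (fun p : T × E => ∑ c : OrderedFinpartition m,
      c.compAlongOrderedFinpartitionL ℝ E G F
          (iteratedFDerivWithin ℝ c.length (Φ p.1) Ω' (u p.1 p.2))
          (fun i => iteratedFDerivWithin ℝ (c.partSize i) (u p.1) Ω p.2)) (l ×ˢ 𝓝[Ω] y)
      (𝓝 (∑ c : OrderedFinpartition m, c.compAlongOrderedFinpartitionL ℝ E G F
          (iteratedFDerivWithin ℝ c.length Ψ Ω' (v y))
          (fun i => iteratedFDerivWithin ℝ (c.partSize i) v Ω y))) := by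
    refine tendsto_finsetSum _ fun c _ => ?_
    have h1 : Tendsto (fun p : T × E => iteratedFDerivWithin ℝ c.length (Φ p.1) Ω' (u p.1 p.2))
        (l ×ˢ 𝓝[Ω] y) (𝓝 (iteratedFDerivWithin ℝ c.length Ψ Ω' (v y))) :=
      (hΦ.2.2 c.length (v y) (hv hy)).comp hu'
    have h2 : Tendsto
        (fun p : T × E => fun i => iteratedFDerivWithin ℝ (c.partSize i) (u p.1) Ω p.2)
        (l ×ˢ 𝓝[Ω] y) (𝓝 (fun i => iteratedFDerivWithin ℝ (c.partSize i) v Ω y)) :=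
      tendsto_pi_nhds.2 fun i => hu.2.2 _ y hy
    have h3 : Continuous fun q : (G [×c.length]→L[ℝ] F) × (∀ i, E [×c.partSize i]→L[ℝ] G) =>
        c.compAlongOrderedFinpartitionL ℝ E G F q.1 q.2 := by
      fun_prop
    exact (h3.tendsto _).comp (h1.prodMk_nhds h2)
  refine this.congr' ?_
  have hall : ∀ᶠ t in l, ContDiffOn ℝ ∞ (Φ t) Ω' ∧ ContDiffOn ℝ ∞ (u t) Ω ∧ MapsTo (u t) Ω Ω' := by
    filter_upwards [hΦ.1, hu.1, hm] with t h1 h2 h3 using ⟨h1, h2, h3⟩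
  filter_upwards [eventually_prod_nhdsWithin hall y] with p hp
  exact (key hp.1.1 hp.1.2.1 hp.1.2.2 p.2 hp.2).symm

lemma SmoothTendsto.comp_left {Ω' : Set G} (hΩ : UniqueDiffOn ℝ Ω) (hΩ' : UniqueDiffOn ℝ Ω')
    {Ψ : G → F} {u : T → E → G} {v : E → G} (hΨ : ContDiffOn ℝ ∞ Ψ Ω') (hu : SmoothTendsto l Ω u v)
    (hm : ∀ᶠ t in l, MapsTo (u t) Ω Ω') (hv : MapsTo v Ω Ω') :
    SmoothTendsto l Ω (fun t y => Ψ (u t y)) (fun y => Ψ (v y)) :=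
  (smoothTendsto_const hΩ' hΨ).comp hΩ hΩ' hu hm hv

lemma SmoothTendsto.clm (hΩ : UniqueDiffOn ℝ Ω) (L : G →L[ℝ] F) {u : T → E → G} {v : E → G}
    (hu : SmoothTendsto l Ω u v) : SmoothTendsto l Ω (fun t y => L (u t y)) (fun y => L (v y)) :=
  hu.comp_left hΩ uniqueDiffOn_univ L.contDiff.contDiffOn
    (Eventually.of_forall fun _ => mapsTo_univ _ _) (mapsTo_univ _ _)

lemma SmoothTendsto.add (hΩ : UniqueDiffOn ℝ Ω) {u u' : T → E → G} {v v' : E → G}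
    (hu : SmoothTendsto l Ω u v) (hu' : SmoothTendsto l Ω u' v') :
    SmoothTendsto l Ω (fun t y => u t y + u' t y) (fun y => v y + v' y) := by
  refine ⟨?_, hu.2.1.add hu'.2.1, fun m y hy => ?_⟩
  · filter_upwards [hu.1, hu'.1] with t h1 h2 using h1.add h2
  have hm : ((m : ℕ∞) : WithTop ℕ∞) ≤ ∞ := by exact_mod_cast le_top
  have key : ∀ {f g : E → G}, ContDiffOn ℝ ∞ f Ω → ContDiffOn ℝ ∞ g Ω → ∀ z ∈ Ω,
      iteratedFDerivWithin ℝ m (fun y => f y + g y) Ω z =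
        iteratedFDerivWithin ℝ m f Ω z + iteratedFDerivWithin ℝ m g Ω z := fun hf hg z hz =>
    fun_iteratedFDerivWithin_add_apply ((hf z hz).of_le hm) ((hg z hz).of_le hm) hΩ hz
  rw [key hu.2.1 hu'.2.1 y hy]
  refine ((hu.2.2 m y hy).add (hu'.2.2 m y hy)).congr' ?_
  filter_upwards [eventually_prod_nhdsWithin (hu.1.and hu'.1) y] with p hp
  exact (key hp.1.1 hp.1.2 p.2 hp.2).symm

lemma SmoothTendsto.sum (hΩ : UniqueDiffOn ℝ Ω) {ι : Type*} (s : Finset ι) {u : ι → T → E → G}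
    {v : ι → E → G} (hu : ∀ i ∈ s, SmoothTendsto l Ω (u i) (v i)) :
    SmoothTendsto l Ω (fun t y => ∑ i ∈ s, u i t y) (fun y => ∑ i ∈ s, v i y) := by
  classical
  induction s using Finset.induction_on with
  | empty => simpa using smoothTendsto_const hΩ (contDiffOn_const (c := (0 : G)))
  | insert a s ha ih =>
    simp only [Finset.sum_insert ha]
    exact (hu a (by simp)).add hΩ (ih fun i hi => hu i (by simp [hi]))

lemma SmoothTendsto.prodMk (hΩ : UniqueDiffOn ℝ Ω) {u : T → E → G} {v : E → G}
    {u' : T → E → F} {v' : E → F} (hu : SmoothTendsto l Ω u v) (hu' : SmoothTendsto l Ω u' v') :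
    SmoothTendsto l Ω (fun t y => (u t y, u' t y)) (fun y => (v y, v' y)) :=
  ((hu.clm hΩ (ContinuousLinearMap.inl ℝ G F)).add hΩ
    (hu'.clm hΩ (ContinuousLinearMap.inr ℝ G F))).congr
    (Eventually.of_forall fun t y _ => by simp) (fun y _ => by simp)

lemma SmoothTendsto.pi (hΩ : UniqueDiffOn ℝ Ω) {ι : Type*} [Fintype ι] {u : T → E → ι → G}
    {v : E → ι → G} (hu : ∀ i, SmoothTendsto l Ω (fun t y => u t y i) (fun y => v y i)) :
    SmoothTendsto l Ω u v := by
  classical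
  refine (SmoothTendsto.sum hΩ Finset.univ fun i _ =>
    (hu i).clm hΩ (ContinuousLinearMap.single ℝ (fun _ : ι => G) i)).congr
    (Eventually.of_forall fun t y _ => ?_) (fun y _ => ?_) <;>
  simp [Finset.univ_sum_single]

lemma SmoothTendsto.fderivWithin (hΩ : UniqueDiffOn ℝ Ω) {u : T → E → G} {v : E → G}
    (hu : SmoothTendsto l Ω u v) :
    SmoothTendsto l Ω (fun t => fderivWithin ℝ (u t) Ω) (fderivWithin ℝ v Ω) := by
  refine ⟨?_, hu.2.1.fderivWithin hΩ (by simp), fun m y hy => ?_⟩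
  · filter_upwards [hu.1] with t h1 using h1.fderivWithin hΩ (by simp)
  have key : ∀ (f : E → G), ∀ z ∈ Ω, iteratedFDerivWithin ℝ m (_root_.fderivWithin ℝ f Ω) Ω z =
      continuousMultilinearCurryRightEquiv' ℝ m E G
        (iteratedFDerivWithin ℝ (m + 1) f Ω z) := by
    intro f z hz
    rw [iteratedFDerivWithin_succ_eq_comp_right hΩ hz]
    simp
  rw [key _ y hy]
  refine (((continuousMultilinearCurryRightEquiv' ℝ m E G).continuous.tendsto _).comp
    (hu.2.2 (m + 1) y hy)).congr' ?_
  filter_upwards [eventually_prod_nhdsWithin hu.1 y] with p hp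
  exact (key _ p.2 hp.2).symm

end SmoothTendsto

section DifferenceQuotient

open Filter Set

universe u

/-- The case of `smoothTendsto_slope` where all spaces live in one universe, as required by the
induction on the order of the derivatives: the derivative of a difference quotient of `Ψ` is a
difference quotient of `(a, b) ↦ DΨ(a) b`. -/
lemma tendsto_iteratedFDerivWithin_slope {E : Type u} [NormedAddCommGroup E] [NormedSpace ℝ E]
    {Ω : Set E} (hΩ : UniqueDiffOn ℝ Ω) (m : ℕ) :
    ∀ {F G : Type u} [NormedAddCommGroup F] [NormedSpace ℝ F] [NormedAddCommGroup G]
      [NormedSpace ℝ G] {S : Set G} {Ψ : G → F} {u w : E → G}, IsOpen S → ContDiffOn ℝ ∞ Ψ S →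
      ContDiffOn ℝ ∞ u Ω → ContDiffOn ℝ ∞ w Ω → MapsTo u Ω S →
      (∀ᶠ t : ℝ in 𝓝[≠] 0, MapsTo (fun y => u y + t • w y) Ω S) → ∀ y ∈ Ω,
      Tendsto (fun p : ℝ × E => iteratedFDerivWithin ℝ m
        (fun y => p.1⁻¹ • (Ψ (u y + p.1 • w y) - Ψ (u y))) Ω p.2) (𝓝[≠] 0 ×ˢ 𝓝[Ω] y)
        (𝓝 (iteratedFDerivWithin ℝ m (fun y => fderiv ℝ Ψ (u y) (w y)) Ω y)) := by
  induction m with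
  | zero =>
    intro F G _ _ _ _ S Ψ u w hS hΨ hu hw hm hmt y hy
    suffices h : Tendsto (fun p : ℝ × E => p.1⁻¹ • (Ψ (u p.2 + p.1 • w p.2) - Ψ (u p.2)))
        (𝓝[≠] 0 ×ˢ 𝓝[Ω] y) (𝓝 (fderiv ℝ Ψ (u y) (w y))) by
      have := ((continuousMultilinearCurryFin0 ℝ E F).symm.continuous.tendsto _).comp h
      simpa only [iteratedFDerivWithin_zero_eq_comp] using! this
    -- strict differentiability is needed since the base point `u p.2` varies as well
    have hd : HasStrictFDerivAt Ψ (fderiv ℝ Ψ (u y)) (u y) :=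
      (hΨ.contDiffAt (hS.mem_nhds (hm hy))).hasStrictFDerivAt (by simp)
    have h1 : Tendsto (fun p : ℝ × E => p.1) (𝓝[≠] 0 ×ˢ 𝓝[Ω] y) (𝓝 0) :=
      (tendsto_nhdsWithin_iff.1 tendsto_fst).1
    have hu' : Tendsto (fun p : ℝ × E => u p.2) (𝓝[≠] 0 ×ˢ 𝓝[Ω] y) (𝓝 (u y)) :=
      (hu.continuousOn y hy).tendsto.comp tendsto_snd
    have hw' : Tendsto (fun p : ℝ × E => w p.2) (𝓝[≠] 0 ×ˢ 𝓝[Ω] y) (𝓝 (w y)) :=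
      (hw.continuousOn y hy).tendsto.comp tendsto_snd
    have hpair : Tendsto (fun p : ℝ × E => (u p.2 + p.1 • w p.2, u p.2)) (𝓝[≠] 0 ×ˢ 𝓝[Ω] y)
        (𝓝 (u y, u y)) := by
      have := (hu'.add (h1.smul hw')).prodMk_nhds hu'
      simpa using this
    have h2 := hd.isLittleO.comp_tendsto hpair
    have h3 : (fun p : ℝ × E => p.1⁻¹ • (Ψ (u p.2 + p.1 • w p.2) - Ψ (u p.2))
        - fderiv ℝ Ψ (u y) (w p.2)) =o[𝓝[≠] 0 ×ˢ 𝓝[Ω] y] (fun p : ℝ × E => w p.2) := by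
      have h4 := (Asymptotics.isBigO_refl (fun p : ℝ × E => p.1⁻¹)
        (𝓝[≠] (0 : ℝ) ×ˢ 𝓝[Ω] y)).smul_isLittleO h2
      have hne : ∀ᶠ p : ℝ × E in 𝓝[≠] 0 ×ˢ 𝓝[Ω] y, p.1 ≠ 0 :=
        tendsto_fst.eventually eventually_mem_nhdsWithin
      refine (h4.congr' ?_ ?_)
      · filter_upwards [hne] with p hp
        simp [smul_sub, inv_smul_smul₀ hp]
      · filter_upwards [hne] with p hp
        simp [inv_smul_smul₀ hp]
    have h5 : Tendsto (fun p : ℝ × E => p.1⁻¹ • (Ψ (u p.2 + p.1 • w p.2) - Ψ (u p.2))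
        - fderiv ℝ Ψ (u y) (w p.2)) (𝓝[≠] 0 ×ˢ 𝓝[Ω] y) (𝓝 0) :=
      (h3.trans_isBigO (hw'.isBigO_one ℝ)).tendsto_zero_of_tendsto tendsto_const_nhds
    have h6 := h5.add (((fderiv ℝ Ψ (u y)).continuous.tendsto _).comp hw')
    simpa using h6
  | succ m ih =>
    intro F G _ _ _ _ S Ψ u w hS hΨ hu hw hm hmt y hy
    have hdu := hu.fderivWithin hΩ (m := ∞) (by simp)
    have hdw := hw.fderivWithin hΩ (m := ∞) (by simp)
    have hdΨ : ContDiffOn ℝ ∞ (fderiv ℝ Ψ) S := hΨ.fderiv_of_isOpen hS (by simp)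
    -- the derivative of a difference quotient of `Ψ` is one of `(a, b) ↦ DΨ(a) ∘ b`
    have hkey := ih (F := E →L[ℝ] F) (G := G × (E →L[ℝ] G)) (S := S ×ˢ univ)
      (Ψ := fun a => (fderiv ℝ Ψ a.1).comp a.2)
      (u := fun y => (u y, fderivWithin ℝ u Ω y)) (w := fun y => (w y, fderivWithin ℝ w Ω y))
      (hS.prod isOpen_univ)
      ((hdΨ.comp contDiffOn_fst fun a ha => ha.1).clm_comp contDiffOn_snd)
      (hu.prodMk hdu) (hw.prodMk hdw) (fun z hz => ⟨hm hz, mem_univ _⟩)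
      (hmt.mono fun t ht z hz => ⟨ht hz, mem_univ _⟩) y hy
    have hsucc : ∀ (f : E → F), ∀ z ∈ Ω, iteratedFDerivWithin ℝ (m + 1) f Ω z =
        (continuousMultilinearCurryRightEquiv' ℝ m E F).symm
          (iteratedFDerivWithin ℝ m (fderivWithin ℝ f Ω) Ω z) := fun f z hz => by
      rw [iteratedFDerivWithin_succ_eq_comp_right hΩ hz]; rfl
    have hd0 : ∀ z ∈ Ω, HasFDerivWithinAt u (fderivWithin ℝ u Ω z) Ω z := fun z hz =>
      (hu.differentiableOn (by simp) z hz).hasFDerivWithinAt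
    have hd1 : ∀ z ∈ Ω, HasFDerivWithinAt w (fderivWithin ℝ w Ω z) Ω z := fun z hz =>
      (hw.differentiableOn (by simp) z hz).hasFDerivWithinAt
    have hdS : ∀ a ∈ S, HasFDerivAt Ψ (fderiv ℝ Ψ a) a := fun a ha =>
      ((hΨ.contDiffAt (hS.mem_nhds ha)).differentiableAt (by simp)).hasFDerivAt
    have hd2 : ∀ a ∈ S, HasFDerivAt (fderiv ℝ Ψ) (fderiv ℝ (fderiv ℝ Ψ) a) a := fun a ha =>
      ((hdΨ.contDiffAt (hS.mem_nhds ha)).differentiableAt (by simp)).hasFDerivAt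
    have e1 : ∀ t : ℝ, MapsTo (fun y => u y + t • w y) Ω S → EqOn
        (fderivWithin ℝ (fun y => t⁻¹ • (Ψ (u y + t • w y) - Ψ (u y))) Ω)
        (fun y => t⁻¹ • ((fderiv ℝ Ψ (u y + t • w y)).comp
            (fderivWithin ℝ u Ω y + t • fderivWithin ℝ w Ω y) -
          (fderiv ℝ Ψ (u y)).comp (fderivWithin ℝ u Ω y))) Ω := by
      intro t ht z hz
      have h1 := (hdS _ (ht hz)).comp_hasFDerivWithinAt z ((hd0 z hz).add ((hd1 z hz).const_smul t))
      have h2 := (hdS _ (hm hz)).comp_hasFDerivWithinAt z (hd0 z hz)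
      exact ((h1.sub h2).const_smul t⁻¹).fderivWithin (hΩ z hz)
    have e2 : EqOn (fderivWithin ℝ (fun y => fderiv ℝ Ψ (u y) (w y)) Ω)
        (fun y => fderiv ℝ (fun a : G × (E →L[ℝ] G) => (fderiv ℝ Ψ a.1).comp a.2)
          (u y, fderivWithin ℝ u Ω y) (w y, fderivWithin ℝ w Ω y)) Ω := by
      intro z hz
      have h2 := hd2 _ (hm hz)
      have h3 : HasFDerivAt (fun a : G × (E →L[ℝ] G) => (fderiv ℝ Ψ a.1).comp a.2) _
          (u z, fderivWithin ℝ u Ω z) :=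
        HasFDerivAt.clm_comp (h2.comp (u z, fderivWithin ℝ u Ω z) hasFDerivAt_fst) hasFDerivAt_snd
      have h4 := ((h2.comp_hasFDerivWithinAt z (hd0 z hz)).clm_apply (hd1 z hz)).fderivWithin
        (hΩ z hz)
      -- here the symmetry of the second derivative of `Ψ` enters
      have hsymm : IsSymmSndFDerivAt ℝ Ψ (u z) :=
        (hΨ.contDiffAt (hS.mem_nhds (hm hz))).isSymmSndFDerivAt
          (by rw [minSmoothness_of_isRCLikeNormedField]; exact WithTop.coe_le_coe.2 le_top)
      refine h4.trans ?_
      beta_reduce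
      rw [h3.fderiv]
      ext v
      simp [hsymm.eq]
    rw [hsucc _ y hy, iteratedFDerivWithin_congr e2 hy]
    refine (((continuousMultilinearCurryRightEquiv' ℝ m E F).symm.continuous.tendsto _).comp
      hkey).congr' ?_
    filter_upwards [eventually_prod_nhdsWithin hmt y] with p hp
    rw [hsucc _ p.2 hp.2, iteratedFDerivWithin_congr (e1 p.1 hp.1) hp.2]
    rfl

/-- Difference quotients of `Ψ` along a curve `u + t w` of functions converge smoothly to
`DΨ(u) w`. The equivalence `e` only serves to move the values of `Ψ` to the universe of `E`. -/
lemma smoothTendsto_slope {E : Type u} [NormedAddCommGroup E] [NormedSpace ℝ E]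
    {Ω : Set E} (hΩ : UniqueDiffOn ℝ Ω) {F : Type*} {F' G : Type u} [NormedAddCommGroup F]
    [NormedSpace ℝ F] [NormedAddCommGroup F'] [NormedSpace ℝ F'] (e : F ≃L[ℝ] F')
    [NormedAddCommGroup G] [NormedSpace ℝ G] {S : Set G} {Ψ : G → F} {u w : E → G}
    (hS : IsOpen S) (hΨ : ContDiffOn ℝ ∞ Ψ S) (hu : ContDiffOn ℝ ∞ u Ω) (hw : ContDiffOn ℝ ∞ w Ω)
    (hm : MapsTo u Ω S) (hmt : ∀ᶠ t : ℝ in 𝓝[≠] 0, MapsTo (fun y => u y + t • w y) Ω S) :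
    SmoothTendsto (𝓝[≠] (0 : ℝ)) Ω (fun t y => t⁻¹ • (Ψ (u y + t • w y) - Ψ (u y)))
      (fun y => fderiv ℝ Ψ (u y) (w y)) := by
  have hΨ' : ContDiffOn ℝ ∞ (fun a => e (Ψ a)) S := e.contDiff.comp_contDiffOn hΨ
  have h : SmoothTendsto (𝓝[≠] (0 : ℝ)) Ω
      (fun t y => t⁻¹ • (e (Ψ (u y + t • w y)) - e (Ψ (u y))))
      (fun y => fderiv ℝ (fun a => e (Ψ a)) (u y) (w y)) := by
    refine ⟨?_, ?_, fun m y hy =>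
      tendsto_iteratedFDerivWithin_slope hΩ m hS hΨ' hu hw hm hmt y hy⟩
    · filter_upwards [hmt] with t ht
      exact ((hΨ'.comp (hu.add (hw.const_smul t)) ht).sub (hΨ'.comp hu hm)).const_smul t⁻¹
    · exact ((hΨ'.fderiv_of_isOpen hS (m := ∞) (by simp)).comp hu hm).clm_apply hw
  refine (h.clm hΩ (e.symm : F' →L[ℝ] F)).congr (Eventually.of_forall fun t y _ => ?_)
    (fun y hy => ?_)
  · simp
  · have hd : DifferentiableAt ℝ Ψ (u y) :=
      (hΨ.contDiffAt (hS.mem_nhds (hm hy))).differentiableAt (by simp)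
    have := (e.toContinuousLinearMap.hasFDerivAt.comp (u y) hd.hasFDerivAt).fderiv
    simp only [Function.comp_def, ContinuousLinearEquiv.coe_coe] at this
    simp [this]

/-- The `k`-th directional derivative `(a, b) ↦ DᵏΨ(a)(b₁, …, bₖ)`, as a function on
`G × Gᵏ`. The last direction is the one of the last differentiation, as in
`IsFrechetSmoothOn`. -/
def dirDeriv {F G : Type*} [NormedAddCommGroup F] [NormedSpace ℝ F] [NormedAddCommGroup G]
    [NormedSpace ℝ G] (Ψ : G → F) : (k : ℕ) → G × (Fin k → G) → F
  | 0, p => Ψ p.1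
  | k + 1, p => fderiv ℝ (dirDeriv Ψ k) (p.1, Fin.init p.2) (p.2 (Fin.last k), 0)

lemma contDiffOn_dirDeriv {F G : Type*} [NormedAddCommGroup F] [NormedSpace ℝ F]
    [NormedAddCommGroup G] [NormedSpace ℝ G] {Ψ : G → F} {S : Set G} (hS : IsOpen S)
    (hΨ : ContDiffOn ℝ ∞ Ψ S) (k : ℕ) : ContDiffOn ℝ ∞ (dirDeriv Ψ k) (S ×ˢ univ) := by
  induction k with
  | zero => exact hΨ.comp contDiffOn_fst fun p hp => hp.1
  | succ k ih =>
    have h1 := ih.fderiv_of_isOpen (hS.prod isOpen_univ) (m := ∞) (by simp)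
    have h2 : ContDiff ℝ ∞ fun p : G × (Fin (k + 1) → G) => (p.1, (Fin.init p.2 : Fin k → G)) := by
      refine contDiff_fst.prodMk (contDiff_pi.2 fun i => ?_)
      simp only [Fin.init]
      fun_prop
    exact (h1.comp h2.contDiffOn fun p hp => ⟨hp.1, mem_univ _⟩).clm_apply (by fun_prop)

end DifferenceQuotient

/-! ### The local expressions of sections -/

section LocalRep

open Filter Set Bundle

variable {E : Type*} [NormedAddCommGroup E] [NormedSpace ℝ E]
  {H : Type*} [TopologicalSpace H] {I : ModelWithCorners ℝ E H}
  {M : Type*} [TopologicalSpace M] [ChartedSpace H M]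
  {F : Type*} [NormedAddCommGroup F] [NormedSpace ℝ F]
  {V : M → Type*} [TopologicalSpace (TotalSpace F V)]
  [∀ x, TopologicalSpace (V x)] [FiberBundle F V]

lemma extChartAt_mem_localDomain (x : M) : extChartAt I x x ∈ localDomain I F V x :=
  ⟨mem_extChartAt_target x, by
    rw [mem_preimage, extChartAt_to_inv]
    exact FiberBundle.mem_baseSet_trivializationAt F V x⟩

lemma extChartAt_mem_localDomain_of_mem {x₀ x : M} (hx : x ∈ (extChartAt I x₀).source)
    (hx' : x ∈ (trivializationAt F V x₀).baseSet) : extChartAt I x₀ x ∈ localDomain I F V x₀ :=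
  ⟨(extChartAt I x₀).map_source hx, by
    rwa [mem_preimage, (extChartAt I x₀).left_inv hx]⟩

lemma localRep_extChartAt {x₀ x : M} (hx : x ∈ (extChartAt I x₀).source) (s : ∀ x, V x) :
    localRep (F := F) I x₀ s (extChartAt I x₀ x) = (trivializationAt F V x₀ ⟨x, s x⟩).2 := by
  unfold localRep
  rw [(extChartAt I x₀).left_inv hx]

lemma localDomain_mem_nhdsWithin {x₀ : M} {y : E} (hy : y ∈ localDomain I F V x₀) :
    localDomain I F V x₀ ∈ 𝓝[range I] y := by
  have h1 : (extChartAt I x₀).target ∈ 𝓝[range I] y := extChartAt_target_mem_nhdsWithin_of_mem hy.1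
  have h2 : ContinuousWithinAt (extChartAt I x₀).symm (range I) y :=
    (continuousAt_extChartAt_symm'' hy.1).continuousWithinAt
  exact inter_mem h1 (h2 ((trivializationAt F V x₀).open_baseSet.mem_nhds hy.2))

lemma localDomain_subset_range {x₀ : M} : localDomain I F V x₀ ⊆ range I :=
  fun _ hy => extChartAt_target_subset_range x₀ hy.1

lemma nhdsWithin_localDomain {x₀ : M} {y : E} (hy : y ∈ localDomain I F V x₀) :
    𝓝[localDomain I F V x₀] y = 𝓝[range I] y :=
  le_antisymm (nhdsWithin_mono _ localDomain_subset_range)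
    (nhdsWithin_le_of_mem (localDomain_mem_nhdsWithin hy))

variable (I F V) in
lemma uniqueDiffOn_localDomain (x₀ : M) : UniqueDiffOn ℝ (localDomain I F V x₀) := fun y hy => by
  have := I.uniqueDiffOn y (localDomain_subset_range hy)
  exact this.mono_nhds (nhdsWithin_localDomain hy).symm.le

lemma exists_isCompact_mem_nhdsWithin [FiniteDimensional ℝ E] {x₀ : M} {y : E}
    (hy : y ∈ localDomain I F V x₀) :
    ∃ K ∈ 𝓝[localDomain I F V x₀] y, IsCompact K ∧ K ⊆ localDomain I F V x₀ := by
  have : ProperSpace E := FiniteDimensional.proper ℝ E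
  obtain ⟨ε, hε, h⟩ := Metric.mem_nhdsWithin_iff.1 (localDomain_mem_nhdsWithin hy)
  refine ⟨Metric.closedBall y (ε / 2) ∩ range I, ?_,
    (isCompact_closedBall y _).inter_right I.isClosed_range, fun z hz => h ⟨?_, hz.2⟩⟩
  · rw [nhdsWithin_localDomain hy]
    exact inter_mem (mem_nhdsWithin_of_mem_nhds (Metric.closedBall_mem_nhds _ (by positivity)))
      self_mem_nhdsWithin
  · exact Metric.closedBall_subset_ball (by linarith) hz.1

lemma contMDiffWithinAt_range_iff {x₀ x : M} [IsManifold I ∞ M] {f : M → F}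
    (hx : x ∈ (extChartAt I x₀).source) :
    ContMDiffAt I 𝓘(ℝ, F) ∞ f x ↔
      ContDiffWithinAt ℝ ∞ (f ∘ (extChartAt I x₀).symm) (range I) (extChartAt I x₀ x) := by
  rw [contMDiffAt_iff_source_of_mem_source (by rwa [← extChartAt_source I]),
    contMDiffWithinAt_iff_contDiffWithinAt]

/-- At the base point of the chart, smoothness of a section is smoothness of its local
expression. -/
lemma contMDiffAt_iff_contDiffWithinAt_localRep [IsManifold I ∞ M] {s : ∀ x, V x} (x : M) :
    ContMDiffAt I (I.prod 𝓘(ℝ, F)) ∞ (fun x => TotalSpace.mk' F x (s x)) x ↔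
      ContDiffWithinAt ℝ ∞ (localRep (F := F) I x s) (localDomain I F V x) (extChartAt I x x) := by
  rw [contMDiffAt_section, contMDiffWithinAt_range_iff (mem_extChartAt_source x),
    contDiffWithinAt_congr_set (nhdsWithin_eq_iff_eventuallyEq.1
      (nhdsWithin_localDomain (F := F) (V := V) (extChartAt_mem_localDomain x)).symm)]
  rfl

/-- Convergence of sections, spelled out from the definition of the topology: all derivatives of all
local expressions converge uniformly on compact sets. -/
lemma tendsto_section_iff_tendstoUniformlyOn {T : Type*} {l : Filter T} {φ : T → Cₛ^∞⟮I; F, V⟯}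
    {s : Cₛ^∞⟮I; F, V⟯} : Tendsto φ l (𝓝 s) ↔ ∀ (x₀ : M) (m : ℕ), ∀ K, IsCompact K →
      K ⊆ localDomain I F V x₀ → TendstoUniformlyOn
        (fun t => iteratedFDerivWithin ℝ m (localRep (F := F) I x₀ (fun x => φ t x))
          (localDomain I F V x₀))
        (iteratedFDerivWithin ℝ m (localRep (F := F) I x₀ (fun x => s x))
          (localDomain I F V x₀)) l K := by
  unfold instTopologicalSpaceSection
  simp only [nhds_iInf, tendsto_iInf, nhds_induced, tendsto_comap_iff,
    UniformOnFun.tendsto_iff_tendstoUniformlyOn]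
  simp only [mem_ofPred_eq, and_imp]
  rfl

/-- For sections with smooth local expressions, convergence of sections is smooth convergence of all
local expressions, since `E` is locally compact. The smoothness has to be assumed unless `V` is a
smooth vector bundle: a smooth section need only have a smooth expression near the base point of
each chart. -/
lemma tendsto_section_iff [FiniteDimensional ℝ E] {T : Type*} {l : Filter T}
    {φ : T → Cₛ^∞⟮I; F, V⟯} {s : Cₛ^∞⟮I; F, V⟯}
    (hφ : ∀ x₀, ∀ᶠ t in l, ContDiffOn ℝ ∞ (localRep (F := F) I x₀ (fun x => φ t x))
      (localDomain I F V x₀))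
    (hs : ∀ x₀, ContDiffOn ℝ ∞ (localRep (F := F) I x₀ (fun x => s x)) (localDomain I F V x₀)) :
    Tendsto φ l (𝓝 s) ↔ ∀ x₀ : M, SmoothTendsto l (localDomain I F V x₀)
      (fun t => localRep (F := F) I x₀ (fun x => φ t x))
      (localRep (F := F) I x₀ (fun x => s x)) := by
  rw [tendsto_section_iff_tendstoUniformlyOn]
  have hc : ∀ x₀ (m : ℕ), ContinuousOn (iteratedFDerivWithin ℝ m
      (localRep (F := F) I x₀ (fun x => s x)) (localDomain I F V x₀)) (localDomain I F V x₀) :=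
    fun x₀ m => (hs x₀).continuousOn_iteratedFDerivWithin (by exact_mod_cast le_top)
      (uniqueDiffOn_localDomain I F V x₀)
  constructor
  · refine fun h x₀ => ⟨hφ x₀, hs x₀, fun m y hy => ?_⟩
    obtain ⟨K, hK, hKc, hKs⟩ := exists_isCompact_mem_nhdsWithin hy
    have h1 := h x₀ m K hKc hKs
    rw [← tendstoLocallyUniformlyOn_iff_tendstoUniformlyOn_of_compact hKc,
      tendstoLocallyUniformlyOn_iff_forall_tendsto] at h1
    have h2 := h1 y (mem_of_mem_nhdsWithin hy hK)
    have h3 : 𝓝[localDomain I F V x₀] y ≤ 𝓝[K] y := nhdsWithin_le_of_mem hK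
    have h4 := h2.mono_left (prod_mono_right l h3)
    exact Tendsto.congr_dist (((hc x₀ m) y hy).tendsto.comp tendsto_snd)
      (tendsto_uniformity_iff_dist_tendsto_zero.1 h4)
  · intro h x₀ m K hKc hKs
    rw [← tendstoLocallyUniformlyOn_iff_tendstoUniformlyOn_of_compact hKc,
      tendstoLocallyUniformlyOn_iff_forall_tendsto]
    intro y hy
    have h1 := (h x₀).2.2 m y (hKs hy)
    have h2 : Tendsto (fun p : T × E => iteratedFDerivWithin ℝ m
      (localRep (F := F) I x₀ (fun x => s x)) (localDomain I F V x₀) p.2)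
        (l ×ˢ 𝓝[localDomain I F V x₀] y) (𝓝 _) := ((hc x₀ m) y (hKs hy)).tendsto.comp tendsto_snd
    exact ((h2.prodMk_nhds h1).mono_left (prod_mono_right l (nhdsWithin_mono _ hKs))).mono_right
      (nhds_le_uniformity _)

section VectorBundle

variable [∀ x, AddCommGroup (V x)] [∀ x, Module ℝ (V x)] [VectorBundle ℝ F V]

lemma localRep_add {x₀ : M} {y : E} (hy : y ∈ localDomain I F V x₀) (s t : ∀ x, V x) :
    localRep (F := F) I x₀ (fun x => s x + t x) y =
      localRep (F := F) I x₀ s y + localRep (F := F) I x₀ t y :=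
  ((trivializationAt F V x₀).linear ℝ hy.2).1 _ _

lemma localRep_smul {x₀ : M} {y : E} (hy : y ∈ localDomain I F V x₀) (c : ℝ) (s : ∀ x, V x) :
    localRep (F := F) I x₀ (fun x => c • s x) y = c • localRep (F := F) I x₀ s y :=
  ((trivializationAt F V x₀).linear ℝ hy.2).2 _ _

lemma localRep_sub {x₀ : M} {y : E} (hy : y ∈ localDomain I F V x₀) (s t : ∀ x, V x) :
    localRep (F := F) I x₀ (fun x => s x - t x) y =
      localRep (F := F) I x₀ s y - localRep (F := F) I x₀ t y := by
  simpa [sub_eq_add_neg] using (localRep_add (F := F) hy s (fun x => (-1 : ℝ) • t x)).trans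
    (congrArg _ (localRep_smul (F := F) hy (-1) t))

/-- A value of a section is determined by the local expression. -/
lemma localRep_injective {x₀ : M} {y : E} (hy : y ∈ localDomain I F V x₀) {s t : ∀ x, V x}
    (h : localRep (F := F) I x₀ s y = localRep (F := F) I x₀ t y) :
    s ((extChartAt I x₀).symm y) = t ((extChartAt I x₀).symm y) := by
  have := ((trivializationAt F V x₀).continuousLinearEquivAt ℝ _ hy.2).injective (a₁ := s _)
    (a₂ := t _)
  exact this h

/-- The section with constant local expression `v` in the chart at `x₀` (and a junk value off
the domain of the trivialization). -/
def constSection (x₀ : M) (v : F) (x : M) : V x := (trivializationAt F V x₀).symm x v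

lemma localRep_constSection {x₀ : M} {y : E} (hy : y ∈ localDomain I F V x₀) (v : F) :
    localRep (F := F) I x₀ (constSection (V := V) x₀ v) y = v := by
  simp only [localRep, constSection, TotalSpace.mk']
  rw [Trivialization.apply_mk_symm _ hy.2]

section

variable [IsManifold I ∞ M] [ContMDiffVectorBundle ∞ F V I]

lemma contMDiffAt_iff_contDiffWithinAt_localRep_of_mem {s : ∀ x, V x} {x₀ : M} {y : E}
    (hy : y ∈ localDomain I F V x₀) :
    ContMDiffAt I (I.prod 𝓘(ℝ, F)) ∞ (fun x => TotalSpace.mk' F x (s x))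
      ((extChartAt I x₀).symm y) ↔
      ContDiffWithinAt ℝ ∞ (localRep (F := F) I x₀ s) (localDomain I F V x₀) y := by
  rw [(trivializationAt F V x₀).contMDiffAt_section_iff hy.2,
    contMDiffWithinAt_range_iff ((extChartAt I x₀).map_target hy.1),
    contDiffWithinAt_congr_set (nhdsWithin_eq_iff_eventuallyEq.1 (by
      rw [(extChartAt I x₀).right_inv hy.1, nhdsWithin_localDomain hy] :
      𝓝[range I] _ = 𝓝[localDomain I F V x₀] _)), (extChartAt I x₀).right_inv hy.1]
  rfl

lemma contDiffOn_localRep (s : Cₛ^∞⟮I; F, V⟯) (x₀ : M) :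
    ContDiffOn ℝ ∞ (localRep (F := F) I x₀ (fun x => s x)) (localDomain I F V x₀) := fun _ hy =>
  (contMDiffAt_iff_contDiffWithinAt_localRep_of_mem hy).1 s.contMDiff.contMDiffAt

lemma smoothTendsto_localRep [FiniteDimensional ℝ E] {T : Type*} {l : Filter T}
    {φ : T → Cₛ^∞⟮I; F, V⟯} {s : Cₛ^∞⟮I; F, V⟯} (h : Tendsto φ l (𝓝 s)) (x₀ : M) :
    SmoothTendsto l (localDomain I F V x₀)
      (fun t => localRep (F := F) I x₀ (fun x => φ t x)) (localRep (F := F) I x₀ (fun x => s x)) :=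
  (tendsto_section_iff (fun x₀ => Eventually.of_forall fun t => contDiffOn_localRep (φ t) x₀)
    (contDiffOn_localRep s)).1 h x₀

end

/-- The transition map for local expressions. -/
lemma localRep_eq_coordChangeL {x₀ x₁ : M} {x : M} (s : ∀ x, V x)
    (h0 : x ∈ (extChartAt I x₀).source) (h0' : x ∈ (trivializationAt F V x₀).baseSet)
    (h1 : x ∈ (extChartAt I x₁).source) (h1' : x ∈ (trivializationAt F V x₁).baseSet) :
    localRep (F := F) I x₀ s (extChartAt I x₀ x) =
      (trivializationAt F V x₁).coordChangeL ℝ (trivializationAt F V x₀) x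
        (localRep (F := F) I x₁ s (extChartAt I x₁ x)) := by
  rw [localRep_extChartAt h0, localRep_extChartAt h1,
    Trivialization.coordChangeL_apply _ _ ⟨h1', h0'⟩]
  congr 2
  ext1
  · rfl
  · rw [Trivialization.symm_apply_apply_mk (trivializationAt F V x₁) h1' (s x)]

variable (I F V) in
/-- A family of functions on the chart domains is compatible if it transforms like the local
expressions of a section. -/
def IsCompatible (Θ : M → E → F) : Prop :=
  ∀ x₀ x₁ x : M, x ∈ (extChartAt I x₀).source → x ∈ (trivializationAt F V x₀).baseSet →
    x ∈ (extChartAt I x₁).source → x ∈ (trivializationAt F V x₁).baseSet →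
    Θ x₀ (extChartAt I x₀ x) = (trivializationAt F V x₁).coordChangeL ℝ (trivializationAt F V x₀) x
        (Θ x₁ (extChartAt I x₁ x))

lemma isCompatible_of_localRep {Θ : M → E → F} {s : ∀ x, V x}
    (h : ∀ x₀, EqOn (localRep (F := F) I x₀ s) (Θ x₀) (localDomain I F V x₀)) :
    IsCompatible I F V Θ := by
  intro x₀ x₁ x h0 h0' h1 h1'
  rw [← h x₀ (extChartAt_mem_localDomain_of_mem h0 h0'),
    ← h x₁ (extChartAt_mem_localDomain_of_mem h1 h1'), localRep_eq_coordChangeL s h0 h0' h1 h1']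

/-- Compatible smooth functions on the chart domains glue to a smooth section. -/
lemma exists_section_of_isCompatible [IsManifold I ∞ M] {Θ : M → E → F}
    (hc : IsCompatible I F V Θ) (hΘ : ∀ x₀, ContDiffOn ℝ ∞ (Θ x₀) (localDomain I F V x₀)) :
    ∃ s : Cₛ^∞⟮I; F, V⟯, ∀ x₀,
      EqOn (localRep (F := F) I x₀ (fun x => s x)) (Θ x₀) (localDomain I F V x₀) := by
  let s : ∀ x, V x := fun x => (trivializationAt F V x).symm x (Θ x (extChartAt I x x))
  have hs : ∀ x₀, EqOn (localRep (F := F) I x₀ s) (Θ x₀) (localDomain I F V x₀) := by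
    intro x₀ y hy
    obtain ⟨x, hx, hx', rfl⟩ : ∃ x ∈ (extChartAt I x₀).source,
        x ∈ (trivializationAt F V x₀).baseSet ∧ extChartAt I x₀ x = y :=
      ⟨_, (extChartAt I x₀).map_target hy.1, hy.2, (extChartAt I x₀).right_inv hy.1⟩
    rw [hc x₀ x x hx hx' (mem_extChartAt_source x)
        (FiberBundle.mem_baseSet_trivializationAt F V x),
      localRep_eq_coordChangeL s hx hx' (mem_extChartAt_source x)
        (FiberBundle.mem_baseSet_trivializationAt F V x),
      localRep_extChartAt (mem_extChartAt_source x)]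
    congr 1
    simp only [s]
    rw [Trivialization.apply_mk_symm _ (FiberBundle.mem_baseSet_trivializationAt F V x)]
  refine ⟨⟨s, fun x => ?_⟩, hs⟩
  rw [contMDiffAt_iff_contDiffWithinAt_localRep]
  exact ((hΘ x).congr (hs x)) _ (extChartAt_mem_localDomain x)

end VectorBundle

end LocalRep

/-! ### Smoothness of nonlinear operators between spaces of sections -/

section Operators

open Filter Set Bundle

universe u

variable {E : Type u} [NormedAddCommGroup E] [NormedSpace ℝ E]
  {H : Type*} [TopologicalSpace H] {I : ModelWithCorners ℝ E H}
  {M : Type*} [TopologicalSpace M] [ChartedSpace H M]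
  {F : Type*} [NormedAddCommGroup F] [NormedSpace ℝ F]
  {V : M → Type*} [TopologicalSpace (TotalSpace F V)]
  [∀ x, TopologicalSpace (V x)] [FiberBundle F V]
  [∀ x, AddCommGroup (V x)] [∀ x, Module ℝ (V x)] [VectorBundle ℝ F V]
  {X : Type*} [AddCommGroup X] [Module ℝ X] [TopologicalSpace X]

section

variable {F' G : Type u} [NormedAddCommGroup F'] [NormedSpace ℝ F'] [NormedAddCommGroup G]
  [NormedSpace ℝ G]

/-- The data of an operator which is given in all charts by composing the function `Ψ`, smooth on
the open set `S`, with functions `a x₀ g` on the chart domain which depend on `g` in a continuous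
affine way, with linear part `b x₀`. In the applications, `a x₀ g` is the jet of the local
expression of `g`, together with some fixed functions. -/
structure IsLocalFormula (V) [TopologicalSpace (TotalSpace F V)]
    [∀ x : M, TopologicalSpace (V x)] [FiberBundle F V] (I : ModelWithCorners ℝ E H)
    (U : Set X) (S : Set G) (Ψ : G → F) (a b : M → X → E → G) : Prop where
  isOpen : IsOpen S
  contDiffOn : ContDiffOn ℝ ∞ Ψ S
  add_smul : ∀ x₀ g w (t : ℝ), ∀ y ∈ localDomain I F V x₀,
    a x₀ (g + t • w) y = a x₀ g y + t • b x₀ w y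
  smoothTendsto : ∀ x₀, ∀ g ∈ U, SmoothTendsto (𝓝 g) (localDomain I F V x₀) (a x₀) (a x₀ g)
  smoothTendsto_linear : ∀ x₀ w, SmoothTendsto (𝓝 w) (localDomain I F V x₀) (b x₀) (b x₀ w)
  mapsTo : ∀ x₀, ∀ g ∈ U, MapsTo (a x₀ g) (localDomain I F V x₀) S

variable {U : Set X} {S : Set G} {Ψ : G → F} {a b : M → X → E → G}

/-- The local expression of the `k`-th derivative of the operator given by `Ψ`. -/
def localDeriv (Ψ : G → F) (a b : M → X → E → G) (k : ℕ) (g : X) (h : Fin k → X) (x₀ : M) (y : E) :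
    F := dirDeriv Ψ k (a x₀ g y, fun i => b x₀ (h i) y)

lemma IsLocalFormula.contDiffOn_localDeriv (hΨ : IsLocalFormula V I U S Ψ a b) (k : ℕ) {g : X}
    (hg : g ∈ U) (h : Fin k → X) (x₀ : M) :
    ContDiffOn ℝ ∞ (localDeriv Ψ a b k g h x₀) (localDomain I F V x₀) :=
  (contDiffOn_dirDeriv hΨ.isOpen hΨ.contDiffOn k).comp
    ((hΨ.smoothTendsto x₀ g hg).2.1.prodMk
      (contDiffOn_pi.2 fun i => (hΨ.smoothTendsto_linear x₀ (h i)).2.1))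
    fun _ hy => ⟨hΨ.mapsTo x₀ g hg hy, mem_univ _⟩

lemma IsLocalFormula.smoothTendsto_localDeriv (hΨ : IsLocalFormula V I U S Ψ a b) (k : ℕ) {g : X}
    (hg : g ∈ U) (h : Fin k → X) (x₀ : M) :
    SmoothTendsto (𝓝[U ×ˢ univ] (g, h)) (localDomain I F V x₀)
      (fun z : X × (Fin k → X) => localDeriv Ψ a b k z.1 z.2 x₀) (localDeriv Ψ a b k g h x₀) := by
  have hΩ := uniqueDiffOn_localDomain I F V x₀
  have h1 : Tendsto (fun z : X × (Fin k → X) => z.1) (𝓝[U ×ˢ univ] (g, h)) (𝓝 g) :=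
    continuous_fst.continuousWithinAt
  have h2 : ∀ i, Tendsto (fun z : X × (Fin k → X) => z.2 i) (𝓝[U ×ˢ univ] (g, h)) (𝓝 (h i)) :=
    fun i => ((continuous_apply i).comp continuous_snd).continuousWithinAt
  refine (((hΨ.smoothTendsto x₀ g hg).comp_tendsto h1).prodMk hΩ (SmoothTendsto.pi hΩ fun i =>
    (hΨ.smoothTendsto_linear x₀ (h i)).comp_tendsto (h2 i))).comp_left hΩ
    (hΨ.isOpen.prod isOpen_univ).uniqueDiffOn (contDiffOn_dirDeriv hΨ.isOpen hΨ.contDiffOn k)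
    ?_ fun _ hy => ⟨hΨ.mapsTo x₀ g hg hy, mem_univ _⟩
  filter_upwards [eventually_mem_nhdsWithin] with z hz y hy
  exact ⟨hΨ.mapsTo x₀ z.1 hz.1 hy, mem_univ _⟩

/-- The difference quotients of the local expression of the `k`-th derivative converge smoothly to
the local expression of the next derivative. -/
lemma IsLocalFormula.smoothTendsto_slope_localDeriv (hΨ : IsLocalFormula V I U S Ψ a b)
    (e : F ≃L[ℝ] F') (hU : ∀ g ∈ U, ∀ w, ∀ᶠ t : ℝ in 𝓝 0, g + t • w ∈ U) (k : ℕ) {g : X}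
    (hg : g ∈ U) (h : Fin k → X) (w : X) (x₀ : M) :
    SmoothTendsto (𝓝[≠] (0 : ℝ)) (localDomain I F V x₀)
      (fun t y => t⁻¹ • (localDeriv Ψ a b k (g + t • w) h x₀ y - localDeriv Ψ a b k g h x₀ y))
      (localDeriv Ψ a b (k + 1) g (Fin.snoc (α := fun _ => X) h w) x₀) := by
  have hΩ := uniqueDiffOn_localDomain I F V x₀
  have := smoothTendsto_slope hΩ e (hΨ.isOpen.prod (isOpen_univ (X := Fin k → G)))
    (contDiffOn_dirDeriv hΨ.isOpen hΨ.contDiffOn k)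
    (u := fun y => (a x₀ g y, fun i => b x₀ (h i) y)) (w := fun y => (b x₀ w y, 0))
    ((hΨ.smoothTendsto x₀ g hg).2.1.prodMk
      (contDiffOn_pi.2 fun i => (hΨ.smoothTendsto_linear x₀ (h i)).2.1))
    ((hΨ.smoothTendsto_linear x₀ w).2.1.prodMk contDiffOn_const)
    (fun _ hy => ⟨hΨ.mapsTo x₀ g hg hy, mem_univ _⟩) (by
      filter_upwards [(hU g hg w).filter_mono nhdsWithin_le_nhds] with t ht y hy
      refine ⟨?_, mem_univ _⟩
      simpa [← hΨ.add_smul x₀ g w t y hy] using hΨ.mapsTo x₀ _ ht hy)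
  refine this.congr (Eventually.of_forall fun t y hy => ?_) (fun y _ => ?_)
  · simp [localDeriv, hΨ.add_smul x₀ g w t y hy]
  · simp [localDeriv, dirDeriv, Fin.init_def]

/-- The transition maps are linear, so that compatibility passes to difference quotients and, in the
limit, to derivatives. -/
lemma IsLocalFormula.isCompatible_localDeriv (hΨ : IsLocalFormula V I U S Ψ a b)
    (e : F ≃L[ℝ] F') (hU : ∀ g ∈ U, ∀ w, ∀ᶠ t : ℝ in 𝓝 0, g + t • w ∈ U)
    (hc : ∀ g ∈ U, IsCompatible I F V (fun x₀ y => Ψ (a x₀ g y))) (k : ℕ) :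
    ∀ g ∈ U, ∀ h : Fin k → X, IsCompatible I F V (localDeriv Ψ a b k g h) := by
  induction k with
  | zero => exact fun g hg h => hc g hg
  | succ k ih =>
    intro g hg h x₀ x₁ x h0 h0' h1 h1'
    rw [← Fin.snoc_init_self h]
    set w := h (Fin.last k)
    set h' : Fin k → X := Fin.init h
    have t0 := (hΨ.smoothTendsto_slope_localDeriv e hU k hg h' w x₀).tendsto_apply
      (extChartAt_mem_localDomain_of_mem h0 h0')
    have t1 := (hΨ.smoothTendsto_slope_localDeriv e hU k hg h' w x₁).tendsto_apply
      (extChartAt_mem_localDomain_of_mem h1 h1')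
    have t1' := (((trivializationAt F V x₁).coordChangeL ℝ (trivializationAt F V x₀)
      x).continuous.tendsto _).comp t1
    refine tendsto_nhds_unique t0 (t1'.congr' ?_)
    filter_upwards [(hU g hg w).filter_mono nhdsWithin_le_nhds] with t ht
    rw [ih _ ht h' x₀ x₁ x h0 h0' h1 h1', ih _ hg h' x₀ x₁ x h0 h0' h1 h1']
    simp

/-- An operator which is given in all charts by a local formula is smooth: the local expressions
`localDeriv` of its derivatives are smooth and compatible, hence glue to sections. -/
theorem IsLocalFormula.isFrechetSmoothOn [FiniteDimensional ℝ E] [IsManifold I ∞ M]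
    (hΨ : IsLocalFormula V I U S Ψ a b) (e : F ≃L[ℝ] F') (hUo : IsOpen U)
    (hU : ∀ g ∈ U, ∀ w, ∀ᶠ t : ℝ in 𝓝 0, g + t • w ∈ U) {f : X → Cₛ^∞⟮I; F, V⟯}
    (hf : ∀ g ∈ U, ∀ x₀, EqOn (localRep (F := F) I x₀ (fun x => f g x)) (fun y => Ψ (a x₀ g y))
      (localDomain I F V x₀)) : IsFrechetSmoothOn f U := by
  classical
  have hc : ∀ g ∈ U, IsCompatible I F V (fun x₀ y => Ψ (a x₀ g y)) := fun g hg =>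
    isCompatible_of_localRep (hf g hg)
  have hex : ∀ (k : ℕ) (g : X) (h : Fin k → X), ∃ s : Cₛ^∞⟮I; F, V⟯, g ∈ U → ∀ x₀,
      EqOn (localRep (F := F) I x₀ (fun x => s x)) (localDeriv Ψ a b k g h x₀)
        (localDomain I F V x₀) := by
    intro k g h
    by_cases hg : g ∈ U
    · obtain ⟨s, hs⟩ := exists_section_of_isCompatible
        (hΨ.isCompatible_localDeriv e hU hc k g hg h) (hΨ.contDiffOn_localDeriv k hg h)
      exact ⟨s, fun _ => hs⟩
    · exact ⟨0, fun h => (hg h).elim⟩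
  choose D hD using hex
  have hDs : ∀ k, ∀ g ∈ U, ∀ h x₀, ContDiffOn ℝ ∞ (localRep (F := F) I x₀ (fun x => D k g h x))
      (localDomain I F V x₀) := fun k g hg h x₀ =>
    (hΨ.contDiffOn_localDeriv k hg h x₀).congr (hD k g h hg x₀)
  refine ⟨hUo, D, fun g hg h => ?_, fun k z hz => ?_, fun k g hg h w => ?_⟩
  · ext x
    have hx := extChartAt_mem_localDomain (I := I) (F := F) (V := V) x
    have := localRep_injective hx ((hD 0 g h hg x hx).trans (hf g hg x hx).symm)
    rwa [extChartAt_to_inv] at this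
  · obtain ⟨g, h⟩ := z
    refine (tendsto_section_iff (fun x₀ => ?_) (hDs k g hz.1 h)).2 fun x₀ => ?_
    · filter_upwards [eventually_mem_nhdsWithin] with z hz using hDs k z.1 hz.1 z.2 x₀
    · refine (hΨ.smoothTendsto_localDeriv k hz.1 h x₀).congr ?_ (hD k g h hz.1 x₀)
      filter_upwards [eventually_mem_nhdsWithin] with z hz using hD k z.1 z.2 hz.1 x₀
  · have key : ∀ x₀, ∀ᶠ t : ℝ in 𝓝[≠] 0,
        EqOn (localRep (F := F) I x₀ (fun x => (t⁻¹ • (D k (g + t • w) h - D k g h)) x))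
        (fun y => t⁻¹ • (localDeriv Ψ a b k (g + t • w) h x₀ y - localDeriv Ψ a b k g h x₀ y))
        (localDomain I F V x₀) := by
      intro x₀
      filter_upwards [(hU g hg w).filter_mono nhdsWithin_le_nhds] with t ht y hy
      beta_reduce
      rw [← hD k _ h ht x₀ hy, ← hD k _ h hg x₀ hy, ← localRep_sub hy, ← localRep_smul hy]
      rfl
    refine (tendsto_section_iff (fun x₀ => ?_) (hDs _ g hg _)).2 fun x₀ => ?_
    · filter_upwards [key x₀, (hΨ.smoothTendsto_slope_localDeriv e hU k hg h w x₀).1] with t h1 h2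
      exact h2.congr h1
    · exact (hΨ.smoothTendsto_slope_localDeriv e hU k hg h w x₀).congr (key x₀)
        (hD (k + 1) g _ hg x₀)

/-- An operation which is specified pointwise by a property `P`, and for which `P` amounts to a
local formula in every chart, is well defined and smooth. -/
theorem IsLocalFormula.exists_isFrechetSmoothOn [FiniteDimensional ℝ E] [IsManifold I ∞ M]
    (hΨ : IsLocalFormula V I U S Ψ a b) (e : F ≃L[ℝ] F') (hUo : IsOpen U)
    (hU : ∀ g ∈ U, ∀ w, ∀ᶠ t : ℝ in 𝓝 0, g + t • w ∈ U) {P : X → ∀ x : M, V x → Prop}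
    (hP : ∀ g ∈ U, ∀ x₀, ∀ s : ∀ x, V x, ∀ y ∈ localDomain I F V x₀,
      P g ((extChartAt I x₀).symm y) (s ((extChartAt I x₀).symm y)) ↔
        localRep (F := F) I x₀ s y = Ψ (a x₀ g y)) :
    ∃ f : X → Cₛ^∞⟮I; F, V⟯, (∀ g ∈ U, ∀ x, P g x (f g x)) ∧ IsFrechetSmoothOn f U := by
  classical
  have hex : ∀ g : X, ∃ s : Cₛ^∞⟮I; F, V⟯, g ∈ U → (∀ x, P g x (s x)) ∧ ∀ x₀,
      EqOn (localRep (F := F) I x₀ (fun x => s x)) (fun y => Ψ (a x₀ g y))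
        (localDomain I F V x₀) := by
    intro g
    by_cases hg : g ∈ U
    -- at each point, `P` determines the value in the chart at this point
    · let s : ∀ x, V x := fun x => constSection x (Ψ (a x g (extChartAt I x x))) x
      have hs : ∀ x, P g x (s x) := fun x => by
        have hx := extChartAt_mem_localDomain (I := I) (F := F) (V := V) x
        have := (hP g hg x (constSection x (Ψ (a x g (extChartAt I x x)))) _ hx).2
          (localRep_constSection hx _)
        rwa [extChartAt_to_inv] at this
      have hs' : ∀ x₀, EqOn (localRep (F := F) I x₀ s) (fun y => Ψ (a x₀ g y))
          (localDomain I F V x₀) := fun x₀ y hy => (hP g hg x₀ s y hy).1 (hs _)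
      obtain ⟨s', hs''⟩ := exists_section_of_isCompatible (isCompatible_of_localRep hs')
        (hΨ.contDiffOn_localDeriv 0 hg Fin.elim0)
      refine ⟨s', fun _ => ⟨fun x => ?_, hs''⟩⟩
      have hx := extChartAt_mem_localDomain (I := I) (F := F) (V := V) x
      have := (hP g hg x s' _ hx).2 (hs'' x hx)
      rwa [extChartAt_to_inv] at this
    · exact ⟨0, fun h => (hg h).elim⟩
  choose f hf using hex
  exact ⟨f, fun g hg => (hf g hg).1, hΨ.isFrechetSmoothOn e hUo hU fun g hg => (hf g hg).2⟩

end

/-- A smooth map with values in a closed subspace is smooth as a map to the subspace: its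
derivatives, as limits of difference quotients, have values in the subspace. -/
lemma IsFrechetSmoothOn.codRestrict {Y : Type*} [AddCommGroup Y] [Module ℝ Y] [TopologicalSpace Y]
    {f : X → Y} {U : Set X} (hf : IsFrechetSmoothOn f U)
    (hU : ∀ g ∈ U, ∀ w, ∀ᶠ t : ℝ in 𝓝 0, g + t • w ∈ U) {Q : Submodule ℝ Y}
    (hQ : IsClosed (Q : Set Y)) (hfQ : ∀ g ∈ U, f g ∈ Q) :
    ∃ f' : X → Q, (∀ g ∈ U, (f' g : Y) = f g) ∧ IsFrechetSmoothOn f' U := by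
  classical
  obtain ⟨hUo, D, h0, hc, hd⟩ := hf
  have hDQ : ∀ k, ∀ g ∈ U, ∀ h, D k g h ∈ Q := by
    intro k
    induction k with
    | zero => exact fun g hg h => by rw [h0 g hg]; exact hfQ g hg
    | succ k ih =>
      intro g hg h
      rw [← Fin.snoc_init_self h]
      refine hQ.mem_of_tendsto (hd k g hg _ _) ?_
      filter_upwards [(hU g hg (h (Fin.last k))).filter_mono nhdsWithin_le_nhds] with t ht
      exact Q.smul_mem _ (Q.sub_mem (ih _ ht _) (ih _ hg _))
  let D' : (k : ℕ) → X → (Fin k → X) → Q := fun k g h =>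
    if hg : g ∈ U then ⟨D k g h, hDQ k g hg h⟩ else 0
  have hD' : ∀ k, ∀ g ∈ U, ∀ h, (D' k g h : Y) = D k g h := fun k g hg h => by simp [D', hg]
  refine ⟨fun g => D' 0 g Fin.elim0, fun g hg => by rw [hD' 0 g hg, h0 g hg], hUo, D',
    fun g hg h => by rw [Subsingleton.elim h Fin.elim0], fun k => ?_, fun k g hg h w => ?_⟩
  · rw [Topology.IsInducing.subtypeVal.continuousOn_iff]
    exact (hc k).congr fun z hz => hD' k z.1 hz.1 z.2
  · rw [Topology.IsInducing.subtypeVal.tendsto_nhds_iff]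
    rw [hD' _ g hg]
    refine (hd k g hg h w).congr' ?_
    filter_upwards [(hU g hg w).filter_mono nhdsWithin_le_nhds] with t ht
    simp [hD' k _ ht, hD' k g hg]

end Operators

/-! ### Tensor bundles in local coordinates -/

section LocalCoordinates

open Filter Set Bundle

variable {E : Type*} [NormedAddCommGroup E] [NormedSpace ℝ E]
  {H : Type*} [TopologicalSpace H] {I : ModelWithCorners ℝ E H}
  {M : Type*} [TopologicalSpace M] [ChartedSpace H M]
  {F : Type*} [NormedAddCommGroup F] [NormedSpace ℝ F]
  {V : M → Type*} [TopologicalSpace (TotalSpace F V)]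
  [∀ x, TopologicalSpace (V x)] [FiberBundle F V]
  {F₂ : Type*} [NormedAddCommGroup F₂] [NormedSpace ℝ F₂]
  {V₂ : M → Type*} [TopologicalSpace (TotalSpace F₂ V₂)]
  [∀ x, TopologicalSpace (V₂ x)] [FiberBundle F₂ V₂]

variable (H F V) in
/-- The preferred trivializations of the bundle `V` are defined over the chart domains. -/
class HasChartDomains : Prop where
  source_subset : ∀ x₀ : M, (chartAt H x₀).source ⊆ (trivializationAt F V x₀).baseSet

lemma localDomain_eq_target [h : HasChartDomains H F V] (x₀ : M) :
    localDomain I F V x₀ = (extChartAt I x₀).target := by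
  refine inter_eq_left.2 fun y hy => h.source_subset x₀ ?_
  rw [← extChartAt_source I]
  exact (extChartAt I x₀).map_target hy

lemma mem_localDomain [h : HasChartDomains H F V] {x₀ : M} {y : E}
    (hy : y ∈ (extChartAt I x₀).target) : y ∈ localDomain I F V x₀ := by
  rwa [localDomain_eq_target]

lemma symm_mem_baseSet [h : HasChartDomains H F V] {x₀ : M} {y : E}
    (hy : y ∈ (extChartAt I x₀).target) :
    (extChartAt I x₀).symm y ∈ (trivializationAt F V x₀).baseSet :=
  (mem_localDomain (F := F) (V := V) hy).2

instance hasChartDomains_trivial : HasChartDomains H F (Bundle.Trivial M F) :=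
  ⟨fun _ _ _ => mem_univ _⟩

instance hasChartDomains_tangent [IsManifold I ∞ M] :
    HasChartDomains H E (fun x : M => TangentSpace I x) :=
  ⟨fun _ _ hx => hx⟩

lemma localRep_trivial (f : M → F) (x₀ : M) (y : E) :
    localRep (F := F) (V := Bundle.Trivial M F) I x₀ f y = f ((extChartAt I x₀).symm y) := rfl

section VectorBundle

variable [∀ x, AddCommGroup (V x)] [∀ x, Module ℝ (V x)] [VectorBundle ℝ F V]
  [∀ x, AddCommGroup (V₂ x)] [∀ x, Module ℝ (V₂ x)] [VectorBundle ℝ F₂ V₂]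

lemma exists_constSection {x₀ : M} {y : E} (hy : y ∈ localDomain I F V x₀)
    (v : V ((extChartAt I x₀).symm y)) :
    ∃ v' : F, constSection x₀ v' ((extChartAt I x₀).symm y) = v :=
  ⟨(trivializationAt F V x₀ ⟨_, v⟩).2, Trivialization.symm_apply_apply_mk _ hy.2 v⟩

/-- A property of all elements of a fibre, in terms of the coordinates. -/
lemma forall_fiber_iff {x₀ : M} {y : E} (hy : y ∈ localDomain I F V x₀)
    {p : V ((extChartAt I x₀).symm y) → Prop} :
    (∀ v, p v) ↔ ∀ v : F, p (constSection x₀ v ((extChartAt I x₀).symm y)) :=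
  ⟨fun h v => h _, fun h v => by obtain ⟨v', rfl⟩ := exists_constSection hy v; exact h v'⟩

lemma constSection_localRep {x₀ : M} {y : E} (hy : y ∈ localDomain I F V x₀) (s : ∀ x, V x) :
    constSection x₀ (localRep (F := F) I x₀ s y) ((extChartAt I x₀).symm y) =
      s ((extChartAt I x₀).symm y) :=
  localRep_injective hy (localRep_constSection hy _)

lemma eq_constSection_iff {x₀ : M} {y : E} (hy : y ∈ localDomain I F V x₀) (s : ∀ x, V x) (v : F) :
    s ((extChartAt I x₀).symm y) = constSection x₀ v ((extChartAt I x₀).symm y) ↔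
      localRep (F := F) I x₀ s y = v := by
  constructor
  · intro h
    rw [← localRep_constSection (V := V) hy v]
    unfold localRep
    rw [h]
  · rintro rfl
    exact (constSection_localRep hy s).symm

lemma symmL_eq_constSection {x₀ x : M} (hx : x ∈ (trivializationAt F V x₀).baseSet) (v : F) :
    (trivializationAt F V x₀).symmL ℝ x v = constSection x₀ v x :=
  Trivialization.symmL_apply _ hx v

lemma constSection_add {x₀ x : M} (hx : x ∈ (trivializationAt F V x₀).baseSet) (u v : F) :
    constSection (V := V) x₀ (u + v) x = constSection x₀ u x + constSection x₀ v x := by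
  simp only [← symmL_eq_constSection hx, map_add]

lemma constSection_smul {x₀ x : M} (hx : x ∈ (trivializationAt F V x₀).baseSet) (c : ℝ) (v : F) :
    constSection (V := V) x₀ (c • v) x = c • constSection x₀ v x := by
  simp only [← symmL_eq_constSection hx, map_smul]

section Hom

variable [∀ x, IsTopologicalAddGroup (V₂ x)] [∀ x, ContinuousSMul ℝ (V₂ x)]

instance hasChartDomains_hom [h : HasChartDomains H F V] [h₂ : HasChartDomains H F₂ V₂] :
    HasChartDomains H (F →L[ℝ] F₂) (fun x => V x →L[ℝ] V₂ x) :=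
  ⟨fun x₀ _ hx => ⟨h.source_subset x₀ hx, h₂.source_subset x₀ hx⟩⟩

instance hasChartDomains_alternating {ι : Type*} [Fintype ι] [h : HasChartDomains H F V]
    [h₂ : HasChartDomains H F₂ V₂] :
    HasChartDomains H (F [⋀^ι]→L[ℝ] F₂) (fun x => V x [⋀^ι]→L[ℝ] V₂ x) :=
  ⟨fun x₀ _ hx => ⟨h.source_subset x₀ hx, h₂.source_subset x₀ hx⟩⟩

/-- The local expression of the value of a field of linear maps. -/
lemma localRep_clm_constSection {x₀ : M} {y : E} (h : y ∈ localDomain I F V x₀)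
    (h₂ : y ∈ localDomain I F₂ V₂ x₀)
    (A : ∀ x, V x →L[ℝ] V₂ x) (v : F) :
    localRep (F := F →L[ℝ] F₂) I x₀ A y v =
      localRep (F := F₂) I x₀ (fun x => A x (constSection x₀ v x)) y := by
  unfold localRep
  rw [hom_trivializationAt]
  rw [TotalSpace.mk', Trivialization.continuousLinearMap_apply]
  refine (Trivialization.continuousLinearMapAt_apply_of_mem _ _ h₂.2 _).trans ?_
  beta_reduce
  rw [← symmL_eq_constSection h.2]
  rfl

lemma localRep_clm_apply {x₀ : M} {y : E} (h : y ∈ localDomain I F V x₀)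
    (h₂ : y ∈ localDomain I F₂ V₂ x₀) (A : ∀ x, V x →L[ℝ] V₂ x) (s : ∀ x, V x) :
    localRep (F := F₂) I x₀ (fun x => A x (s x)) y =
    localRep (F := F →L[ℝ] F₂) I x₀ A y (localRep (F := F) I x₀ s y) := by
  rw [localRep_clm_constSection h h₂]
  have := constSection_localRep h s
  unfold localRep at this ⊢
  beta_reduce
  rw [this]

lemma localRep_alternating {ι : Type*} [Fintype ι] {x₀ : M} {y : E}
    (h : y ∈ localDomain I F V x₀) (h₂ : y ∈ localDomain I F₂ V₂ x₀)
    (A : ∀ x, V x [⋀^ι]→L[ℝ] V₂ x) (v : ι → F) :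
    localRep (F := F [⋀^ι]→L[ℝ] F₂) I x₀ A y v =
      localRep (F := F₂) I x₀ (fun x => A x (fun i => constSection x₀ (v i) x)) y := by
  unfold localRep
  rw [FiberBundle.trivializationAt_continuousAlternatingMap]
  rw [TotalSpace.mk', Trivialization.continuousAlternatingMap_apply]
  refine (Trivialization.continuousLinearMapAt_apply_of_mem _ _ h₂.2 _).trans ?_
  simp only [← symmL_eq_constSection h.2]
  rfl

end Hom

end VectorBundle

end LocalCoordinates

/-! ### Differentiation in local coordinates -/

section Differentiation

open Filter Set Bundle VectorField

variable {E : Type*} [NormedAddCommGroup E] [NormedSpace ℝ E]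
  {H : Type*} [TopologicalSpace H] {I : ModelWithCorners ℝ E H}
  {M : Type*} [TopologicalSpace M] [ChartedSpace H M] [IsManifold I ∞ M]

variable (I) in
lemma isManifold_one : IsManifold I 1 M := IsManifold.of_le (n := ∞) (by exact_mod_cast le_top)

lemma nhdsWithin_target {x₀ : M} {y : E} (hy : y ∈ (extChartAt I x₀).target) :
    𝓝[(extChartAt I x₀).target] y = 𝓝[range I] y :=
  nhdsWithin_extChartAt_target_eq_of_mem hy

lemma uniqueDiffOn_target (x₀ : M) : UniqueDiffOn ℝ (extChartAt I x₀).target :=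
  uniqueDiffOn_extChartAt_target x₀

lemma fderivWithin_range {F : Type*} [NormedAddCommGroup F] [NormedSpace ℝ F] {x₀ : M} {y : E}
    (hy : y ∈ (extChartAt I x₀).target) (f : E → F) :
    fderivWithin ℝ f (range I) y = fderivWithin ℝ f (extChartAt I x₀).target y :=
  fderivWithin_congr_set (nhdsWithin_eq_iff_eventuallyEq.1 (nhdsWithin_target hy).symm)

/-- The trivialization of the tangent bundle at `x₀` is the derivative of the chart at `x₀`. -/
lemma constSection_eq_mfderivWithin {x₀ : M} {y : E} (hy : y ∈ (extChartAt I x₀).target) (v : E) :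
    constSection (V := fun x : M => TangentSpace I x) x₀ v ((extChartAt I x₀).symm y) =
    mfderivWithin 𝓘(ℝ, E) I (extChartAt I x₀).symm (range I) y v := by
  have := isManifold_one I (M := M)
  have hx : (extChartAt I x₀).symm y ∈ (chartAt H x₀).source := by
    rw [← extChartAt_source I]; exact (extChartAt I x₀).map_target hy
  have h1 := TangentBundle.symmL_trivializationAt (I := I) hx
  rw [(extChartAt I x₀).right_inv hy] at h1
  rw [← symmL_eq_constSection hx]
  exact congrArg (fun L => L v) h1

lemma mpullbackWithin_extChartAt_symm {x₀ : M} {y : E} (hy : y ∈ (extChartAt I x₀).target)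
    (Y : ∀ x : M, TangentSpace I x) :
    mpullbackWithin 𝓘(ℝ, E) I (extChartAt I x₀).symm Y (range I) y =
      localRep (F := E) I x₀ Y y := by
  have := isManifold_one I (M := M)
  rw [mpullbackWithin_apply]
  have h := isInvertible_mfderivWithin_extChartAt_symm (I := I) hy
  refine h.inverse_apply_eq.2 ?_
  have h1 := constSection_localRep (F := E)
    (mem_localDomain (V := fun x : M => TangentSpace I x) hy) Y
  rw [← h1]
  exact constSection_eq_mfderivWithin hy _

/-- The derivative of a function in the chart at `x₀`. -/
lemma mvfderiv_constSection {F : Type*} [NormedAddCommGroup F] [NormedSpace ℝ F] {x₀ : M} {y : E}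
    (hy : y ∈ (extChartAt I x₀).target) {f : M → F}
    (hf : MDifferentiableAt I 𝓘(ℝ, F) f ((extChartAt I x₀).symm y)) (v : E) :
    mvfderiv I f ((extChartAt I x₀).symm y)
      (constSection (V := fun x : M => TangentSpace I x) x₀ v ((extChartAt I x₀).symm y)) =
    fderivWithin ℝ (f ∘ (extChartAt I x₀).symm) (extChartAt I x₀).target y v := by
  have := isManifold_one I (M := M)
  have hx : (extChartAt I x₀).symm y ∈ (chartAt H x₀).source := by
    rw [← extChartAt_source I]; exact (extChartAt I x₀).map_target hy
  have hr := (extChartAt I x₀).right_inv hy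
  have h2 := constSection_eq_mfderivWithin hy v
  rw [h2, ← fderivWithin_range hy]
  have h3 : MDifferentiableWithinAt 𝓘(ℝ, E) I (extChartAt I x₀).symm (range I) y :=
    mdifferentiableWithinAt_extChartAt_symm hy
  have h4 : UniqueMDiffWithinAt 𝓘(ℝ, E) (range I) y :=
    (I.uniqueDiffOn y (extChartAt_target_subset_range x₀ hy)).uniqueMDiffWithinAt
  have h5 := mfderiv_comp_mfderivWithin (I' := I) y hf h3 h4
  rw [mfderivWithin_eq_fderivWithin] at h5
  have := congrArg (fun L => L v) h5
  exact this.symm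

/-- Differentiability of a section in terms of the local expression. -/
lemma mdifferentiableAt_iff_localRep {F : Type*} [NormedAddCommGroup F] [NormedSpace ℝ F]
    {V : M → Type*} [TopologicalSpace (TotalSpace F V)] [∀ x, TopologicalSpace (V x)]
    [FiberBundle F V] [∀ x, AddCommGroup (V x)] [∀ x, Module ℝ (V x)] [VectorBundle ℝ F V]
    [ContMDiffVectorBundle ∞ F V I] [HasChartDomains H F V] {s : ∀ x, V x} {x₀ : M} {y : E}
    (hy : y ∈ (extChartAt I x₀).target) :
    MDifferentiableAt I (I.prod 𝓘(ℝ, F)) (fun x => TotalSpace.mk' F x (s x))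
      ((extChartAt I x₀).symm y) ↔
      DifferentiableWithinAt ℝ (localRep (F := F) I x₀ s) (extChartAt I x₀).target y := by
  have := isManifold_one I (M := M)
  have : ContMDiffVectorBundle 1 F V I :=
    ContMDiffVectorBundle.of_le (n := ∞) (by exact_mod_cast le_top)
  rw [(trivializationAt F V x₀).mdifferentiableAt_section_iff I s (symm_mem_baseSet hy)]
  have hx : (extChartAt I x₀).symm y ∈ (chartAt H x₀).source := by
    rw [← extChartAt_source I]; exact (extChartAt I x₀).map_target hy
  rw [mdifferentiableAt_iff_source_of_mem_source hx, (extChartAt I x₀).right_inv hy,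
    mdifferentiableWithinAt_iff_differentiableWithinAt,
    differentiableWithinAt_congr_set (nhdsWithin_eq_iff_eventuallyEq.1 (nhdsWithin_target hy).symm)]
  rfl

/-- The Lie bracket of vector fields in the chart at `x₀`. -/
lemma localRep_mlieBracket [CompleteSpace E] {x₀ : M} {y : E} (hy : y ∈ (extChartAt I x₀).target)
    {X Y : ∀ x : M, TangentSpace I x}
    (hX : MDiffAt (T% X) ((extChartAt I x₀).symm y))
    (hY : MDiffAt (T% Y) ((extChartAt I x₀).symm y)) :
    localRep (F := E) I x₀ (mlieBracket I X Y) y =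
      fderivWithin ℝ (localRep (F := E) I x₀ Y) (extChartAt I x₀).target y
        (localRep (F := E) I x₀ X y) -
      fderivWithin ℝ (localRep (F := E) I x₀ X) (extChartAt I x₀).target y
        (localRep (F := E) I x₀ Y y) := by
  have : IsManifold I (minSmoothness ℝ 2) M := by
    rw [minSmoothness_of_isRCLikeNormedField]
    exact IsManifold.of_le (n := ∞) ENat.LEInfty.out
  have hyr := extChartAt_target_subset_range x₀ hy
  -- the pullback by the inverse chart is compatible with Lie brackets
  have h1 := mpullbackWithin_mlieBracketWithin (I := 𝓘(ℝ, E)) (I' := I)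
    (f := (extChartAt I x₀).symm) (V := X) (W := Y) (s := range I) (t := univ) (x₀ := y) (n := ∞)
    (mdifferentiableWithinAt_univ.2 hX) (mdifferentiableWithinAt_univ.2 hY)
    I.uniqueDiffOn.uniqueMDiffOn
    (contMDiffWithinAt_extChartAt_symm_range x₀ hy)
    hyr (by
      rw [minSmoothness_of_isRCLikeNormedField]; exact ENat.LEInfty.out) (by simp)
    (I.range_subset_closure_interior hyr)
  rw [mlieBracketWithin_univ, mlieBracketWithin_eq_lieBracketWithin,
    mpullbackWithin_extChartAt_symm hy] at h1
  rw [h1]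
  have e : ∀ Z : ∀ x : M, TangentSpace I x,
      mpullbackWithin 𝓘(ℝ, E) I (extChartAt I x₀).symm Z (range I) =ᶠ[𝓝[range I] y]
        localRep (F := E) I x₀ Z := fun Z => by
    filter_upwards [extChartAt_target_mem_nhdsWithin_of_mem hy] with z hz
    exact mpullbackWithin_extChartAt_symm hz Z
  rw [← fderivWithin_range hy, ← fderivWithin_range hy]
  exact congrArg₂ (· - ·)
    (congrArg₂ (fun (L : E →L[ℝ] E) v => L v)
      ((e Y).fderivWithin_eq (mpullbackWithin_extChartAt_symm hy Y))
      (mpullbackWithin_extChartAt_symm hy X))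
    (congrArg₂ (fun (L : E →L[ℝ] E) v => L v)
      ((e X).fderivWithin_eq (mpullbackWithin_extChartAt_symm hy X))
      (mpullbackWithin_extChartAt_symm hy Y))

end Differentiation

/-! ### Bilinear forms of given signature -/

section Signature

open Filter Set

variable {E : Type*} [NormedAddCommGroup E] [NormedSpace ℝ E]

/-- The quadratic form `v ↦ B(v, v)`. -/
def bilinQuadForm (B : E →L[ℝ] E →L[ℝ] ℝ) : QuadraticForm ℝ E :=
  LinearMap.BilinMap.toQuadraticMap
    (LinearMap.mk₂ ℝ (fun u v : E => B u v) (by simp) (by simp) (by simp) (by simp))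

lemma bilinQuadForm_apply (B : E →L[ℝ] E →L[ℝ] ℝ) (v : E) : bilinQuadForm B v = B v v := rfl

lemma bilinQuadForm_neg (B : E →L[ℝ] E →L[ℝ] ℝ) : bilinQuadForm (-B) = -bilinQuadForm B := by
  ext v
  simp [bilinQuadForm_apply]

variable [FiniteDimensional ℝ E]

/-- A subspace on which a form is positive definite stays so under small perturbations, because the
unit sphere is compact. -/
lemma eventually_le_sigPos (B₀ : E →L[ℝ] E →L[ℝ] ℝ) :
    ∀ᶠ B in 𝓝 B₀, sigPos (bilinQuadForm B₀) ≤ sigPos (bilinQuadForm B) := by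
  obtain ⟨W, hW, hpos⟩ := exists_finrank_eq_sigPos_and_posDef (bilinQuadForm B₀)
  have hc : IsCompact (Metric.sphere (0 : W) 1) := isCompact_sphere 0 1
  have key : ∀ᶠ B in 𝓝 B₀, ∀ v ∈ Metric.sphere (0 : W) 1, 0 < B (v : E) (v : E) := by
    refine hc.eventually_forall_of_forall_eventually fun v hv => ?_
    have hv0 : v ≠ 0 := by
      rintro rfl
      simp at hv
    have h0 : 0 < B₀ (v : E) (v : E) := hpos v hv0
    have hcont : Continuous fun z : (E →L[ℝ] E →L[ℝ] ℝ) × W => z.1 (z.2 : E) (z.2 : E) := by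
      fun_prop
    exact hcont.continuousAt.eventually_const_lt h0
  filter_upwards [key] with B hB
  rw [← hW]
  refine le_sigPos_of_posDef _ fun v hv => ?_
  have hn : 0 < ‖v‖ := norm_pos_iff.2 hv
  have h1 := hB (‖v‖⁻¹ • v) (by
    rw [mem_sphere_zero_iff_norm, norm_smul, norm_inv, norm_norm, inv_mul_cancel₀ hn.ne'])
  simp only [Submodule.coe_smul, map_smul, smul_apply, smul_eq_mul] at h1
  have h2 : 0 < B (v : E) (v : E) := by
    have h3 : 0 < ‖v‖⁻¹ := inv_pos.2 hn
    exact (mul_pos_iff_of_pos_left h3).1 ((mul_pos_iff_of_pos_left h3).1 h1)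
  exact h2

lemma eventually_le_sigNeg (B₀ : E →L[ℝ] E →L[ℝ] ℝ) :
    ∀ᶠ B in 𝓝 B₀, sigNeg (bilinQuadForm B₀) ≤ sigNeg (bilinQuadForm B) := by
  have h := (continuous_neg (G := E →L[ℝ] E →L[ℝ] ℝ)).tendsto B₀ |>.eventually
    (eventually_le_sigPos (-B₀))
  simpa only [bilinQuadForm_neg, sigPos_neg] using h

/-- The forms of a given nondegenerate inertia are an open set: both indices are lower
semicontinuous, and by the law of inertia their sum is at most the dimension. -/
lemma eventually_signature_eq {p q : ℕ} (hpq : p + q = Module.finrank ℝ E)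
    {B₀ : E →L[ℝ] E →L[ℝ] ℝ} (hp : sigPos (bilinQuadForm B₀) = p)
    (hq : sigNeg (bilinQuadForm B₀) = q) :
    ∀ᶠ B in 𝓝 B₀, sigPos (bilinQuadForm B) = p ∧ sigNeg (bilinQuadForm B) = q := by
  filter_upwards [eventually_le_sigPos B₀, eventually_le_sigNeg B₀] with B h1 h2
  have := QuadraticForm.sigPos_add_sigNeg_add_radical (Q := bilinQuadForm B)
  omega

/-- A form whose inertia indices add up to the dimension has trivial radical. -/
lemma eq_zero_of_sigPos_add_sigNeg {W : Type*} [AddCommGroup W] [Module ℝ W]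
    [FiniteDimensional ℝ W] {Q : QuadraticForm ℝ W} (hQ : sigPos Q + sigNeg Q = Module.finrank ℝ W)
    {u : W} (hu : Q u = 0) (hu' : ∀ v, Q (u + v) = Q v) : u = 0 := by
  have h := QuadraticForm.sigPos_add_sigNeg_add_radical (Q := Q)
  have h1 : Q.radical = ⊥ := Submodule.finrank_eq_zero.1 (by omega)
  have h2 : u ∈ Q.radical := QuadraticMap.mem_radical_iff'.2 ⟨hu, hu'⟩
  simpa [h1] using h2

lemma isInvertible_of_forall {B : E →L[ℝ] E →L[ℝ] ℝ} (hB : ∀ u, (∀ v, B u v = 0) → u = 0) :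
    B.IsInvertible := by
  have hi : Function.Injective (B : E →ₗ[ℝ] E →L[ℝ] ℝ) := by
    rw [← LinearMap.ker_eq_bot, LinearMap.ker_eq_bot']
    exact fun u hu => hB u fun v => by simpa using congrArg (fun L => L v) hu
  have hd : Module.finrank ℝ E = Module.finrank ℝ (E →L[ℝ] ℝ) := by
    rw [← LinearEquiv.finrank_eq (LinearMap.toContinuousLinearMap (𝕜 := ℝ) (E := E) (F' := ℝ))]
    exact (Subspace.dual_finrank_eq (K := ℝ) (V := E)).symm
  let e := LinearEquiv.ofInjectiveOfFinrankEq (B : E →ₗ[ℝ] E →L[ℝ] ℝ) hi hd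
  exact ⟨e.toContinuousLinearEquiv, by ext; rfl⟩

end Signature

section Metrics

open Filter Set Bundle

variable {E : Type*} [NormedAddCommGroup E] [NormedSpace ℝ E]
  {H : Type*} [TopologicalSpace H] {I : ModelWithCorners ℝ E H}
  {M : Type*} [TopologicalSpace M] [ChartedSpace H M] [IsManifold I ∞ M]

/-- Values of bilinear forms in the chart at `x₀`. -/
lemma localRep_bilin_apply {x₀ : M} {y : E} (hy : y ∈ (extChartAt I x₀).target)
    (g : ∀ x : M, TangentSpace I x →L[ℝ] TangentSpace I x →L[ℝ] Bundle.Trivial M ℝ x) (u v : E) :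
    localRep (F := E →L[ℝ] E →L[ℝ] ℝ) I x₀ g y u v =
      (g ((extChartAt I x₀).symm y) (constSection x₀ u ((extChartAt I x₀).symm y))
        (constSection x₀ v ((extChartAt I x₀).symm y)) : ℝ) := by
  rw [localRep_clm_constSection (F := E) (V := fun x : M => TangentSpace I x)
    (mem_localDomain hy) (mem_localDomain hy),
    localRep_clm_constSection (F := E) (V := fun x : M => TangentSpace I x)
    (mem_localDomain hy) (mem_localDomain hy)]
  rfl

lemma localRep_bilin_symm (g : symBilin I M) {x₀ : M} {y : E}
    (hy : y ∈ (extChartAt I x₀).target) (u v : E) :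
    localRep (F := E →L[ℝ] E →L[ℝ] ℝ) I x₀ (fun x => g.1 x) y u v =
      localRep (F := E →L[ℝ] E →L[ℝ] ℝ) I x₀ (fun x => g.1 x) y v u := by
  rw [localRep_bilin_apply hy, localRep_bilin_apply hy]
  exact g.2 _ _ _

lemma quadForm_equivalent (g : BilinField I M) {x₀ : M} {y : E}
    (hy : y ∈ (extChartAt I x₀).target) :
    (bilinQuadForm (localRep (F := E →L[ℝ] E →L[ℝ] ℝ) I x₀ (fun x => g x) y)).Equivalent
      (quadForm g ((extChartAt I x₀).symm y)) := by
  have hb := symm_mem_baseSet (F := E) (V := fun x : M => TangentSpace I x) hy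
  let e := (trivializationAt E (fun x : M => TangentSpace I x) x₀).continuousLinearEquivAt ℝ
    ((extChartAt I x₀).symm y) hb
  refine ⟨⟨e.symm.toLinearEquiv, fun v => ?_⟩⟩
  rw [bilinQuadForm_apply, localRep_bilin_apply hy]
  have : e.symm v = constSection x₀ v ((extChartAt I x₀).symm y) := rfl
  exact congrArg (fun w => (g ((extChartAt I x₀).symm y) w w : ℝ)) this

variable [FiniteDimensional ℝ E] {p q : ℕ}

/-- The nondegeneracy follows from the inertia. -/
lemma mem_pseudoMetrics_iff (hpq : p + q = Module.finrank ℝ E) {g : symBilin I M} :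
    g ∈ pseudoMetrics I M p q ↔ ∀ x : M,
      sigPos (quadForm g.1 x) = p ∧ sigNeg (quadForm g.1 x) = q := by
  refine ⟨fun h x => (h x).2, fun h x => ⟨fun u hu => ?_, h x⟩⟩
  have : FiniteDimensional ℝ (TangentSpace I x) := inferInstanceAs (FiniteDimensional ℝ E)
  refine eq_zero_of_sigPos_add_sigNeg (Q := quadForm g.1 x) ?_ (hu u) fun v => ?_
  · rw [(h x).1, (h x).2, hpq]
    rfl
  · have h1 : g.1 x v u = 0 := (g.2 x v u).trans (hu v)
    have h2 : g.1 x (u + v) (u + v) = g.1 x v v := by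
      rw [map_add, map_add, add_apply, add_apply, hu, hu, h1]
      simp
    exact h2

lemma isInvertible_localRep {g : symBilin I M} (hg : g ∈ pseudoMetrics I M p q) {x₀ : M} {y : E}
    (hy : y ∈ (extChartAt I x₀).target) :
    (localRep (F := E →L[ℝ] E →L[ℝ] ℝ) I x₀ (fun x => g.1 x) y).IsInvertible := by
  have hb := mem_localDomain (F := E) (V := fun x : M => TangentSpace I x) hy
  refine isInvertible_of_forall fun u hu => ?_
  have h := (hg ((extChartAt I x₀).symm y)).1 (constSection x₀ u _)
    ((forall_fiber_iff hb).2 fun v =>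
      (localRep_bilin_apply hy (fun x => g.1 x) u v).symm.trans (hu v))
  have h2 := localRep_constSection (V := fun x : M => TangentSpace I x) hb u
  rw [← h2, localRep, h]
  exact ((trivializationAt E (fun x : M => TangentSpace I x) x₀).linear ℝ hb.2).map_zero

/-- Since `M` is compact, the metrics are an open set of symmetric forms. -/
lemma isOpen_pseudoMetrics [CompactSpace M] (hpq : p + q = Module.finrank ℝ E) :
    IsOpen (pseudoMetrics I M p q) := by
  rw [isOpen_iff_eventually]
  intro g hg
  have key : ∀ᶠ g' in 𝓝 g, ∀ x ∈ (univ : Set M),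
      sigPos (quadForm g'.1 x) = p ∧ sigNeg (quadForm g'.1 x) = q := by
    refine isCompact_univ.eventually_forall_of_forall_eventually fun x₁ _ => ?_
    have hy := mem_extChartAt_target (I := I) x₁
    have h1 := (smoothTendsto_localRep (continuous_subtype_val.tendsto g) x₁).tendsto
      (mem_localDomain hy)
    have he := quadForm_equivalent g.1 hy
    rw [extChartAt_to_inv] at he
    have h2 := h1.eventually (eventually_signature_eq hpq (he.sigPos_eq.trans (hg x₁).2.1)
      (he.sigNeg_eq.trans (hg x₁).2.2))
    have h3 : Tendsto (fun z : symBilin I M × M => (z.1, extChartAt I x₁ z.2)) (𝓝 (g, x₁))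
        (𝓝 g ×ˢ 𝓝[localDomain I (E →L[ℝ] E →L[ℝ] ℝ)
          (fun x : M => TangentSpace I x →L[ℝ] TangentSpace I x →L[ℝ] Bundle.Trivial M ℝ x) x₁]
          (extChartAt I x₁ x₁)) := by
      rw [nhds_prod_eq]
      refine tendsto_id.prodMap (tendsto_nhdsWithin_iff.2 ⟨continuousAt_extChartAt x₁, ?_⟩)
      filter_upwards [extChartAt_source_mem_nhds (I := I) x₁] with x hx
      exact mem_localDomain ((extChartAt I x₁).map_source hx)
    filter_upwards [h3.eventually h2, (continuous_snd.tendsto (g, x₁)).eventually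
      (extChartAt_source_mem_nhds (I := I) x₁)] with z hz hzs
    have he := quadForm_equivalent z.1.1 ((extChartAt I x₁).map_source hzs)
    rw [(extChartAt I x₁).left_inv hzs] at he
    rw [← he.sigPos_eq, ← he.sigNeg_eq]
    exact hz
  filter_upwards [key] with g' hg'
  exact (mem_pseudoMetrics_iff hpq).2 fun x => hg' x (mem_univ x)

end Metrics

/-! ### Operations on metrics given by the 2-jet of the metric -/

section Lines

open Filter Set Bundle

variable {E : Type*} [NormedAddCommGroup E] [NormedSpace ℝ E]

lemma smoothTendsto_param {F T : Type*} [NormedAddCommGroup F] [NormedSpace ℝ F] {l : Filter T}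
    {Ω : Set E} {c : T → F} {c₀ : F} (hc : Tendsto c l (𝓝 c₀)) :
    SmoothTendsto l Ω (fun t (_ : E) => c t) (fun _ => c₀) := by
  refine ⟨Eventually.of_forall fun _ => contDiffOn_const, contDiffOn_const, fun m y hy => ?_⟩
  cases m with
  | zero =>
    have h := ((continuousMultilinearCurryFin0 ℝ E F).symm.continuous.tendsto c₀).comp
      (hc.comp (tendsto_fst (g := 𝓝[Ω] y)))
    refine (h.congr fun p => ?_).trans (le_of_eq ?_) <;> simp [iteratedFDerivWithin_zero_eq_comp]
  | succ m =>
    simp only [iteratedFDerivWithin_succ_const]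
    exact tendsto_const_nhds

variable [FiniteDimensional ℝ E]
  {H : Type*} [TopologicalSpace H] {I : ModelWithCorners ℝ E H}
  {M : Type*} [TopologicalSpace M] [ChartedSpace H M] [IsManifold I ∞ M]
  {F : Type*} [NormedAddCommGroup F] [NormedSpace ℝ F]
  {V : M → Type*} [TopologicalSpace (TotalSpace F V)]
  [∀ x, TopologicalSpace (V x)] [FiberBundle F V] [∀ x, AddCommGroup (V x)] [∀ x, Module ℝ (V x)]
  [VectorBundle ℝ F V] [ContMDiffVectorBundle ∞ F V I]

lemma tendsto_add_smul_section (g w : Cₛ^∞⟮I; F, V⟯) :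
    Tendsto (fun t : ℝ => g + t • w) (𝓝 0) (𝓝 g) := by
  refine (tendsto_section_iff (fun x₀ => Eventually.of_forall fun t => contDiffOn_localRep _ x₀)
    (contDiffOn_localRep g)).2 fun x₀ => ?_
  have hΩ := uniqueDiffOn_localDomain I F V x₀
  have h1 : SmoothTendsto (𝓝 (0 : ℝ)) (localDomain I F V x₀)
      (fun t y => t • localRep (F := F) I x₀ (fun x => w x) y)
      (fun y => (0 : ℝ) • localRep (F := F) I x₀ (fun x => w x) y) :=
    ((smoothTendsto_param tendsto_id).prodMk hΩ (smoothTendsto_const hΩ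
      (contDiffOn_localRep w x₀))).comp_left hΩ uniqueDiffOn_univ
      (Ψ := fun z : ℝ × F => z.1 • z.2) (contDiff_smul.contDiffOn)
      (Eventually.of_forall fun _ => mapsTo_univ _ _) (mapsTo_univ _ _)
  refine ((smoothTendsto_const hΩ (contDiffOn_localRep g x₀)).add hΩ h1).congr
    (Eventually.of_forall fun t y hy => ?_) fun y hy => by simp
  beta_reduce
  rw [← localRep_smul hy, ← localRep_add hy]
  rfl

end Lines

section Jets

open Filter Set Bundle

universe u

variable {E : Type u} [NormedAddCommGroup E] [NormedSpace ℝ E]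
  {H : Type*} [TopologicalSpace H] {I : ModelWithCorners ℝ E H}
  {M : Type*} [TopologicalSpace M] [ChartedSpace H M] [IsManifold I ∞ M]

/-- The local expression of a metric. -/
def metricRep (x₀ : M) (g : symBilin I M) : E → E →L[ℝ] E →L[ℝ] ℝ :=
  localRep (F := E →L[ℝ] E →L[ℝ] ℝ) I x₀ (fun x => g.1 x)

/-- The first derivative of the local expression of a metric. -/
def metricRep₁ (x₀ : M) (g : symBilin I M) : E → E →L[ℝ] E →L[ℝ] E →L[ℝ] ℝ :=
  fderivWithin ℝ (metricRep x₀ g) (extChartAt I x₀).target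

/-- The second derivative of the local expression of a metric. -/
def metricRep₂ (x₀ : M) (g : symBilin I M) : E → E →L[ℝ] E →L[ℝ] E →L[ℝ] E →L[ℝ] ℝ :=
  fderivWithin ℝ (metricRep₁ x₀ g) (extChartAt I x₀).target

variable (E) in
/-- The space of 2-jets of fields of bilinear forms on `E`. -/
abbrev Jet : Type u :=
  (E →L[ℝ] E →L[ℝ] ℝ) × (E →L[ℝ] E →L[ℝ] E →L[ℝ] ℝ) × (E →L[ℝ] E →L[ℝ] E →L[ℝ] E →L[ℝ] ℝ)

/-- The 2-jet of a metric in the chart at `x₀`. -/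
def metricJet (x₀ : M) (g : symBilin I M) (y : E) : Jet E :=
  (metricRep x₀ g y, metricRep₁ x₀ g y, metricRep₂ x₀ g y)

variable (E) in
/-- The jets of metrics, with an additional parameter in `C`. -/
def metricJets (C : Type u) : Set (C × Jet E) := {z | z.2.1.IsInvertible}

lemma isOpen_metricJets [CompleteSpace E] (C : Type u) [TopologicalSpace C] :
    IsOpen (metricJets E C) := by
  have h : IsOpen (range ((↑) : (E ≃L[ℝ] E →L[ℝ] ℝ) → (E →L[ℝ] E →L[ℝ] ℝ))) :=
    ContinuousLinearEquiv.isOpen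
  exact h.preimage (continuous_fst.comp continuous_snd)

lemma contDiffOn_metricRep (g : symBilin I M) (x₀ : M) :
    ContDiffOn ℝ ∞ (metricRep x₀ g) (extChartAt I x₀).target := by
  have := contDiffOn_localRep g.1 x₀
  rwa [localDomain_eq_target] at this

lemma contDiffOn_metricRep₁ (g : symBilin I M) (x₀ : M) :
    ContDiffOn ℝ ∞ (metricRep₁ x₀ g) (extChartAt I x₀).target :=
  (contDiffOn_metricRep g x₀).fderivWithin (uniqueDiffOn_target x₀) (by simp)

lemma metricRep_add_smul (x₀ : M) (g w : symBilin I M) (t : ℝ) {y : E}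
    (hy : y ∈ (extChartAt I x₀).target) :
    metricRep x₀ (g + t • w) y = metricRep x₀ g y + t • metricRep x₀ w y := by
  unfold metricRep
  rw [← localRep_smul (mem_localDomain hy), ← localRep_add (mem_localDomain hy)]
  rfl

lemma metricJet_add_smul (x₀ : M) (g w : symBilin I M) (t : ℝ) {y : E}
    (hy : y ∈ (extChartAt I x₀).target) :
    metricJet x₀ (g + t • w) y = metricJet x₀ g y + t • metricJet x₀ w y := by
  have hu := uniqueDiffOn_target (I := I) x₀
  have key : ∀ {F : Type u} [NormedAddCommGroup F] [NormedSpace ℝ F] {a b c : E → F},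
      (∀ y ∈ (extChartAt I x₀).target, a y = b y + t • c y) →
      ContDiffOn ℝ ∞ b (extChartAt I x₀).target → ContDiffOn ℝ ∞ c (extChartAt I x₀).target →
      ∀ y ∈ (extChartAt I x₀).target, fderivWithin ℝ a (extChartAt I x₀).target y =
        fderivWithin ℝ b (extChartAt I x₀).target y +
        t • fderivWithin ℝ c (extChartAt I x₀).target y := by
    intro F _ _ a b c habc hb hc y hy
    have hb' := (hb.differentiableOn (by simp)) y hy
    have hc' := (hc.differentiableOn (by simp)) y hy
    have htc : DifferentiableWithinAt ℝ (fun y => t • c y) (extChartAt I x₀).target y :=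
      hc'.const_smul t
    rw [fderivWithin_congr habc (habc y hy), fderivWithin_fun_add (hu y hy) hb' htc,
      fderivWithin_fun_const_smul (hu y hy) hc']
  have h1 := key (fun y hy => metricRep_add_smul x₀ g w t hy) (contDiffOn_metricRep g x₀)
    (contDiffOn_metricRep w x₀)
  have h2 := key h1 (contDiffOn_metricRep₁ g x₀) (contDiffOn_metricRep₁ w x₀)
  exact Prod.ext (metricRep_add_smul x₀ g w t hy) (Prod.ext (h1 y hy) (h2 y hy))

variable [FiniteDimensional ℝ E]

lemma smoothTendsto_metricJet (x₀ : M) (g : symBilin I M) :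
    SmoothTendsto (𝓝 g) (extChartAt I x₀).target (metricJet x₀) (metricJet x₀ g) := by
  have hu := uniqueDiffOn_target (I := I) x₀
  have h := smoothTendsto_localRep (continuous_subtype_val.tendsto g) x₀
  rw [localDomain_eq_target] at h
  exact h.prodMk hu ((h.fderivWithin hu).prodMk hu ((h.fderivWithin hu).fderivWithin hu))

variable [CompactSpace M] {p q : ℕ}

lemma eventually_add_smul_mem_pseudoMetrics (hpq : p + q = Module.finrank ℝ E) :
    ∀ g ∈ pseudoMetrics I M p q, ∀ w, ∀ᶠ t : ℝ in 𝓝 0, g + t • w ∈ pseudoMetrics I M p q := by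
  intro g hg w
  have h : Tendsto (fun t : ℝ => g + t • w) (𝓝 0) (𝓝 g) := by
    rw [Topology.IsInducing.subtypeVal.tendsto_nhds_iff]
    exact tendsto_add_smul_section g.1 w.1
  exact h.eventually ((isOpen_pseudoMetrics hpq).eventually_mem hg)

/-- An operation on metrics which is pointwise and in every chart given by a smooth function of the
2-jet of the metric (and of some fixed smooth functions `c` on the chart domain) is well defined and
smooth. The result may be defined on another manifold `M'`: `τ x₀` then expresses the map from `M'`
to `M` in the charts at `x₀` and at `β x₀`. The equivalence `e` only provides a copy of `F` in the
universe of `E`. -/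
theorem exists_isFrechetSmoothOn_of_jet (hpq : p + q = Module.finrank ℝ E)
    {M' : Type*} [TopologicalSpace M'] [ChartedSpace H M'] [IsManifold I ∞ M']
    {F : Type*} [NormedAddCommGroup F] [NormedSpace ℝ F] {F' : Type u} [NormedAddCommGroup F']
    [NormedSpace ℝ F'] (e : F ≃L[ℝ] F')
    {V : M' → Type*} [TopologicalSpace (TotalSpace F V)] [∀ x, TopologicalSpace (V x)]
    [FiberBundle F V] [∀ x, AddCommGroup (V x)] [∀ x, Module ℝ (V x)] [VectorBundle ℝ F V]
    [HasChartDomains H F V] {C : Type u} [NormedAddCommGroup C] [NormedSpace ℝ C]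
    {Ψ : C × Jet E → F} (hΨ : ContDiffOn ℝ ∞ Ψ (metricJets E C))
    (β : M' → M) (τ : M' → E → E) (hτ : ∀ x₀, ContDiffOn ℝ ∞ (τ x₀) (extChartAt I x₀).target)
    (hτm : ∀ x₀, MapsTo (τ x₀) (extChartAt I x₀).target (extChartAt I (β x₀)).target)
    (c : M' → E → C) (hc : ∀ x₀, ContDiffOn ℝ ∞ (c x₀) (extChartAt I x₀).target)
    {P : symBilin I M → ∀ x : M', V x → Prop}
    (hP : ∀ g ∈ pseudoMetrics I M p q, ∀ x₀, ∀ s : ∀ x, V x, ∀ y ∈ (extChartAt I x₀).target,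
      P g ((extChartAt I x₀).symm y) (s ((extChartAt I x₀).symm y)) ↔
        localRep (F := F) I x₀ s y = Ψ (c x₀ y, metricJet (β x₀) g (τ x₀ y))) :
    ∃ f : symBilin I M → Cₛ^∞⟮I; F, V⟯, (∀ g ∈ pseudoMetrics I M p q, ∀ x, P g x (f g x)) ∧
      IsFrechetSmoothOn f (pseudoMetrics I M p q) := by
  have : CompleteSpace E := FiniteDimensional.complete ℝ E
  have hd : ∀ x₀, localDomain I F V x₀ = (extChartAt I x₀).target := localDomain_eq_target
  have hj : ∀ x₀ (g : symBilin I M), SmoothTendsto (𝓝 g) (extChartAt I x₀).target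
      (fun g y => metricJet (β x₀) g (τ x₀ y)) (fun y => metricJet (β x₀) g (τ x₀ y)) := by
    intro x₀ g
    have hu := uniqueDiffOn_target (I := I) x₀
    exact (smoothTendsto_metricJet (β x₀) g).comp hu (uniqueDiffOn_target (β x₀))
      (smoothTendsto_const hu (hτ x₀)) (Eventually.of_forall fun _ => hτm x₀) (hτm x₀)
  have hL : IsLocalFormula V I (pseudoMetrics I M p q) (metricJets E C) Ψ
      (fun x₀ g y => (c x₀ y, metricJet (β x₀) g (τ x₀ y)))
      (fun x₀ g y => (0, metricJet (β x₀) g (τ x₀ y))) := by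
    refine ⟨isOpen_metricJets C, hΨ, fun x₀ g w t y hy => ?_, fun x₀ g _ => ?_, fun x₀ w => ?_,
      fun x₀ g hg y hy => ?_⟩
    · rw [hd] at hy
      simp [metricJet_add_smul (β x₀) g w t (hτm x₀ hy)]
    · rw [hd]
      exact (smoothTendsto_const (uniqueDiffOn_target x₀) (hc x₀)).prodMk (uniqueDiffOn_target x₀)
        (hj x₀ g)
    · rw [hd]
      exact (smoothTendsto_const (uniqueDiffOn_target x₀) contDiffOn_const).prodMk
        (uniqueDiffOn_target x₀) (hj x₀ w)
    · rw [hd] at hy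
      exact isInvertible_localRep hg (hτm x₀ hy)
  exact hL.exists_isFrechetSmoothOn e (isOpen_pseudoMetrics hpq)
    (eventually_add_smul_mem_pseudoMetrics hpq)
    fun g hg x₀ s y hy => hP g hg x₀ s y (by rwa [hd] at hy)

/-- The case `M' = M` of `exists_isFrechetSmoothOn_of_jet`. -/
theorem exists_isFrechetSmoothOn_of_jet' (hpq : p + q = Module.finrank ℝ E)
    {F : Type*} [NormedAddCommGroup F] [NormedSpace ℝ F] {F' : Type u} [NormedAddCommGroup F']
    [NormedSpace ℝ F'] (e : F ≃L[ℝ] F')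
    {V : M → Type*} [TopologicalSpace (TotalSpace F V)] [∀ x, TopologicalSpace (V x)]
    [FiberBundle F V] [∀ x, AddCommGroup (V x)] [∀ x, Module ℝ (V x)] [VectorBundle ℝ F V]
    [HasChartDomains H F V] {C : Type u} [NormedAddCommGroup C] [NormedSpace ℝ C]
    {Ψ : C × Jet E → F} (hΨ : ContDiffOn ℝ ∞ Ψ (metricJets E C))
    (c : M → E → C) (hc : ∀ x₀, ContDiffOn ℝ ∞ (c x₀) (extChartAt I x₀).target)
    {P : symBilin I M → ∀ x : M, V x → Prop}
    (hP : ∀ g ∈ pseudoMetrics I M p q, ∀ x₀, ∀ s : ∀ x, V x, ∀ y ∈ (extChartAt I x₀).target,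
      P g ((extChartAt I x₀).symm y) (s ((extChartAt I x₀).symm y)) ↔
        localRep (F := F) I x₀ s y = Ψ (c x₀ y, metricJet x₀ g y)) :
    ∃ f : symBilin I M → Cₛ^∞⟮I; F, V⟯, (∀ g ∈ pseudoMetrics I M p q, ∀ x, P g x (f g x)) ∧
      IsFrechetSmoothOn f (pseudoMetrics I M p q) :=
  exists_isFrechetSmoothOn_of_jet hpq e hΨ id (fun _ => id) (fun _ => contDiffOn_id)
    (fun _ => mapsTo_id _) c hc hP

end Jets

/-! ### Riemannian geometry in coordinates -/

section Algebra

open Filter Set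

universe u

variable {E : Type u} [NormedAddCommGroup E] [NormedSpace ℝ E]
  {F : Type*} [NormedAddCommGroup F] [NormedSpace ℝ F]

/-- The cyclic permutation `(v, w, u) ↦ T(u, v, w)` of the arguments of a trilinear map. -/
def cyclicPerm (T : E →L[ℝ] E →L[ℝ] E →L[ℝ] F) : E →L[ℝ] E →L[ℝ] E →L[ℝ] F :=
  ((ContinuousLinearMap.flipₗᵢ ℝ E E F : (E →L[ℝ] E →L[ℝ] F) →L[ℝ] E →L[ℝ] E →L[ℝ] F)).comp T.flip

@[simp] lemma cyclicPerm_apply (T : E →L[ℝ] E →L[ℝ] E →L[ℝ] F) (u v w : E) :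
    cyclicPerm T v w u = T u v w := rfl

section ContDiff

variable {G E₁ E₂ F₁ F₂ : Type*} [NormedAddCommGroup G] [NormedSpace ℝ G]
  [NormedAddCommGroup E₁] [NormedSpace ℝ E₁] [NormedAddCommGroup E₂] [NormedSpace ℝ E₂]
  [NormedAddCommGroup F₁] [NormedSpace ℝ F₁] [NormedAddCommGroup F₂] [NormedSpace ℝ F₂] {s : Set G}

lemma contDiffOn_clm_flip {f : G → E₁ →L[ℝ] E₂ →L[ℝ] F₁} (hf : ContDiffOn ℝ ∞ f s) :
    ContDiffOn ℝ ∞ (fun z => (f z).flip) s :=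
  (ContinuousLinearMap.flipₗᵢ ℝ E₁ E₂ F₁).contDiff.comp_contDiffOn hf

lemma contDiffOn_compL_comp {f : G → F₁ →L[ℝ] F₂} (hf : ContDiffOn ℝ ∞ f s)
    {k : G → E₁ →L[ℝ] E₂ →L[ℝ] F₁} (hk : ContDiffOn ℝ ∞ k s) :
    ContDiffOn ℝ ∞ (fun z => (ContinuousLinearMap.compL ℝ E₂ F₁ F₂ (f z)).comp (k z)) s :=
  ((ContinuousLinearMap.compL ℝ E₂ F₁ F₂).contDiff.comp_contDiffOn hf).clm_comp hk

lemma contDiffOn_clm_prod {f : G → E₁ →L[ℝ] F₁} (hf : ContDiffOn ℝ ∞ f s)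
    {k : G → E₁ →L[ℝ] F₂} (hk : ContDiffOn ℝ ∞ k s) :
    ContDiffOn ℝ ∞ (fun z => (f z).prod (k z)) s := by
  have h : ∀ z, (f z).prod (k z) = (ContinuousLinearMap.inl ℝ F₁ F₂).comp (f z) +
      (ContinuousLinearMap.inr ℝ F₁ F₂).comp (k z) := fun z => by
    ext <;> simp
  simp only [h]
  exact (contDiffOn_const.clm_comp hf).add (contDiffOn_const.clm_comp hk)

lemma contDiffOn_cyclicPerm {T : G → E →L[ℝ] E →L[ℝ] E →L[ℝ] F} (hT : ContDiffOn ℝ ∞ T s) :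
    ContDiffOn ℝ ∞ (fun z => cyclicPerm (T z)) s :=
  contDiffOn_const.clm_comp (contDiffOn_clm_flip hT)

end ContDiff

/-- The right hand side of the Koszul formula,
`(u, v, w) ↦ (B'(u)(v, w) + B'(v)(u, w) - B'(w)(u, v)) / 2`. -/
def koszulForm (B' : E →L[ℝ] E →L[ℝ] E →L[ℝ] ℝ) : E →L[ℝ] E →L[ℝ] E →L[ℝ] ℝ :=
  (1 / 2 : ℝ) • (B' + B'.flip - cyclicPerm B')

lemma koszulForm_apply (B' : E →L[ℝ] E →L[ℝ] E →L[ℝ] ℝ) (u v w : E) :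
    koszulForm B' u v w = (1 / 2) * (B' u v w + B' v u w - B' w u v) := rfl

lemma contDiffOn_koszulForm {G : Type*} [NormedAddCommGroup G] [NormedSpace ℝ G] {s : Set G}
    {T : G → E →L[ℝ] E →L[ℝ] E →L[ℝ] ℝ} (hT : ContDiffOn ℝ ∞ T s) :
    ContDiffOn ℝ ∞ (fun z => koszulForm (T z)) s :=
  ((hT.add (contDiffOn_clm_flip hT)).sub (contDiffOn_cyclicPerm hT)).const_smul (1 / 2 : ℝ)

/-- The Christoffel symbols of a metric with value `B` and derivative `B'`. -/
def christoffel (B : E →L[ℝ] E →L[ℝ] ℝ) (B' : E →L[ℝ] E →L[ℝ] E →L[ℝ] ℝ) : E →L[ℝ] E →L[ℝ] E :=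
  (ContinuousLinearMap.compL ℝ E (E →L[ℝ] ℝ) E B.inverse).comp (koszulForm B')

lemma apply_inverse {B : E →L[ℝ] E →L[ℝ] ℝ} (hB : B.IsInvertible) (α : E →L[ℝ] ℝ) :
    B (B.inverse α) = α := by
  obtain ⟨e, rfl⟩ := hB
  simp

lemma inverse_apply {B : E →L[ℝ] E →L[ℝ] ℝ} (hB : B.IsInvertible) (u : E) :
    B.inverse (B u) = u := by
  obtain ⟨e, rfl⟩ := hB
  simp

lemma apply_christoffel {B : E →L[ℝ] E →L[ℝ] ℝ} (hB : B.IsInvertible)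
    (B' : E →L[ℝ] E →L[ℝ] E →L[ℝ] ℝ) (u v : E) :
    B (christoffel B B' u v) = koszulForm B' u v := apply_inverse hB _

lemma eq_of_forall_apply_eq {B : E →L[ℝ] E →L[ℝ] ℝ} (hB : B.IsInvertible) {u v : E}
    (h : ∀ w, B u w = B v w) : u = v := by
  rw [← inverse_apply hB u, ← inverse_apply hB v, ContinuousLinearMap.ext h]

lemma christoffel_symm {B : E →L[ℝ] E →L[ℝ] ℝ} {B' : E →L[ℝ] E →L[ℝ] E →L[ℝ] ℝ}
    (hB' : ∀ u v w, B' u v w = B' u w v) (u v : E) :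
    christoffel B B' u v = christoffel B B' v u := by
  have : koszulForm B' u v = koszulForm B' v u := by
    ext w
    rw [koszulForm_apply, koszulForm_apply, hB' w u v]
    ring
  exact congrArg B.inverse this

lemma christoffel_metric {B : E →L[ℝ] E →L[ℝ] ℝ} (hB : B.IsInvertible)
    (hs : ∀ u v, B u v = B v u) {B' : E →L[ℝ] E →L[ℝ] E →L[ℝ] ℝ}
    (hB' : ∀ u v w, B' u v w = B' u w v) (u v w : E) :
    B' u v w = B (christoffel B B' u v) w + B v (christoffel B B' u w) := by
  rw [hs v, apply_christoffel hB, apply_christoffel hB, koszulForm_apply, koszulForm_apply,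
    hB' w u v, hB' v u w, hB' u w v]
  ring

lemma contDiffOn_inverse [CompleteSpace E] :
    ContDiffOn ℝ ∞ (fun B : E →L[ℝ] E →L[ℝ] ℝ => B.inverse) {B | B.IsInvertible} := by
  rintro B ⟨e, rfl⟩
  exact (contDiffAt_map_inverse e).contDiffWithinAt

lemma contDiffOn_christoffel [CompleteSpace E] :
    ContDiffOn ℝ ∞ (fun z : (E →L[ℝ] E →L[ℝ] ℝ) × (E →L[ℝ] E →L[ℝ] E →L[ℝ] ℝ) =>
      christoffel z.1 z.2) {z | z.1.IsInvertible} := by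
  have h1 : ContDiffOn ℝ ∞ (fun z : (E →L[ℝ] E →L[ℝ] ℝ) × (E →L[ℝ] E →L[ℝ] E →L[ℝ] ℝ) =>
      z.1.inverse) {z | z.1.IsInvertible} := contDiffOn_inverse.comp contDiffOn_fst fun _ h => h
  exact contDiffOn_compL_comp h1 (contDiffOn_koszulForm contDiffOn_snd)

/-- The derivative of the Christoffel symbols of a metric with the given 2-jet, by the chain
rule. -/
def christoffelDeriv (j : Jet E) : E →L[ℝ] E →L[ℝ] E →L[ℝ] E :=
  (fderiv ℝ (fun z : (E →L[ℝ] E →L[ℝ] ℝ) × (E →L[ℝ] E →L[ℝ] E →L[ℝ] ℝ) =>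
    christoffel z.1 z.2) (j.1, j.2.1)).comp (j.2.1.prod j.2.2)

/-- The trilinear map `(u, v, w) ↦ Γ(u, Γ(v, w))`. -/
def christoffelSq (Γ : E →L[ℝ] E →L[ℝ] E) : E →L[ℝ] E →L[ℝ] E →L[ℝ] E :=
  ((((ContinuousLinearMap.compL ℝ E E E).comp Γ).flip).comp Γ).flip

lemma contDiffOn_christoffelSq {G : Type*} [NormedAddCommGroup G] [NormedSpace ℝ G] {s : Set G}
    {Γ : G → E →L[ℝ] E →L[ℝ] E} (hΓ : ContDiffOn ℝ ∞ Γ s) :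
    ContDiffOn ℝ ∞ (fun z => christoffelSq (Γ z)) s :=
  contDiffOn_clm_flip ((contDiffOn_clm_flip (contDiffOn_const.clm_comp hΓ)).clm_comp hΓ)

/-- The curvature with given Christoffel symbols `Γ` and derivative `Γ'` of the Christoffel
symbols. -/
def curvature (Γ : E →L[ℝ] E →L[ℝ] E) (Γ' : E →L[ℝ] E →L[ℝ] E →L[ℝ] E) :
    E →L[ℝ] E →L[ℝ] E →L[ℝ] E :=
  Γ' - Γ'.flip + christoffelSq Γ - (christoffelSq Γ).flip

lemma curvature_apply (Γ : E →L[ℝ] E →L[ℝ] E) (Γ' : E →L[ℝ] E →L[ℝ] E →L[ℝ] E) (u v w : E) :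
    curvature Γ Γ' u v w = Γ' u v w - Γ' v u w + Γ u (Γ v w) - Γ v (Γ u w) := rfl

lemma contDiffOn_curvature {G : Type*} [NormedAddCommGroup G] [NormedSpace ℝ G] {s : Set G}
    {Γ : G → E →L[ℝ] E →L[ℝ] E} (hΓ : ContDiffOn ℝ ∞ Γ s) {Γ' : G → E →L[ℝ] E →L[ℝ] E →L[ℝ] E}
    (hΓ' : ContDiffOn ℝ ∞ Γ' s) : ContDiffOn ℝ ∞ (fun z => curvature (Γ z) (Γ' z)) s :=
  ((hΓ'.sub (contDiffOn_clm_flip hΓ')).add (contDiffOn_christoffelSq hΓ)).sub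
    (contDiffOn_clm_flip (contDiffOn_christoffelSq hΓ))

/-- The Riemann curvature of a metric with the given 2-jet. -/
def jetRiem (j : Jet E) : E →L[ℝ] E →L[ℝ] E →L[ℝ] E :=
  curvature (christoffel j.1 j.2.1) (christoffelDeriv j)

variable [FiniteDimensional ℝ E]

variable (E) in
/-- The trace, as a continuous linear map. -/
def traceL : (E →L[ℝ] E) →L[ℝ] ℝ :=
  LinearMap.toContinuousLinearMap
    ((LinearMap.trace ℝ E).comp (ContinuousLinearMap.coeLM ℝ : (E →L[ℝ] E) →ₗ[ℝ] E →ₗ[ℝ] E))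

lemma traceL_apply (A : E →L[ℝ] E) : traceL E A = LinearMap.trace ℝ E (A : E →ₗ[ℝ] E) := rfl

/-- The contraction `(v, w) ↦ tr (u ↦ R(u, v)w)`. -/
def ricciContraction (R : E →L[ℝ] E →L[ℝ] E →L[ℝ] E) : E →L[ℝ] E →L[ℝ] ℝ :=
  (ContinuousLinearMap.compL ℝ E (E →L[ℝ] E) ℝ (traceL E)).comp (cyclicPerm R)

/-- The Ricci curvature of a metric with the given 2-jet. -/
def jetRic (j : Jet E) : E →L[ℝ] E →L[ℝ] ℝ := ricciContraction (jetRiem j)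

/-- The scalar curvature of a metric with the given 2-jet: the trace of the Ricci endomorphism. -/
def jetScal (j : Jet E) : ℝ := traceL E (j.1.inverse.comp (jetRic j))

section Smooth

variable (C : Type u) [NormedAddCommGroup C] [NormedSpace ℝ C]

lemma contDiffOn_jet_inverse : ContDiffOn ℝ ∞ (fun z : C × Jet E => z.2.1.inverse)
    (metricJets E C) := by
  have : CompleteSpace E := FiniteDimensional.complete ℝ E
  exact contDiffOn_inverse.comp (contDiff_fst.comp contDiff_snd).contDiffOn fun _ h => h

lemma contDiffOn_jet_christoffel :
    ContDiffOn ℝ ∞ (fun z : C × Jet E => christoffel z.2.1 z.2.2.1) (metricJets E C) := by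
  have : CompleteSpace E := FiniteDimensional.complete ℝ E
  exact contDiffOn_christoffel.comp (f := fun z : C × Jet E => (z.2.1, z.2.2.1))
    (by fun_prop) fun _ h => h

lemma contDiffOn_christoffelDeriv :
    ContDiffOn ℝ ∞ (fun z : C × Jet E => christoffelDeriv z.2) (metricJets E C) := by
  have : CompleteSpace E := FiniteDimensional.complete ℝ E
  have ho : IsOpen {z : (E →L[ℝ] E →L[ℝ] ℝ) × (E →L[ℝ] E →L[ℝ] E →L[ℝ] ℝ) | z.1.IsInvertible} := by
    have h : IsOpen (range ((↑) : (E ≃L[ℝ] E →L[ℝ] ℝ) → (E →L[ℝ] E →L[ℝ] ℝ))) :=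
      ContinuousLinearEquiv.isOpen
    exact h.preimage continuous_fst
  have h1 := (contDiffOn_christoffel (E := E)).fderiv_of_isOpen ho (m := ∞) (by simp)
  have h0 : ContDiff ℝ ∞ (fun z : C × Jet E => (z.2.1, z.2.2.1)) := by fun_prop
  have h2 := h1.comp (s := metricJets E C) h0.contDiffOn fun _ h => h
  have h3 : ContDiffOn ℝ ∞ (fun z : C × Jet E => z.2.2.1.prod z.2.2.2) (metricJets E C) := by
    have h4 : ContDiff ℝ ∞ (fun z : C × Jet E => z.2.2.1) := by fun_prop
    have h5 : ContDiff ℝ ∞ (fun z : C × Jet E => z.2.2.2) := by fun_prop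
    exact contDiffOn_clm_prod h4.contDiffOn h5.contDiffOn
  exact h2.clm_comp h3

lemma contDiffOn_jetRiem :
    ContDiffOn ℝ ∞ (fun z : C × Jet E => jetRiem z.2) (metricJets E C) :=
  contDiffOn_curvature (contDiffOn_jet_christoffel C) (contDiffOn_christoffelDeriv C)

lemma contDiffOn_jetRic :
    ContDiffOn ℝ ∞ (fun z : C × Jet E => jetRic z.2) (metricJets E C) :=
  contDiffOn_const.clm_comp (contDiffOn_cyclicPerm (contDiffOn_jetRiem C))

lemma contDiffOn_jetScal :
    ContDiffOn ℝ ∞ (fun z : C × Jet E => jetScal z.2) (metricJets E C) :=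
  (traceL E).contDiff.comp_contDiffOn ((contDiffOn_jet_inverse C).clm_comp (contDiffOn_jetRic C))

end Smooth

/-- An endomorphism `A` which is skew with respect to a nondegenerate form is traceless: the form
conjugates `A` to `-Aᵀ`. -/
lemma traceL_eq_zero_of_skew {B : E →L[ℝ] E →L[ℝ] ℝ} (hB : B.IsInvertible) {A : E →L[ℝ] E}
    (hA : ∀ u v, B (A u) v = -B u (A v)) : traceL E A = 0 := by
  obtain ⟨e, rfl⟩ := hB
  let e' : E ≃ₗ[ℝ] Module.Dual ℝ E := e.toLinearEquiv.trans
    (LinearMap.toContinuousLinearMap (𝕜 := ℝ) (E := E) (F' := ℝ)).symm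
  have h1 : e'.conj (A : E →ₗ[ℝ] E) = -Module.Dual.transpose (A : E →ₗ[ℝ] E) := by
    ext α v
    obtain ⟨u, rfl⟩ := e'.surjective α
    have h : e'.symm (e' u) = u := e'.symm_apply_apply u
    rw [LinearEquiv.conj_apply_apply, h]
    exact hA u v
  have h2 := LinearMap.trace_conj' (A : E →ₗ[ℝ] E) e'
  rw [h1, map_neg, LinearMap.trace_transpose'] at h2
  rw [traceL_apply]
  linarith

end Algebra

section LocalGeometry

open Filter Set

universe u

variable {E : Type u} [NormedAddCommGroup E] [NormedSpace ℝ E]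

/-- `G` is a pseudo-Riemannian metric on the domain `Ω` of `E`, which may have boundary points. The
first two conditions on `Ω` provide unique derivatives and the symmetry of second derivatives. -/
structure IsLocalMetric (Ω : Set E) (G : E → E →L[ℝ] E →L[ℝ] ℝ) : Prop where
  uniqueDiffOn : UniqueDiffOn ℝ Ω
  subset_closure : Ω ⊆ closure (interior Ω)
  contDiffOn : ContDiffOn ℝ ∞ G Ω
  symm : ∀ y ∈ Ω, ∀ u v, G y u v = G y v u
  isInvertible : ∀ y ∈ Ω, (G y).IsInvertible

/-- The Christoffel symbols of the metric `G` on `Ω`. -/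
def christoffelOn (Ω : Set E) (G : E → E →L[ℝ] E →L[ℝ] ℝ) (y : E) : E →L[ℝ] E →L[ℝ] E :=
  christoffel (G y) (fderivWithin ℝ G Ω y)

/-- The 2-jet of `G`. -/
def jetOn (Ω : Set E) (G : E → E →L[ℝ] E →L[ℝ] ℝ) (y : E) : Jet E :=
  (G y, fderivWithin ℝ G Ω y, fderivWithin ℝ (fderivWithin ℝ G Ω) Ω y)

/-- The covariant derivative `DY(u) + Γ(u, Y)` of a vector-valued function with respect to the
connection form `Γ`. -/
def localCov {F : Type*} [NormedAddCommGroup F] [NormedSpace ℝ F] (Ω : Set E)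
    (Γ : E → E →L[ℝ] F →L[ℝ] F) (Y : E → F) (y : E) : E →L[ℝ] F :=
  fderivWithin ℝ Y Ω y + (Γ y).flip (Y y)

lemma localCov_apply {F : Type*} [NormedAddCommGroup F] [NormedSpace ℝ F] (Ω : Set E)
    (Γ : E → E →L[ℝ] F →L[ℝ] F) (Y : E → F) (y u : E) :
    localCov Ω Γ Y y u = fderivWithin ℝ Y Ω y u + Γ y u (Y y) := rfl

variable {Ω : Set E} {G : E → E →L[ℝ] E →L[ℝ] ℝ} {y : E}

namespace IsLocalMetric

lemma differentiableWithinAt (hG : IsLocalMetric Ω G) (hy : y ∈ Ω) :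
    DifferentiableWithinAt ℝ G Ω y := hG.contDiffOn.differentiableOn (by simp) y hy

lemma contDiffOn_fderivWithin (hG : IsLocalMetric Ω G) :
    ContDiffOn ℝ ∞ (fderivWithin ℝ G Ω) Ω := hG.contDiffOn.fderivWithin hG.uniqueDiffOn (by simp)

/-- The derivative of a bilinear expression. -/
lemma fderivWithin_apply₂ (hΩ : UniqueDiffOn ℝ Ω) (hy : y ∈ Ω) {F F₁ F₂ : Type*}
    [NormedAddCommGroup F] [NormedSpace ℝ F] [NormedAddCommGroup F₁] [NormedSpace ℝ F₁]
    [NormedAddCommGroup F₂] [NormedSpace ℝ F₂] {B : E → F₁ →L[ℝ] F₂ →L[ℝ] F}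
    (hB : DifferentiableWithinAt ℝ B Ω y) {Y : E → F₁} {Z : E → F₂}
    (hY : DifferentiableWithinAt ℝ Y Ω y) (hZ : DifferentiableWithinAt ℝ Z Ω y) (u : E) :
    fderivWithin ℝ (fun y => B y (Y y) (Z y)) Ω y u =
      fderivWithin ℝ B Ω y u (Y y) (Z y) + B y (fderivWithin ℝ Y Ω y u) (Z y) +
        B y (Y y) (fderivWithin ℝ Z Ω y u) := by
  rw [fderivWithin_clm_apply (hΩ y hy) (hB.clm_apply hY) hZ,
    fderivWithin_clm_apply (hΩ y hy) hB hY]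
  simp
  abel

lemma fderivWithin_symm (hG : IsLocalMetric Ω G) (hy : y ∈ Ω) (u v w : E) :
    fderivWithin ℝ G Ω y u v w = fderivWithin ℝ G Ω y u w v := by
  have h : ∀ v w, fderivWithin ℝ G Ω y u v w = fderivWithin ℝ (fun y => G y v w) Ω y u := by
    intro v w
    rw [fderivWithin_apply₂ hG.uniqueDiffOn hy (hG.differentiableWithinAt hy)
      (differentiableWithinAt_const v) (differentiableWithinAt_const w)]
    simp
  rw [h, h, fderivWithin_congr (fun y hy => hG.symm y hy v w) (hG.symm y hy v w)]

lemma christoffelOn_symm (hG : IsLocalMetric Ω G) (hy : y ∈ Ω) (u v : E) :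
    christoffelOn Ω G y u v = christoffelOn Ω G y v u :=
  christoffel_symm (hG.fderivWithin_symm hy) u v

lemma christoffelOn_metric (hG : IsLocalMetric Ω G) (hy : y ∈ Ω) (u v w : E) :
    fderivWithin ℝ G Ω y u v w =
      G y (christoffelOn Ω G y u v) w + G y v (christoffelOn Ω G y u w) :=
  christoffel_metric (hG.isInvertible y hy) (hG.symm y hy) (hG.fderivWithin_symm hy) u v w

/-- The connection given by the Christoffel symbols is compatible with the metric. -/
lemma localCov_metric (hG : IsLocalMetric Ω G) (hy : y ∈ Ω) {Y Z : E → E}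
    (hY : DifferentiableWithinAt ℝ Y Ω y) (hZ : DifferentiableWithinAt ℝ Z Ω y) (u : E) :
    fderivWithin ℝ (fun y => G y (Y y) (Z y)) Ω y u =
      G y (localCov Ω (christoffelOn Ω G) Y y u) (Z y) +
        G y (Y y) (localCov Ω (christoffelOn Ω G) Z y u) := by
  rw [fderivWithin_apply₂ hG.uniqueDiffOn hy (hG.differentiableWithinAt hy) hY hZ,
    hG.christoffelOn_metric hy, localCov_apply, localCov_apply]
  simp
  ring

variable [FiniteDimensional ℝ E]

lemma contDiffOn_christoffelOn (hG : IsLocalMetric Ω G) :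
    ContDiffOn ℝ ∞ (christoffelOn Ω G) Ω := by
  have : CompleteSpace E := FiniteDimensional.complete ℝ E
  exact (contDiffOn_christoffel (E := E)).comp (hG.contDiffOn.prodMk hG.contDiffOn_fderivWithin)
    fun y hy => hG.isInvertible y hy

lemma fderivWithin_christoffelOn (hG : IsLocalMetric Ω G) (hy : y ∈ Ω) :
    fderivWithin ℝ (christoffelOn Ω G) Ω y = christoffelDeriv (jetOn Ω G y) := by
  have : CompleteSpace E := FiniteDimensional.complete ℝ E
  have hd : DifferentiableAt ℝ (fun z : (E →L[ℝ] E →L[ℝ] ℝ) × (E →L[ℝ] E →L[ℝ] E →L[ℝ] ℝ) =>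
      christoffel z.1 z.2) (G y, fderivWithin ℝ G Ω y) := by
    refine ((contDiffOn_christoffel (E := E)).contDiffAt ?_).differentiableAt (by simp)
    have h : IsOpen (range ((↑) : (E ≃L[ℝ] E →L[ℝ] ℝ) → (E →L[ℝ] E →L[ℝ] ℝ))) :=
      ContinuousLinearEquiv.isOpen
    exact (h.preimage continuous_fst).mem_nhds (hG.isInvertible y hy)
  have h1 := hG.differentiableWithinAt hy
  have h2 := hG.contDiffOn_fderivWithin.differentiableOn (by simp) y hy
  have h3 := fderiv_comp_fderivWithin y hd (h1.prodMk h2) (hG.uniqueDiffOn y hy)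
  rw [DifferentiableWithinAt.fderivWithin_prodMk h1 h2 (hG.uniqueDiffOn y hy)] at h3
  exact h3

/-- The curvature in terms of the Christoffel symbols. -/
lemma jetRiem_eq (hG : IsLocalMetric Ω G) (hy : y ∈ Ω) :
    jetRiem (jetOn Ω G y) = curvature (christoffelOn Ω G y)
      (fderivWithin ℝ (christoffelOn Ω G) Ω y) := by
  rw [hG.fderivWithin_christoffelOn hy]
  rfl

lemma fderivWithin_christoffelOn_symm (hG : IsLocalMetric Ω G) (hy : y ∈ Ω) (u v w : E) :
    fderivWithin ℝ (christoffelOn Ω G) Ω y u v w =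
      fderivWithin ℝ (christoffelOn Ω G) Ω y u w v := by
  have hd := hG.contDiffOn_christoffelOn.differentiableOn (by simp) y hy
  have h : ∀ v w, fderivWithin ℝ (christoffelOn Ω G) Ω y u v w =
      fderivWithin ℝ (fun y => christoffelOn Ω G y v w) Ω y u := by
    intro v w
    rw [fderivWithin_apply₂ hG.uniqueDiffOn hy hd
      (differentiableWithinAt_const v) (differentiableWithinAt_const w)]
    simp
  rw [h, h, fderivWithin_congr (fun y hy => hG.christoffelOn_symm hy v w)
    (hG.christoffelOn_symm hy v w)]

lemma isSymmSndFDerivWithinAt (hG : IsLocalMetric Ω G) (hy : y ∈ Ω) {F : Type*}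
    [NormedAddCommGroup F] [NormedSpace ℝ F] {f : E → F} (hf : ContDiffWithinAt ℝ ∞ f Ω y) :
    IsSymmSndFDerivWithinAt ℝ f Ω y :=
  hf.isSymmSndFDerivWithinAt (by
    rw [minSmoothness_of_isRCLikeNormedField]; exact ENat.LEInfty.out) hG.uniqueDiffOn
    (hG.subset_closure hy) hy

/-- The curvature operators are skew with respect to the metric: differentiate the compatibility of
metric and Christoffel symbols, and use the symmetry of the second derivative of the metric. -/
lemma jetRiem_skew (hG : IsLocalMetric Ω G) (hy : y ∈ Ω) (u v w z : E) :
    G y (jetRiem (jetOn Ω G y) u v w) z = -G y w (jetRiem (jetOn Ω G y) u v z) := by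
  have hd := hG.contDiffOn_christoffelOn.differentiableOn (by simp) y hy
  set Γ := christoffelOn Ω G with hΓ
  have hΓd : ∀ v w, DifferentiableWithinAt ℝ (fun y => Γ y v w) Ω y := fun v w =>
    (hd.clm_apply (differentiableWithinAt_const v)).clm_apply (differentiableWithinAt_const w)
  have hΓ' : ∀ u v w, fderivWithin ℝ (fun y => Γ y v w) Ω y u = fderivWithin ℝ Γ Ω y u v w := by
    intro u v w
    rw [fderivWithin_apply₂ hG.uniqueDiffOn hy hd
      (differentiableWithinAt_const v) (differentiableWithinAt_const w)]
    simp
  have hGd := hG.differentiableWithinAt hy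
  have h2 := hG.contDiffOn_fderivWithin.differentiableOn (by simp) y hy
  -- the derivative of the identity `G'(v)(w, z) = G(Γ(v, w), z) + G(w, Γ(v, z))`
  have key : ∀ u v, fderivWithin ℝ (fderivWithin ℝ G Ω) Ω y u v w z =
      fderivWithin ℝ G Ω y u (Γ y v w) z + G y (fderivWithin ℝ Γ Ω y u v w) z +
      fderivWithin ℝ G Ω y u w (Γ y v z) + G y w (fderivWithin ℝ Γ Ω y u v z) := by
    intro u v
    have e1 : fderivWithin ℝ (fun y => fderivWithin ℝ G Ω y v w z) Ω y u =
        fderivWithin ℝ (fderivWithin ℝ G Ω) Ω y u v w z := by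
      rw [fderivWithin_apply₂ hG.uniqueDiffOn hy (h2.clm_apply (differentiableWithinAt_const v))
        (differentiableWithinAt_const w) (differentiableWithinAt_const z),
        fderivWithin_clm_apply (hG.uniqueDiffOn y hy) h2 (differentiableWithinAt_const v)]
      simp
    have e2 : fderivWithin ℝ (fun y => fderivWithin ℝ G Ω y v w z) Ω y =
        fderivWithin ℝ (fun y => G y (Γ y v w) z + G y w (Γ y v z)) Ω y :=
      fderivWithin_congr (fun y hy => hG.christoffelOn_metric hy v w z)
        (hG.christoffelOn_metric hy v w z)
    rw [← e1, e2, fderivWithin_fun_add (hG.uniqueDiffOn y hy)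
      ((hGd.clm_apply (hΓd v w)).clm_apply (differentiableWithinAt_const z))
      ((hGd.clm_apply (differentiableWithinAt_const w)).clm_apply (hΓd v z)),
      add_apply,
      fderivWithin_apply₂ hG.uniqueDiffOn hy hGd (hΓd v w) (differentiableWithinAt_const z),
      fderivWithin_apply₂ hG.uniqueDiffOn hy hGd (differentiableWithinAt_const w) (hΓd v z),
      hΓ', hΓ']
    simp
    ring
  have hs := hG.isSymmSndFDerivWithinAt hy (hG.contDiffOn y hy) u v
  have k1 := key u v
  have k2 := key v u
  rw [hs] at k1
  rw [k2] at k1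
  simp only [hG.christoffelOn_metric hy, ← hΓ] at k1
  rw [hG.jetRiem_eq hy, curvature_apply, curvature_apply]
  simp only [map_add, map_sub, add_apply, sub_apply, ← hΓ]
  linarith

/-- The Ricci curvature is symmetric: by the Bianchi identity, its skew part is the trace of a
curvature operator. -/
lemma jetRic_symm (hG : IsLocalMetric Ω G) (hy : y ∈ Ω) (v w : E) :
    jetRic (jetOn Ω G y) v w = jetRic (jetOn Ω G y) w v := by
  have h0 : traceL E (jetRiem (jetOn Ω G y) v w) = 0 :=
    traceL_eq_zero_of_skew (hG.isInvertible y hy) (hG.jetRiem_skew hy v w)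
  have h1 : cyclicPerm (jetRiem (jetOn Ω G y)) v w - cyclicPerm (jetRiem (jetOn Ω G y)) w v =
      -jetRiem (jetOn Ω G y) v w := by
    ext u
    have s := hG.fderivWithin_christoffelOn_symm hy
    have t := hG.christoffelOn_symm hy
    simp only [sub_apply, neg_apply, cyclicPerm_apply,
      hG.jetRiem_eq hy, curvature_apply]
    rw [s u w v, s v u w, s w u v, t u w, t v u, t w v, t u v]
    abel
  have h2 := congrArg (traceL E) h1
  rw [map_sub, map_neg, h0, neg_zero, sub_eq_zero] at h2
  exact h2

/-- The curvature in terms of the covariant derivatives of vector fields. -/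
lemma localCov_localCov (hG : IsLocalMetric Ω G) (hy : y ∈ Ω) {X Y Z : E → E}
    (hX : ContDiffWithinAt ℝ ∞ X Ω y) (hY : ContDiffWithinAt ℝ ∞ Y Ω y)
    (hZ : ContDiffWithinAt ℝ ∞ Z Ω y) (hZ' : ContDiffWithinAt ℝ ∞ (fderivWithin ℝ Z Ω) Ω y) :
    localCov Ω (christoffelOn Ω G) (fun y => localCov Ω (christoffelOn Ω G) Z y (Y y)) y (X y) -
      localCov Ω (christoffelOn Ω G) (fun y => localCov Ω (christoffelOn Ω G) Z y (X y)) y (Y y) -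
      localCov Ω (christoffelOn Ω G) Z y
        (fderivWithin ℝ Y Ω y (X y) - fderivWithin ℝ X Ω y (Y y)) =
      jetRiem (jetOn Ω G y) (X y) (Y y) (Z y) := by
  have hd := hG.contDiffOn_christoffelOn.differentiableOn (by simp) y hy
  have hu := hG.uniqueDiffOn y hy
  have hZd := hZ.differentiableWithinAt (by simp)
  have hZd' := hZ'.differentiableWithinAt (by simp)
  have key : ∀ {X Y : E → E}, ContDiffWithinAt ℝ ∞ Y Ω y →
      localCov Ω (christoffelOn Ω G) (fun y => localCov Ω (christoffelOn Ω G) Z y (Y y)) y (X y) =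
      fderivWithin ℝ (fderivWithin ℝ Z Ω) Ω y (X y) (Y y) +
        fderivWithin ℝ Z Ω y (fderivWithin ℝ Y Ω y (X y)) +
        (fderivWithin ℝ (christoffelOn Ω G) Ω y (X y) (Y y) (Z y) +
          christoffelOn Ω G y (fderivWithin ℝ Y Ω y (X y)) (Z y) +
          christoffelOn Ω G y (Y y) (fderivWithin ℝ Z Ω y (X y))) +
        christoffelOn Ω G y (X y)
          (fderivWithin ℝ Z Ω y (Y y) + christoffelOn Ω G y (Y y) (Z y)) := by
    intro X Y hY
    have hYd := hY.differentiableWithinAt (by simp)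
    simp only [localCov_apply]
    rw [fderivWithin_fun_add hu (hZd'.clm_apply hYd) ((hd.clm_apply hYd).clm_apply hZd),
      add_apply, fderivWithin_apply₂ hG.uniqueDiffOn hy hd hYd hZd,
      fderivWithin_clm_apply hu hZd' hYd]
    simp
    abel
  have hs := hG.isSymmSndFDerivWithinAt hy hZ (X y) (Y y)
  rw [key hY, key hX, localCov_apply, hG.jetRiem_eq hy, curvature_apply, hs]
  simp only [map_sub, map_add, sub_apply]
  abel

end IsLocalMetric

end LocalGeometry

/-! ### Connections given in the charts -/

section ChartConnections

open Filter Set Bundle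

variable {E : Type*} [NormedAddCommGroup E] [NormedSpace ℝ E]
  {H : Type*} [TopologicalSpace H] {I : ModelWithCorners ℝ E H}
  {M : Type*} [TopologicalSpace M] [ChartedSpace H M] [IsManifold I ∞ M]
  {F : Type*} [NormedAddCommGroup F] [NormedSpace ℝ F]
  {V : M → Type*} [TopologicalSpace (TotalSpace F V)]
  [∀ x, TopologicalSpace (V x)] [FiberBundle F V] [∀ x, AddCommGroup (V x)] [∀ x, Module ℝ (V x)]
  [VectorBundle ℝ F V] [ContMDiffVectorBundle ∞ F V I] [HasChartDomains H F V]

/-- Differentiability of a function in terms of the local expression. -/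
lemma mdifferentiableAt_iff_comp_symm {f : M → F} {x₀ : M} {y : E}
    (hy : y ∈ (extChartAt I x₀).target) :
    MDifferentiableAt I 𝓘(ℝ, F) f ((extChartAt I x₀).symm y) ↔
      DifferentiableWithinAt ℝ (f ∘ (extChartAt I x₀).symm) (extChartAt I x₀).target y := by
  have := isManifold_one I (M := M)
  have hx : (extChartAt I x₀).symm y ∈ (chartAt H x₀).source := by
    rw [← extChartAt_source I]; exact (extChartAt I x₀).map_target hy
  rw [mdifferentiableAt_iff_source_of_mem_source hx, (extChartAt I x₀).right_inv hy,
    mdifferentiableWithinAt_iff_differentiableWithinAt,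
    differentiableWithinAt_congr_set (nhdsWithin_eq_iff_eventuallyEq.1 (nhdsWithin_target hy).symm)]

/-- The covariant derivative of a section with respect to the connection which has the connection
form `Γ` in the chart at `x₀`. -/
def chartCov (x₀ : M) (Γ : E → E →L[ℝ] F →L[ℝ] F) (s : ∀ x, V x) (x : M) :
    TangentSpace I x →L[ℝ] V x :=
  (trivializationAt F V x₀).symmL ℝ x ∘L
    (localCov (extChartAt I x₀).target Γ (localRep (F := F) I x₀ s) (extChartAt I x₀ x)) ∘L
      (trivializationAt E (TangentSpace I) x₀).continuousLinearMapAt ℝ x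

lemma localRep_chartCov {x₀ : M} {y : E} (hy : y ∈ (extChartAt I x₀).target)
    (Γ : E → E →L[ℝ] F →L[ℝ] F) (s : ∀ x, V x) (X : ∀ x : M, TangentSpace I x) :
    localRep (F := F) I x₀ (fun x => chartCov x₀ Γ s x (X x)) y =
      localCov (extChartAt I x₀).target Γ (localRep (F := F) I x₀ s) y
        (localRep (F := E) I x₀ X y) := by
  refine (eq_constSection_iff (mem_localDomain hy) _ _).1 ?_
  rw [← symmL_eq_constSection (symm_mem_baseSet hy)]
  simp only [chartCov, ContinuousLinearMap.comp_apply, (extChartAt I x₀).right_inv hy]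
  congr 2
  exact Trivialization.continuousLinearMapAt_apply_of_mem _ _ (symm_mem_baseSet hy) _

variable [∀ x, IsTopologicalAddGroup (V x)] [∀ x, ContinuousSMul ℝ (V x)]

lemma isCovariantDerivativeOn_chartCov (x₀ : M) (Γ : E → E →L[ℝ] F →L[ℝ] F) :
    IsCovariantDerivativeOn F (fun s : ∀ x, V x => chartCov (I := I) x₀ Γ s)
      (chartAt H x₀).source := by
  have hx' : ∀ x ∈ (chartAt H x₀).source, ∃ y ∈ (extChartAt I x₀).target,
      (extChartAt I x₀).symm y = x := by
    intro x hx
    rw [← extChartAt_source I] at hx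
    exact ⟨_, (extChartAt I x₀).map_source hx, (extChartAt I x₀).left_inv hx⟩
  refine ⟨fun {s s' x} hs hs' hx => ?_, fun {s f x} hs hf hx => ?_⟩
  · obtain ⟨y, hy, rfl⟩ := hx' x hx
    have hd := (mdifferentiableAt_iff_localRep (F := F) (V := V) hy).1 hs
    have hd' := (mdifferentiableAt_iff_localRep (F := F) (V := V) hy).1 hs'
    have hu := uniqueDiffOn_target (I := I) x₀ y hy
    have e : ∀ y ∈ (extChartAt I x₀).target, localRep (F := F) I x₀ (s + s') y =
        localRep (F := F) I x₀ s y + localRep (F := F) I x₀ s' y := fun y hy =>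
      localRep_add (mem_localDomain hy) s s'
    have key : localCov (extChartAt I x₀).target Γ (localRep (F := F) I x₀ (s + s')) y =
        localCov (extChartAt I x₀).target Γ (localRep (F := F) I x₀ s) y +
        localCov (extChartAt I x₀).target Γ (localRep (F := F) I x₀ s') y := by
      unfold localCov
      rw [e y hy, fderivWithin_congr e (e y hy), fderivWithin_fun_add hu hd hd', map_add]
      abel
    ext v
    simp only [chartCov, (extChartAt I x₀).right_inv hy, key, ContinuousLinearMap.comp_apply,
      add_apply, map_add]
  · obtain ⟨y, hy, rfl⟩ := hx' x hx
    have hd := (mdifferentiableAt_iff_localRep (F := F) (V := V) hy).1 hs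
    have hfd := (mdifferentiableAt_iff_comp_symm (I := I) (f := f) hy).1 hf
    have hu := uniqueDiffOn_target (I := I) x₀ y hy
    have e : ∀ y ∈ (extChartAt I x₀).target, localRep (F := F) I x₀ (f • s) y =
        (f ∘ (extChartAt I x₀).symm) y • localRep (F := F) I x₀ s y := fun y hy =>
      localRep_smul (mem_localDomain hy) _ s
    have hb := symm_mem_baseSet (F := F) (V := V) hy
    have key : localCov (extChartAt I x₀).target Γ (localRep (F := F) I x₀ (f • s)) y =
        f ((extChartAt I x₀).symm y) •
          localCov (extChartAt I x₀).target Γ (localRep (F := F) I x₀ s) y +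
        (fderivWithin ℝ (f ∘ (extChartAt I x₀).symm) (extChartAt I x₀).target y).smulRight
          (localRep (F := F) I x₀ s y) := by
      unfold localCov
      rw [e y hy, fderivWithin_congr e (e y hy), fderivWithin_fun_smul hu hfd hd, map_smul,
        Function.comp_apply]
      module
    ext v
    obtain ⟨v', rfl⟩ := exists_constSection (mem_localDomain (F := E)
      (V := fun x : M => TangentSpace I x) hy) v
    have h1 := mvfderiv_constSection hy hf v'
    have h2 := constSection_localRep (mem_localDomain (I := I) (F := F) (V := V) hy) s
    have hb' : (extChartAt I x₀).symm y ∈ (trivializationAt E (TangentSpace I) x₀).baseSet :=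
      symm_mem_baseSet (F := E) (V := fun x : M => TangentSpace I x) hy
    have h3 : (trivializationAt E (TangentSpace I) x₀).continuousLinearMapAt ℝ
        ((extChartAt I x₀).symm y)
        (constSection (V := fun x : M => TangentSpace I x) x₀ v' ((extChartAt I x₀).symm y)) =
          v' := by
      rw [← symmL_eq_constSection hb']
      exact (trivializationAt E (TangentSpace I) x₀).continuousLinearMapAt_symmL hb' v'
    simp only [chartCov, (extChartAt I x₀).right_inv hy, key, ContinuousLinearMap.comp_apply,
      add_apply, smul_apply, ContinuousLinearMap.smulRight_apply, h3, symmL_eq_constSection hb]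
    rw [h1, constSection_add hb, constSection_smul hb, constSection_smul hb, h2]

variable (I V) in
/-- The connection which at each `x` is given by the connection form `Γ x` in the chart at `x`. The
forms `Γ x` need not be related to each other, since the axioms of a covariant derivative are
pointwise. -/
def connectionOfCharts (Γ : M → E → E →L[ℝ] F →L[ℝ] F) : CovariantDerivative I F V where
  toFun s x := chartCov x (Γ x) s x
  isCovariantDerivativeOnUniv :=
    ⟨fun {_ _ x} hs hs' _ =>
      (isCovariantDerivativeOn_chartCov x (Γ x)).add hs hs' (mem_chart_source H x),
    fun {_ _ x} hs hf _ =>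
      (isCovariantDerivativeOn_chartCov x (Γ x)).leibniz hs hf (mem_chart_source H x)⟩

end ChartConnections

/-! ### The Levi-Civita connection -/

section LeviCivita

open Filter Set Bundle VectorField

universe u

variable {E : Type u} [NormedAddCommGroup E] [NormedSpace ℝ E]
  {H : Type*} [TopologicalSpace H] {I : ModelWithCorners ℝ E H}
  {M : Type*} [TopologicalSpace M] [ChartedSpace H M] [IsManifold I ∞ M]

/-- At the point `x`, the operator `D` on vector fields is torsion-free and compatible with `g`. -/
structure IsLeviCivitaAt (g : symBilin I M) (x : M)
    (D : (∀ x : M, TangentSpace I x) → TangentSpace I x → TangentSpace I x) : Prop where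
  torsion_free : ∀ X Y : ∀ x : M, TangentSpace I x, MDiffAt (T% X) x → MDiffAt (T% Y) x →
    D Y (X x) - D X (Y x) = mlieBracket I X Y x
  compatible : ∀ (Y Z : ∀ x : M, TangentSpace I x) (X : TangentSpace I x),
    MDiffAt (T% Y) x → MDiffAt (T% Z) x →
    mvfderiv I (fun x' => (g.1 x' (Y x') (Z x') : ℝ)) x X =
      g.1 x (D Y X) (Z x) + g.1 x (Y x) (D Z X)

lemma mdifferentiableAt_constSection {x₀ : M} {y : E} (hy : y ∈ (extChartAt I x₀).target) (v : E) :
    MDiffAt (T% (constSection (V := fun x : M => TangentSpace I x) x₀ v))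
      ((extChartAt I x₀).symm y) := by
  refine (mdifferentiableAt_iff_localRep hy).2 ?_
  exact (differentiableWithinAt_const v).congr
    (fun z hz => localRep_constSection (mem_localDomain hz) v)
    (localRep_constSection (mem_localDomain hy) v)

lemma exists_mdifferentiableAt_eq {x : M} (v : TangentSpace I x) :
    ∃ X : ∀ x : M, TangentSpace I x, MDiffAt (T% X) x ∧ X x = v := by
  have hy := mem_extChartAt_target (I := I) x
  have h1 := exists_constSection (mem_localDomain (F := E) (V := fun x : M => TangentSpace I x) hy)
  have h2 := mdifferentiableAt_constSection hy
  rw [extChartAt_to_inv] at h1 h2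
  obtain ⟨v', h⟩ := h1 v
  exact ⟨_, h2 v', h⟩

/-- The uniqueness of the Levi-Civita connection: the difference of two candidates is a trilinear
form `S(X, Y, Z)` which is symmetric in `X, Y` and skew in `Y, Z`, and therefore zero. -/
lemma IsLeviCivitaAt.unique {g : symBilin I M} {x : M}
    {D D' : (∀ x : M, TangentSpace I x) → TangentSpace I x → TangentSpace I x}
    (hg : ∀ u : TangentSpace I x, (∀ v : TangentSpace I x, g.1 x u v = 0) → u = 0)
    (hD : IsLeviCivitaAt g x D) (hD' : IsLeviCivitaAt g x D') {Y : ∀ x : M, TangentSpace I x}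
    (hY : MDiffAt (T% Y) x) (X : TangentSpace I x) : D Y X = D' Y X := by
  let S (X Y Z : ∀ x : M, TangentSpace I x) : ℝ := g.1 x (D Y (X x) - D' Y (X x)) (Z x)
  have hsub : ∀ u v w : TangentSpace I x, (g.1 x (u - v) w : ℝ) = g.1 x u w - g.1 x v w :=
    fun u v w => by rw [map_sub]; rfl
  have symm : ∀ X Y Z : ∀ x : M, TangentSpace I x, MDiffAt (T% X) x → MDiffAt (T% Y) x →
      S X Y Z = S Y X Z := by
    intro X Y Z hX hY
    have h1 := (hD.torsion_free X Y hX hY).trans (hD'.torsion_free X Y hX hY).symm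
    have h2 : D Y (X x) - D' Y (X x) = D X (Y x) - D' X (Y x) := by
      rw [sub_eq_sub_iff_sub_eq_sub]
      exact h1
    exact congrArg (fun u => (g.1 x u (Z x) : ℝ)) h2
  have skew : ∀ X Y Z : ∀ x : M, TangentSpace I x, MDiffAt (T% Y) x → MDiffAt (T% Z) x →
      S X Y Z = -S X Z Y := by
    intro X Y Z hY hZ
    have h1 := (hD.compatible Y Z (X x) hY hZ).symm.trans (hD'.compatible Y Z (X x) hY hZ)
    have h2 : (g.1 x (Y x) (D Z (X x)) : ℝ) = g.1 x (D Z (X x)) (Y x) := g.2 _ _ _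
    have h3 : (g.1 x (Y x) (D' Z (X x)) : ℝ) = g.1 x (D' Z (X x)) (Y x) := g.2 _ _ _
    have h4 : (g.1 x (D Y (X x)) (Z x) : ℝ) + g.1 x (Y x) (D Z (X x)) =
      g.1 x (D' Y (X x)) (Z x) + g.1 x (Y x) (D' Z (X x)) := h1
    simp only [S, hsub]
    linarith
  obtain ⟨X, hX, rfl⟩ := exists_mdifferentiableAt_eq X
  refine sub_eq_zero.1 (hg _ fun v => ?_)
  obtain ⟨Z, hZ, rfl⟩ := exists_mdifferentiableAt_eq v
  have h1 := symm X Y Z hX hY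
  have h2 := skew Y X Z hX hZ
  have h3 := symm Y Z X hY hZ
  have h4 := skew Z Y X hY hX
  have h5 := symm Z X Y hZ hX
  have h6 := skew X Z Y hZ hY
  have h7 : S X Y Z = 0 := by linarith
  exact h7

lemma localRep_bilin {x₀ : M} {y : E} (hy : y ∈ (extChartAt I x₀).target) (g : symBilin I M)
    (Y Z : ∀ x : M, TangentSpace I x) :
    (g.1 ((extChartAt I x₀).symm y) (Y _) (Z _) : ℝ) =
      metricRep x₀ g y (localRep (F := E) I x₀ Y y) (localRep (F := E) I x₀ Z y) := by
  unfold metricRep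
  rw [localRep_bilin_apply hy,
    constSection_localRep (mem_localDomain hy) Y, constSection_localRep (mem_localDomain hy) Z]

variable [FiniteDimensional ℝ E] {p q : ℕ}

/-- The local expression of a metric is a metric on the image of the chart. -/
lemma isLocalMetric_metricRep {g : symBilin I M} (hg : g ∈ pseudoMetrics I M p q) (x₀ : M) :
    IsLocalMetric (extChartAt I x₀).target (metricRep x₀ g) where
  uniqueDiffOn := uniqueDiffOn_target x₀
  subset_closure := extChartAt_target_subset_closure_interior
  contDiffOn := contDiffOn_metricRep g x₀
  symm _ hy := localRep_bilin_symm g hy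
  isInvertible _ hy := isInvertible_localRep hg hy

lemma metricJet_eq_jetOn (x₀ : M) (g : symBilin I M) :
    metricJet x₀ g = jetOn (extChartAt I x₀).target (metricRep x₀ g) := rfl

/-- The Christoffel symbols of `g` in the chart at `x₀`. -/
def christoffelRep (x₀ : M) (g : symBilin I M) : E → E →L[ℝ] E →L[ℝ] E :=
  christoffelOn (extChartAt I x₀).target (metricRep x₀ g)

/-- The connection with the Christoffel symbols of `g` in a chart has the properties of the
Levi-Civita connection. -/
lemma isLeviCivitaAt_chartCov [CompleteSpace E] {g : symBilin I M}
    (hg : g ∈ pseudoMetrics I M p q) {x₀ : M} {y : E}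
    (hy : y ∈ (extChartAt I x₀).target) :
    IsLeviCivitaAt g ((extChartAt I x₀).symm y) (fun Y X =>
      chartCov (V := fun x : M => TangentSpace I x) x₀ (christoffelRep x₀ g) Y _ X) := by
  have hG := isLocalMetric_metricRep hg x₀
  refine ⟨fun X Y hX hY => ?_, fun Y Z X hY hZ => ?_⟩
  · refine localRep_injective (F := E) (V := fun x : M => TangentSpace I x) (mem_localDomain hy)
      (s := fun x => chartCov x₀ (christoffelRep x₀ g) Y x (X x) -
        chartCov x₀ (christoffelRep x₀ g) X x (Y x)) (t := mlieBracket I X Y) ?_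
    rw [localRep_mlieBracket hy hX hY, localRep_sub (mem_localDomain hy), localRep_chartCov hy,
      localRep_chartCov hy, localCov_apply, localCov_apply, christoffelRep,
      hG.christoffelOn_symm hy (localRep I x₀ X y)]
    abel
  · obtain ⟨v, rfl⟩ := exists_constSection
      (mem_localDomain (F := E) (V := fun x : M => TangentSpace I x) hy) X
    have hYd := (mdifferentiableAt_iff_localRep hy).1 hY
    have hZd := (mdifferentiableAt_iff_localRep hy).1 hZ
    have e : ∀ z ∈ (extChartAt I x₀).target,
        ((fun x' => (g.1 x' (Y x') (Z x') : ℝ)) ∘ (extChartAt I x₀).symm) z =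
        metricRep x₀ g z (localRep (F := E) I x₀ Y z) (localRep (F := E) I x₀ Z z) :=
      fun z hz => localRep_bilin hz g Y Z
    have hd : DifferentiableWithinAt ℝ ((fun x' => (g.1 x' (Y x') (Z x') : ℝ)) ∘
        (extChartAt I x₀).symm) (extChartAt I x₀).target y :=
      (((hG.differentiableWithinAt hy).clm_apply hYd).clm_apply hZd).congr e (e y hy)
    refine (mvfderiv_constSection hy ((mdifferentiableAt_iff_comp_symm hy).2 hd) v).trans ?_
    rw [fderivWithin_congr e (e y hy), hG.localCov_metric hy hYd hZd]
    have hv := localRep_constSection (mem_localDomain (F := E)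
      (V := fun x : M => TangentSpace I x) hy) v
    have h1 := localRep_bilin hy g (fun x => chartCov (V := fun x : M => TangentSpace I x) x₀
      (christoffelRep x₀ g) Y x (constSection (V := fun x : M => TangentSpace I x) x₀ v x)) Z
    have h2 := localRep_bilin hy g Y (fun x => chartCov (V := fun x : M => TangentSpace I x) x₀
      (christoffelRep x₀ g) Z x (constSection (V := fun x : M => TangentSpace I x) x₀ v x))
    rw [localRep_chartCov hy, hv] at h1 h2
    exact (congrArg₂ (· + ·) h1 h2).symm

/-- The Levi-Civita connection of a metric, defined at each point by the Christoffel symbols in the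
chart at this point. -/
def leviCivita (g : symBilin I M) : TangentConnection I M :=
  connectionOfCharts I (fun x : M => TangentSpace I x) fun x => christoffelRep x g

lemma isLeviCivitaAt_leviCivita [CompleteSpace E] {g : symBilin I M}
    (hg : g ∈ pseudoMetrics I M p q) (x : M) :
    IsLeviCivitaAt g x (fun Y X => leviCivita g Y x X) := by
  have h := isLeviCivitaAt_chartCov hg (mem_extChartAt_target (I := I) x)
  rwa [extChartAt_to_inv] at h

lemma isLeviCivita_leviCivita {g : symBilin I M} (hg : g ∈ pseudoMetrics I M p q) :
    IsLeviCivita g.1 (leviCivita g) := by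
  have : CompleteSpace E := FiniteDimensional.complete ℝ E
  refine ⟨(CovariantDerivative.torsion_eq_zero_iff _).2 fun {X Y x} hX hY => ?_,
    fun Y Z x X hY hZ => ?_⟩
  · exact (isLeviCivitaAt_leviCivita hg x).torsion_free X Y hX hY
  · exact (isLeviCivitaAt_leviCivita hg x).compatible Y Z X hY hZ

/-- The Levi-Civita connection is in every chart given by the Christoffel symbols, because of its
uniqueness. -/
lemma localRep_leviCivita {g : symBilin I M} (hg : g ∈ pseudoMetrics I M p q) {x₀ : M} {y : E}
    (hy : y ∈ (extChartAt I x₀).target) {Y : ∀ x : M, TangentSpace I x}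
    (hY : MDiffAt (T% Y) ((extChartAt I x₀).symm y)) (X : ∀ x : M, TangentSpace I x) :
    localRep (F := E) I x₀ (fun x => leviCivita g Y x (X x)) y =
      localCov (extChartAt I x₀).target (christoffelRep x₀ g) (localRep (F := E) I x₀ Y) y
        (localRep (F := E) I x₀ X y) := by
  have : CompleteSpace E := FiniteDimensional.complete ℝ E
  rw [← localRep_chartCov (V := fun x : M => TangentSpace I x) hy]
  unfold localRep
  beta_reduce
  have h := (isLeviCivitaAt_leviCivita hg _).unique (hg _).1 (isLeviCivitaAt_chartCov hg hy) hY
    (X ((extChartAt I x₀).symm y))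
  beta_reduce at h
  rw [h]

end LeviCivita

/-! ### The connection form of a smooth connection -/

section ConnectionForm

open Filter Set Bundle

variable {E : Type*} [NormedAddCommGroup E] [NormedSpace ℝ E]
  {H : Type*} [TopologicalSpace H] {I : ModelWithCorners ℝ E H}
  {M : Type*} [TopologicalSpace M] [ChartedSpace H M] [IsManifold I ∞ M]
  {F : Type*} [NormedAddCommGroup F] [NormedSpace ℝ F] [FiniteDimensional ℝ F]
  {V : M → Type*} [TopologicalSpace (TotalSpace F V)]
  [∀ x, TopologicalSpace (V x)] [FiberBundle F V] [∀ x, AddCommGroup (V x)] [∀ x, Module ℝ (V x)]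
  [VectorBundle ℝ F V] [ContMDiffVectorBundle ∞ F V I] [HasChartDomains H F V]
  [∀ x, IsTopologicalAddGroup (V x)] [∀ x, ContinuousSMul ℝ (V x)]

/-- The difference of a connection and the flat connection of the chart at `x₀`. -/
def connectionDifference (cov : CovariantDerivative I F V) (x₀ x : M) :
    V x →L[ℝ] TangentSpace I x →L[ℝ] V x :=
  haveI : ContMDiffVectorBundle 1 F V I :=
    ContMDiffVectorBundle.of_le (n := ∞) (by exact_mod_cast le_top)
  IsCovariantDerivativeOn.difference (F := F) (s := (chartAt H x₀).source)
    cov.isCovariantDerivativeOn (isCovariantDerivativeOn_chartCov (F := F) x₀ 0) x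

/-- The connection form of a connection in the chart at `x₀`. -/
def connectionForm (cov : CovariantDerivative I F V) (x₀ : M) (y : E) : E →L[ℝ] F →L[ℝ] F :=
  (localRep (F := F →L[ℝ] E →L[ℝ] F) (V := fun x => V x →L[ℝ] TangentSpace I x →L[ℝ] V x) I x₀
    (connectionDifference cov x₀) y).flip

lemma symm_mem_chartAt_source {x₀ : M} {y : E} (hy : y ∈ (extChartAt I x₀).target) :
    (extChartAt I x₀).symm y ∈ (chartAt H x₀).source := by
  rw [← extChartAt_source I]; exact (extChartAt I x₀).map_target hy

lemma connectionDifference_apply (cov : CovariantDerivative I F V) {x₀ : M} {y : E}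
    (hy : y ∈ (extChartAt I x₀).target) {s : ∀ x, V x}
    (hs : MDifferentiableAt I (I.prod 𝓘(ℝ, F)) (fun x => TotalSpace.mk' F x (s x))
      ((extChartAt I x₀).symm y)) :
    connectionDifference (F := F) cov x₀ _ (s ((extChartAt I x₀).symm y)) =
      cov s ((extChartAt I x₀).symm y) - chartCov (F := F) x₀ 0 s ((extChartAt I x₀).symm y) := by
  have : ContMDiffVectorBundle 1 F V I :=
    ContMDiffVectorBundle.of_le (n := ∞) (by exact_mod_cast le_top)
  exact IsCovariantDerivativeOn.difference_apply _ _ (symm_mem_chartAt_source hy) hs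

/-- A connection in local coordinates. -/
lemma localRep_cov (cov : CovariantDerivative I F V) {x₀ : M} {y : E}
    (hy : y ∈ (extChartAt I x₀).target) {s : ∀ x, V x}
    (hs : MDifferentiableAt I (I.prod 𝓘(ℝ, F)) (fun x => TotalSpace.mk' F x (s x))
      ((extChartAt I x₀).symm y)) (X : ∀ x : M, TangentSpace I x) :
    localRep (F := F) I x₀ (fun x => cov s x (X x)) y =
      localCov (extChartAt I x₀).target (connectionForm cov x₀) (localRep (F := F) I x₀ s) y
        (localRep (F := E) I x₀ X y) := by
  have h1 : cov s ((extChartAt I x₀).symm y) (X _) =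
      chartCov (F := F) x₀ 0 s ((extChartAt I x₀).symm y) (X _) +
        connectionDifference (F := F) cov x₀ _ (s ((extChartAt I x₀).symm y)) (X _) := by
    rw [connectionDifference_apply cov hy hs, sub_apply]
    abel
  have h2 : localRep (F := F) I x₀ (fun x => cov s x (X x)) y =
      localRep (F := F) I x₀ (fun x => chartCov (F := F) x₀ 0 s x (X x) +
        connectionDifference cov x₀ x (s x) (X x)) y := by
    unfold localRep
    beta_reduce
    rw [h1]
  rw [h2, localRep_add (mem_localDomain hy), localRep_chartCov hy,
    localRep_clm_apply (F := E) (V := fun x : M => TangentSpace I x) (mem_localDomain hy)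
      (mem_localDomain hy),
    localRep_clm_apply (F := F) (F₂ := E →L[ℝ] F) (V := V)
      (V₂ := fun x : M => TangentSpace I x →L[ℝ] V x) (mem_localDomain hy)
      (mem_localDomain hy), localCov_apply, localCov_apply]
  simp [connectionForm]

lemma contMDiffAt_constSection {x₀ x : M} (hx : x ∈ (chartAt H x₀).source) (v : F) :
    ContMDiffAt I (I.prod 𝓘(ℝ, F)) ∞ (fun x => TotalSpace.mk' F x (constSection (V := V) x₀ v x))
      x := by
  have hx' := hx
  rw [← extChartAt_source I] at hx'
  have hy := (extChartAt I x₀).map_source hx'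
  have h := contMDiffAt_iff_contDiffWithinAt_localRep_of_mem (F := F) (V := V)
    (s := constSection x₀ v) (mem_localDomain hy)
  rw [(extChartAt I x₀).left_inv hx'] at h
  exact h.2 (contDiffWithinAt_const.congr (fun z hz => localRep_constSection hz v)
    (localRep_constSection (mem_localDomain hy) v))

variable [FiniteDimensional ℝ E] [T2Space M]

/-- The smoothness of a connection is defined in terms of its values on global smooth sections; a
cutoff function extends it to sections over a chart domain. -/
lemma contMDiffAt_cov_constSection (cov : CovariantDerivative I F V)
    [IsManifold I 1 M] (hcov : cov.ContMDiffCovariantDerivative ∞) {x₀ x : M}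
    (hx : x ∈ (chartAt H x₀).source) (v : F) :
    ContMDiffAt I (I.prod 𝓘(ℝ, E →L[ℝ] F)) ∞ (fun x => TotalSpace.mk' (E →L[ℝ] F)
      (E := fun x => TangentSpace I x →L[ℝ] V x) x (cov (constSection x₀ v) x)) x := by
  obtain ⟨χ, -, hχ⟩ := (SmoothBumpFunction.nhds_basis_tsupport (I := I) x).mem_iff.1
    ((chartAt H x₀).open_source.mem_nhds hx)
  have hs : ContMDiff I (I.prod 𝓘(ℝ, F)) ∞ (fun z => TotalSpace.mk' F z
      (((χ : M → ℝ) • constSection (V := V) x₀ v) z)) := by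
    intro z
    by_cases hz : z ∈ (chartAt H x₀).source
    · exact χ.contMDiff.contMDiffAt.smul_section (contMDiffAt_constSection hz v)
    · have h0 : ∀ᶠ z' in 𝓝 z, χ z' = 0 :=
        notMem_tsupport_iff_eventuallyEq.1 fun h => hz (hχ h)
      refine (Bundle.contMDiff_zeroSection ℝ V).contMDiffAt.congr_of_eventuallyEq ?_
      filter_upwards [h0] with z' hz'
      simp [hz', zeroSection]
  have h1 := (hcov.contMDiff.contMDiff (σ := (χ : M → ℝ) • constSection (V := V) x₀ v)
    (by simpa using! hs.contMDiffOn)).contMDiffAt univ_mem (x := x)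
  refine h1.congr_of_eventuallyEq ?_
  filter_upwards [χ.eventuallyEq_one.eventually_nhds, (chartAt H x₀).open_source.mem_nhds hx]
    with z hz hz'
  congr 1
  refine (cov.isCovariantDerivativeOn (s := univ)).congr_of_eventuallyEq
    ((contMDiffAt_constSection hz' v).mdifferentiableAt (by simp))
    (hs.contMDiffAt.mdifferentiableAt (by simp)) univ_mem ?_
  filter_upwards [hz] with w hw
  simp [hw]

/-- The connection form, applied to a constant `v`, is the covariant derivative of the section which
is constant `v` in the chart. -/
lemma contDiffOn_connectionForm (cov : CovariantDerivative I F V)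
    [IsManifold I 1 M] (hcov : cov.ContMDiffCovariantDerivative ∞) (x₀ : M) :
    ContDiffOn ℝ ∞ (connectionForm cov x₀) (extChartAt I x₀).target := by
  refine contDiffOn_clm_flip (contDiffOn_clm_apply.2 fun v y hy => ?_)
  have h1 := (contMDiffAt_iff_contDiffWithinAt_localRep_of_mem
    (F := E →L[ℝ] F) (V := fun x => TangentSpace I x →L[ℝ] V x)
    (s := fun x => cov (constSection x₀ v) x) (mem_localDomain hy)).1
    (contMDiffAt_cov_constSection cov hcov (symm_mem_chartAt_source hy) v)
  rw [localDomain_eq_target] at h1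
  have key : ∀ y ∈ (extChartAt I x₀).target, localRep (F := F →L[ℝ] E →L[ℝ] F)
      (V := fun x => V x →L[ℝ] TangentSpace I x →L[ℝ] V x) I x₀ (connectionDifference cov x₀) y v =
      localRep (F := E →L[ℝ] F) (V := fun x => TangentSpace I x →L[ℝ] V x) I x₀
        (fun x => cov (constSection x₀ v) x) y := by
    intro y hy
    rw [localRep_clm_constSection (F := F) (V := V) (mem_localDomain hy) (mem_localDomain hy)]
    ext u
    rw [localRep_clm_constSection (F := E) (V := fun x : M => TangentSpace I x)
      (mem_localDomain hy) (mem_localDomain hy), localRep_clm_constSection (F := E)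
      (V := fun x : M => TangentSpace I x) (mem_localDomain hy) (mem_localDomain hy)]
    have hs := (contMDiffAt_constSection (V := V) (I := I) (symm_mem_chartAt_source hy)
      v).mdifferentiableAt (by simp)
    have h0 := localRep_chartCov (F := F) hy 0 (constSection (V := V) x₀ v)
      (constSection (V := fun x : M => TangentSpace I x) x₀ u)
    have h00 : localCov (extChartAt I x₀).target 0
        (localRep (F := F) I x₀ (constSection (V := V) x₀ v)) y = 0 := by
      unfold localCov
      rw [fderivWithin_congr (f := fun _ => v)
        (fun z hz => localRep_constSection (mem_localDomain hz) v)
        (localRep_constSection (mem_localDomain hy) v)]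
      simp
    rw [h00] at h0
    have h2 := localRep_sub (F := F) (mem_localDomain hy)
      (fun x => cov (constSection (V := V) x₀ v) x
        (constSection (V := fun x : M => TangentSpace I x) x₀ u x))
      (fun x => chartCov (F := F) x₀ 0 (constSection (V := V) x₀ v) x
        (constSection (V := fun x : M => TangentSpace I x) x₀ u x))
    rw [h0] at h2
    refine Eq.trans ?_ (h2.trans (sub_zero _))
    unfold localRep
    beta_reduce
    rw [connectionDifference_apply cov hy hs, sub_apply]
  exact h1.congr key (key y hy)

end ConnectionForm

/-! ### The Levi-Civita connection relative to a background connection -/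

section Difference

open Filter Set Bundle

variable {E : Type*} [NormedAddCommGroup E] [NormedSpace ℝ E]
  {H : Type*} [TopologicalSpace H] {I : ModelWithCorners ℝ E H}
  {M : Type*} [TopologicalSpace M] [ChartedSpace H M] [IsManifold I ∞ M]
  {F : Type*} [NormedAddCommGroup F] [NormedSpace ℝ F] [FiniteDimensional ℝ F]
  {V : M → Type*} [TopologicalSpace (TotalSpace F V)]
  [∀ x, TopologicalSpace (V x)] [FiberBundle F V] [∀ x, AddCommGroup (V x)] [∀ x, Module ℝ (V x)]
  [VectorBundle ℝ F V] [ContMDiffVectorBundle ∞ F V I] [HasChartDomains H F V]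
  [∀ x, IsTopologicalAddGroup (V x)] [∀ x, ContinuousSMul ℝ (V x)]

/-- The difference of two connections is locally the difference of the connection forms. -/
lemma cov_eq_add_iff {cov cov₀ : CovariantDerivative I F V} {x₀ : M} {y : E}
    (hy : y ∈ (extChartAt I x₀).target) {Γ : E → E →L[ℝ] F →L[ℝ] F}
    (hΓ : ∀ s : ∀ x, V x, MDifferentiableAt I (I.prod 𝓘(ℝ, F)) (fun x => TotalSpace.mk' F x (s x))
      ((extChartAt I x₀).symm y) → ∀ X : ∀ x : M, TangentSpace I x,
      localRep (F := F) I x₀ (fun x => cov s x (X x)) y =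
        localCov (extChartAt I x₀).target Γ (localRep (F := F) I x₀ s) y
          (localRep (F := E) I x₀ X y)) (A : ∀ x, TangentSpace I x →L[ℝ] V x →L[ℝ] V x) :
    (∀ (s : ∀ x, V x) (X : TangentSpace I ((extChartAt I x₀).symm y)),
      MDifferentiableAt I (I.prod 𝓘(ℝ, F)) (fun x => TotalSpace.mk' F x (s x))
        ((extChartAt I x₀).symm y) →
      cov s ((extChartAt I x₀).symm y) X = cov₀ s ((extChartAt I x₀).symm y) X +
        A ((extChartAt I x₀).symm y) X (s ((extChartAt I x₀).symm y))) ↔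
    localRep (F := E →L[ℝ] F →L[ℝ] F) I x₀ A y = Γ y - connectionForm cov₀ x₀ y := by
  have hA : ∀ (s : ∀ x, V x) (u : E), localRep (F := F) I x₀
      (fun x => A x (constSection x₀ u x) (s x)) y =
      localRep (F := E →L[ℝ] F →L[ℝ] F) I x₀ A y u (localRep (F := F) I x₀ s y) := by
    intro s u
    rw [localRep_clm_apply (F := F) (V := V) (mem_localDomain hy) (mem_localDomain hy),
      localRep_clm_apply (F := E) (V := fun x : M => TangentSpace I x)
        (F₂ := F →L[ℝ] F) (V₂ := fun x => V x →L[ℝ] V x) (mem_localDomain hy) (mem_localDomain hy),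
      localRep_constSection (mem_localDomain hy)]
  have hu : ∀ u : E, localRep (F := E) I x₀
      (constSection (V := fun x : M => TangentSpace I x) x₀ u) y = u :=
    localRep_constSection (mem_localDomain hy)
  constructor
  · intro h
    ext u v
    have hs := (contMDiffAt_constSection (V := V) (I := I) (symm_mem_chartAt_source hy)
      v).mdifferentiableAt (by simp)
    have h1 := h (constSection x₀ v) (constSection x₀ u _) hs
    have h2 : localRep (F := F) I x₀ (fun x => cov (constSection x₀ v) x (constSection x₀ u x)) y =
        localRep (F := F) I x₀ (fun x => cov₀ (constSection x₀ v) x (constSection x₀ u x) +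
          A x (constSection x₀ u x) (constSection x₀ v x)) y := by
      unfold localRep
      beta_reduce
      rw [h1]
    have hv : localRep (F := F) I x₀ (constSection (V := V) x₀ v) y = v :=
      localRep_constSection (mem_localDomain hy) v
    rw [localRep_add (mem_localDomain hy), hA, hΓ _ hs, localRep_cov cov₀ hy hs, hu, hv,
      localCov_apply, localCov_apply, hv] at h2
    rw [sub_apply, sub_apply, eq_sub_iff_add_eq]
    exact (add_comm _ _).trans (add_left_cancel (h2.trans (add_assoc _ _ _))).symm
  · intro h s X hs
    obtain ⟨u, rfl⟩ := exists_constSection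
      (mem_localDomain (F := E) (V := fun x : M => TangentSpace I x) hy) X
    refine localRep_injective (F := F) (mem_localDomain hy)
      (s := fun x => cov s x (constSection x₀ u x))
      (t := fun x => cov₀ s x (constSection x₀ u x) + A x (constSection x₀ u x) (s x)) ?_
    rw [localRep_add (mem_localDomain hy), hA, hΓ _ hs, localRep_cov cov₀ hy hs, hu, h,
      localCov_apply, localCov_apply, sub_apply, sub_apply]
    abel

end Difference

section LeviCivitaTangent

open Filter Set Bundle

universe u

variable {E : Type u} [NormedAddCommGroup E] [NormedSpace ℝ E] [FiniteDimensional ℝ E]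
  {H : Type*} [TopologicalSpace H] {I : ModelWithCorners ℝ E H}
  {M : Type*} [TopologicalSpace M] [ChartedSpace H M] [IsManifold I ∞ M] [T2Space M]
  [CompactSpace M] {p q : ℕ}

lemma isSmoothOperation_leviCivitaTangent (hpq : p + q = Module.finrank ℝ E)
    (cov₀ : TangentConnection I M) [IsManifold I 1 M]
    (hcov₀ : cov₀.ContMDiffCovariantDerivative ∞) :
    IsSmoothOperation (pseudoMetrics I M p q) (fun g A => IsLeviCivitaTangent cov₀ g.1 A) := by
  obtain ⟨f, hf, hf'⟩ := exists_isFrechetSmoothOn_of_jet' (I := I) (M := M) hpq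
    (F := E →L[ℝ] E →L[ℝ] E)
    (V := fun x : M => TangentSpace I x →L[ℝ] TangentSpace I x →L[ℝ] TangentSpace I x)
    (C := E →L[ℝ] E →L[ℝ] E) (ContinuousLinearEquiv.refl ℝ _)
    (Ψ := fun z => christoffel z.2.1 z.2.2.1 - z.1)
    ((contDiffOn_jet_christoffel _).sub contDiffOn_fst)
    (connectionForm cov₀) (contDiffOn_connectionForm cov₀ hcov₀)
    (P := fun g x A => ∀ (Y : ∀ x, TangentSpace I x) (X : TangentSpace I x), MDiffAt (T% Y) x →
      leviCivita g Y x X = cov₀ Y x X + A X (Y x))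
    fun g hg x₀ s y hy => cov_eq_add_iff hy (fun Y hY X => localRep_leviCivita hg hy hY X) s
  exact ⟨f, fun g hg => ⟨leviCivita g, isLeviCivita_leviCivita hg,
    fun Y x X hY => hf g hg x Y X hY⟩, hf'⟩

end LeviCivitaTangent

section LeviCivitaCotangent

open Filter Set Bundle

universe u

variable {E : Type u} [NormedAddCommGroup E] [NormedSpace ℝ E]
  {H : Type*} [TopologicalSpace H] {I : ModelWithCorners ℝ E H}
  {M : Type*} [TopologicalSpace M] [ChartedSpace H M] [IsManifold I ∞ M]

/-- The connection form of the dual connection, `α ↦ -α ∘ Γ(u, ·)`. -/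
def dualForm (Γ : E →L[ℝ] E →L[ℝ] E) : E →L[ℝ] (E →L[ℝ] ℝ) →L[ℝ] (E →L[ℝ] ℝ) :=
  -((ContinuousLinearMap.compL ℝ E E ℝ).flip.comp Γ)

lemma dualForm_apply (Γ : E →L[ℝ] E →L[ℝ] E) (u : E) (α : E →L[ℝ] ℝ) (v : E) :
    dualForm Γ u α v = -α (Γ u v) := rfl

lemma contDiffOn_dualForm {G : Type*} [NormedAddCommGroup G] [NormedSpace ℝ G] {s : Set G}
    {Γ : G → E →L[ℝ] E →L[ℝ] E} (hΓ : ContDiffOn ℝ ∞ Γ s) :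
    ContDiffOn ℝ ∞ (fun z => dualForm (Γ z)) s :=
  (contDiffOn_const.clm_comp hΓ).neg

variable [FiniteDimensional ℝ E]

/-- The connection on the cotangent bundle induced by the Levi-Civita connection. -/
def leviCivitaDual (g : symBilin I M) : CotangentConnection I M :=
  connectionOfCharts I (fun x : M => TangentSpace I x →L[ℝ] Bundle.Trivial M ℝ x)
    fun x y => dualForm (christoffelRep x g y)

variable {p q : ℕ}

/-- In every chart, the connection with the dual connection form satisfies the product rule. -/
lemma chartCov_dualForm_apply {g : symBilin I M} (hg : g ∈ pseudoMetrics I M p q) {x₀ : M} {y : E}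
    (hy : y ∈ (extChartAt I x₀).target)
    {α : ∀ x : M, TangentSpace I x →L[ℝ] Bundle.Trivial M ℝ x} {Y : ∀ x : M, TangentSpace I x}
    (hα : MDifferentiableAt I (I.prod 𝓘(ℝ, E →L[ℝ] ℝ)) (fun x' => TotalSpace.mk' (E →L[ℝ] ℝ)
      (E := fun x : M => TangentSpace I x →L[ℝ] Bundle.Trivial M ℝ x) x' (α x'))
      ((extChartAt I x₀).symm y))
    (hY : MDiffAt (T% Y) ((extChartAt I x₀).symm y))
    (X : TangentSpace I ((extChartAt I x₀).symm y)) :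
    chartCov (V := fun x : M => TangentSpace I x →L[ℝ] Bundle.Trivial M ℝ x) x₀
      (fun y => dualForm (christoffelRep x₀ g y)) α _ X (Y _) =
      mvfderiv I (fun x' => (α x' (Y x') : ℝ)) ((extChartAt I x₀).symm y) X -
        α _ (leviCivita g Y _ X) := by
  obtain ⟨u, rfl⟩ := exists_constSection
    (mem_localDomain (F := E) (V := fun x : M => TangentSpace I x) hy) X
  have hu := localRep_constSection (mem_localDomain (F := E)
    (V := fun x : M => TangentSpace I x) hy) u
  have hYd := (mdifferentiableAt_iff_localRep hy).1 hY
  have hαd := (mdifferentiableAt_iff_localRep (F := E →L[ℝ] ℝ) (V := fun x : M =>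
    TangentSpace I x →L[ℝ] Bundle.Trivial M ℝ x) hy).1 hα
  -- the pairing of a form and a vector field in local coordinates
  have e : ∀ (α : ∀ x : M, TangentSpace I x →L[ℝ] Bundle.Trivial M ℝ x)
      (Y : ∀ x : M, TangentSpace I x), ∀ z ∈ (extChartAt I x₀).target,
      (α ((extChartAt I x₀).symm z) (Y _) : ℝ) =
        localRep (F := E →L[ℝ] ℝ) I x₀ α z (localRep (F := E) I x₀ Y z) := fun α Y z hz =>
    localRep_clm_apply (F := E) (V := fun x : M => TangentSpace I x) (F₂ := ℝ)
      (V₂ := Bundle.Trivial M ℝ) (mem_localDomain hz) (mem_localDomain hz) α Y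
  have e' : ∀ z ∈ (extChartAt I x₀).target,
      ((fun x' => (α x' (Y x') : ℝ)) ∘ (extChartAt I x₀).symm) z =
        localRep (F := E →L[ℝ] ℝ) I x₀ α z (localRep (F := E) I x₀ Y z) := e α Y
  have hd : DifferentiableWithinAt ℝ ((fun x' => (α x' (Y x') : ℝ)) ∘ (extChartAt I x₀).symm)
      (extChartAt I x₀).target y := (hαd.clm_apply hYd).congr e' (e' y hy)
  have h1 := (mvfderiv_constSection hy ((mdifferentiableAt_iff_comp_symm hy).2 hd) u)
  rw [fderivWithin_congr e' (e' y hy),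
    fderivWithin_clm_apply (uniqueDiffOn_target x₀ y hy) hαd hYd] at h1
  have h2 := e (fun x => chartCov (V := fun x : M => TangentSpace I x →L[ℝ] Bundle.Trivial M ℝ x) x₀
    (fun y => dualForm (christoffelRep x₀ g y)) α x (constSection
    (V := fun x : M => TangentSpace I x) x₀ u x)) Y y hy
  have h3 := e α (fun x => leviCivita g Y x (constSection
    (V := fun x : M => TangentSpace I x) x₀ u x)) y hy
  rw [localRep_chartCov hy, localCov_apply, hu] at h2
  rw [localRep_leviCivita hg hy hY, localCov_apply, hu] at h3
  refine h2.trans ((congrArg₂ (· - ·) h1 h3).trans ?_).symm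
  simp [dualForm_apply]
  exact sub_eq_add_neg (G := ℝ) _ _

lemma isDualConnection_leviCivitaDual {g : symBilin I M} (hg : g ∈ pseudoMetrics I M p q) :
    IsDualConnection (leviCivita g) (leviCivitaDual g) := by
  intro α Y x X hα hY
  have h := chartCov_dualForm_apply hg (mem_extChartAt_target (I := I) x) (α := α) (Y := Y)
  rw [extChartAt_to_inv] at h
  exact h hα hY X

lemma localRep_leviCivitaDual {g : symBilin I M} (hg : g ∈ pseudoMetrics I M p q) {x₀ : M} {y : E}
    (hy : y ∈ (extChartAt I x₀).target)
    {α : ∀ x : M, TangentSpace I x →L[ℝ] Bundle.Trivial M ℝ x}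
    (hα : MDifferentiableAt I (I.prod 𝓘(ℝ, E →L[ℝ] ℝ)) (fun x' => TotalSpace.mk' (E →L[ℝ] ℝ)
      (E := fun x : M => TangentSpace I x →L[ℝ] Bundle.Trivial M ℝ x) x' (α x'))
      ((extChartAt I x₀).symm y)) (X : ∀ x : M, TangentSpace I x) :
    localRep (F := E →L[ℝ] ℝ) (V := fun x : M => TangentSpace I x →L[ℝ] Bundle.Trivial M ℝ x) I x₀
      (fun x => leviCivitaDual g α x (X x)) y =
      localCov (extChartAt I x₀).target (fun y => dualForm (christoffelRep x₀ g y))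
        (localRep (F := E →L[ℝ] ℝ) I x₀ α) y (localRep (F := E) I x₀ X y) := by
  rw [← localRep_chartCov (V := fun x : M => TangentSpace I x →L[ℝ] Bundle.Trivial M ℝ x) hy]
  have h : leviCivitaDual g α ((extChartAt I x₀).symm y) (X _) =
      chartCov (V := fun x : M => TangentSpace I x →L[ℝ] Bundle.Trivial M ℝ x) x₀
      (fun y => dualForm (christoffelRep x₀ g y)) α _ (X _) := by
    refine ContinuousLinearMap.ext fun v => ?_
    obtain ⟨Y, hY, rfl⟩ := exists_mdifferentiableAt_eq v
    exact (isDualConnection_leviCivitaDual hg α Y _ _ hα hY).trans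
      (chartCov_dualForm_apply hg hy hα hY _).symm
  unfold localRep
  beta_reduce
  rw [h]

variable [T2Space M] [CompactSpace M]

lemma isSmoothOperation_leviCivitaCotangent (hpq : p + q = Module.finrank ℝ E)
    (cov₀ : CotangentConnection I M) [IsManifold I 1 M]
    (hcov₀ : cov₀.ContMDiffCovariantDerivative ∞) :
    IsSmoothOperation (pseudoMetrics I M p q) (fun g A => IsLeviCivitaCotangent cov₀ g.1 A) := by
  obtain ⟨f, hf, hf'⟩ := exists_isFrechetSmoothOn_of_jet' (I := I) (M := M) hpq
    (F := E →L[ℝ] (E →L[ℝ] ℝ) →L[ℝ] (E →L[ℝ] ℝ))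
    (V := fun x : M => TangentSpace I x →L[ℝ] (TangentSpace I x →L[ℝ] Bundle.Trivial M ℝ x) →L[ℝ]
      (TangentSpace I x →L[ℝ] Bundle.Trivial M ℝ x))
    (C := E →L[ℝ] (E →L[ℝ] ℝ) →L[ℝ] (E →L[ℝ] ℝ)) (ContinuousLinearEquiv.refl ℝ _)
    (Ψ := fun z => dualForm (christoffel z.2.1 z.2.2.1) - z.1)
    ((contDiffOn_dualForm (contDiffOn_jet_christoffel _)).sub contDiffOn_fst)
    (connectionForm cov₀) (contDiffOn_connectionForm cov₀ hcov₀)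
    (P := fun g x A => ∀ (α : ∀ x : M, TangentSpace I x →L[ℝ] Bundle.Trivial M ℝ x)
      (X : TangentSpace I x), MDifferentiableAt I (I.prod 𝓘(ℝ, E →L[ℝ] ℝ))
        (fun x' => TotalSpace.mk' (E →L[ℝ] ℝ)
          (E := fun x : M => TangentSpace I x →L[ℝ] Bundle.Trivial M ℝ x) x' (α x')) x →
      leviCivitaDual g α x X = cov₀ α x X + A X (α x))
    fun g hg x₀ s y hy => cov_eq_add_iff hy (fun Y hY X => localRep_leviCivitaDual hg hy hY X) s
  exact ⟨f, fun g hg => ⟨leviCivita g, leviCivitaDual g, isLeviCivita_leviCivita hg,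
    isDualConnection_leviCivitaDual hg, fun α x X hα => hf g hg x α X hα⟩, hf'⟩

end LeviCivitaCotangent

/-! ### Symmetric tensors -/

section Symmetric

open Filter Set Bundle

variable {E : Type*} [NormedAddCommGroup E] [NormedSpace ℝ E]
  {H : Type*} [TopologicalSpace H] {I : ModelWithCorners ℝ E H}
  {M : Type*} [TopologicalSpace M] [ChartedSpace H M] [IsManifold I ∞ M]
  {F : Type*} [NormedAddCommGroup F] [NormedSpace ℝ F]
  {V : M → Type*} [TopologicalSpace (TotalSpace F V)]
  [∀ x, TopologicalSpace (V x)] [FiberBundle F V] [∀ x, AddCommGroup (V x)] [∀ x, Module ℝ (V x)]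
  [VectorBundle ℝ F V] [ContMDiffVectorBundle ∞ F V I] [HasChartDomains H F V]

lemma continuous_localRep [FiniteDimensional ℝ E] {x₀ : M} {y : E}
    (hy : y ∈ (extChartAt I x₀).target) :
    Continuous (fun s : Cₛ^∞⟮I; F, V⟯ => localRep (F := F) I x₀ (fun x => s x) y) := by
  refine continuous_iff_continuousAt.2 fun s => ?_
  have hd := mem_localDomain (F := F) (V := V) hy
  have h : SmoothTendsto (𝓝 s) (localDomain I F V x₀)
      (fun t : Cₛ^∞⟮I; F, V⟯ => localRep (F := F) I x₀ (fun x => t x))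
      (localRep (F := F) I x₀ (fun x => s x)) := smoothTendsto_localRep tendsto_id x₀
  have h2 : Tendsto (fun s : Cₛ^∞⟮I; F, V⟯ => (s, y)) (𝓝 s) (𝓝 s ×ˢ 𝓝[localDomain I F V x₀] y) :=
    tendsto_id.prodMk (tendsto_const_pure.mono_right (pure_le_nhdsWithin hd))
  exact ((h.tendsto hd).comp h2 :)

lemma localRep_bilinear [∀ x, IsTopologicalAddGroup (V x)] [∀ x, ContinuousSMul ℝ (V x)]
    {x₀ : M} {y : E} (hy : y ∈ (extChartAt I x₀).target)
    (B : ∀ x, V x →L[ℝ] V x →L[ℝ] Bundle.Trivial M ℝ x) (u v : F) :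
    localRep (F := F →L[ℝ] F →L[ℝ] ℝ) I x₀ B y u v =
      (B ((extChartAt I x₀).symm y) (constSection x₀ u _) (constSection x₀ v _) : ℝ) := by
  rw [localRep_clm_constSection (F := F) (V := V) (F₂ := F →L[ℝ] ℝ)
    (V₂ := fun x => V x →L[ℝ] Bundle.Trivial M ℝ x) (mem_localDomain hy) (mem_localDomain hy),
    localRep_clm_constSection (F := F) (V := V) (F₂ := ℝ) (V₂ := Bundle.Trivial M ℝ)
    (mem_localDomain hy) (mem_localDomain hy)]
  rfl

lemma forall_symm_iff [∀ x, IsTopologicalAddGroup (V x)] [∀ x, ContinuousSMul ℝ (V x)]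
    {x₀ : M} {y : E} (hy : y ∈ (extChartAt I x₀).target)
    (B : ∀ x, V x →L[ℝ] V x →L[ℝ] Bundle.Trivial M ℝ x) :
    (∀ u v : V ((extChartAt I x₀).symm y), B _ u v = B _ v u) ↔
      ∀ u v : F, localRep (F := F →L[ℝ] F →L[ℝ] ℝ) I x₀ B y u v =
        localRep (F := F →L[ℝ] F →L[ℝ] ℝ) I x₀ B y v u := by
  have hd := mem_localDomain (F := F) (V := V) hy
  rw [forall_fiber_iff hd]
  refine forall_congr' fun u => ?_
  rw [forall_fiber_iff hd]
  refine forall_congr' fun v => ?_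
  rw [localRep_bilinear hy, localRep_bilinear hy]

lemma symm_iff_localRep [∀ x, IsTopologicalAddGroup (V x)] [∀ x, ContinuousSMul ℝ (V x)]
    (B : ∀ x, V x →L[ℝ] V x →L[ℝ] Bundle.Trivial M ℝ x) :
    (∀ x (u v : V x), B x u v = B x v u) ↔
      ∀ x (u v : F), localRep (F := F →L[ℝ] F →L[ℝ] ℝ) I x B (extChartAt I x x) u v =
        localRep (F := F →L[ℝ] F →L[ℝ] ℝ) I x B (extChartAt I x x) v u := by
  refine forall_congr' fun x => ?_
  have h := forall_symm_iff (F := F) (V := V) (mem_extChartAt_target (I := I) x) B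
  rwa [extChartAt_to_inv] at h

variable [FiniteDimensional ℝ E]

variable (I M) in
lemma isClosed_symBilin : IsClosed (symBilin I M : Set (BilinField I M)) := by
  have : (symBilin I M : Set (BilinField I M)) = {g | ∀ x (u v : E),
      localRep (F := E →L[ℝ] E →L[ℝ] ℝ) I x (fun x => g x) (extChartAt I x x) u v =
        localRep (F := E →L[ℝ] E →L[ℝ] ℝ) I x (fun x => g x) (extChartAt I x x) v u} :=
    Set.ext fun g => symm_iff_localRep (fun x => g x)
  rw [this]
  simp only [ofPred_forall]
  have hc := fun x : M => continuous_localRep (F := E →L[ℝ] E →L[ℝ] ℝ)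
    (V := fun x : M => TangentSpace I x →L[ℝ] TangentSpace I x →L[ℝ] Bundle.Trivial M ℝ x)
    (mem_extChartAt_target (I := I) x)
  exact isClosed_iInter fun x => isClosed_iInter fun u => isClosed_iInter fun v =>
    isClosed_eq (((hc x).clm_apply continuous_const).clm_apply continuous_const)
      (((hc x).clm_apply continuous_const).clm_apply continuous_const)

variable (I M) in
lemma isClosed_symCobilin : IsClosed (symCobilin I M : Set (CobilinField I M)) := by
  have : (symCobilin I M : Set (CobilinField I M)) = {g | ∀ x (u v : E →L[ℝ] ℝ),
      localRep (F := (E →L[ℝ] ℝ) →L[ℝ] (E →L[ℝ] ℝ) →L[ℝ] ℝ) I x (fun x => g x)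
        (extChartAt I x x) u v =
      localRep (F := (E →L[ℝ] ℝ) →L[ℝ] (E →L[ℝ] ℝ) →L[ℝ] ℝ) I x (fun x => g x)
        (extChartAt I x x) v u} :=
    Set.ext fun g => symm_iff_localRep (F := E →L[ℝ] ℝ)
      (V := fun x : M => TangentSpace I x →L[ℝ] Bundle.Trivial M ℝ x) (fun x => g x)
  rw [this]
  simp only [ofPred_forall]
  have hc := fun x : M => continuous_localRep (F := (E →L[ℝ] ℝ) →L[ℝ] (E →L[ℝ] ℝ) →L[ℝ] ℝ)
    (V := fun x : M => (TangentSpace I x →L[ℝ] Bundle.Trivial M ℝ x) →L[ℝ]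
      (TangentSpace I x →L[ℝ] Bundle.Trivial M ℝ x) →L[ℝ] Bundle.Trivial M ℝ x)
    (mem_extChartAt_target (I := I) x)
  exact isClosed_iInter fun x => isClosed_iInter fun u => isClosed_iInter fun v =>
    isClosed_eq (((hc x).clm_apply continuous_const).clm_apply continuous_const)
      (((hc x).clm_apply continuous_const).clm_apply continuous_const)

end Symmetric

/-! ### The inverse metric -/

section Inverse

open Filter Set Bundle

universe u

variable {E : Type u} [NormedAddCommGroup E] [NormedSpace ℝ E] [FiniteDimensional ℝ E]
  {H : Type*} [TopologicalSpace H] {I : ModelWithCorners ℝ E H}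
  {M : Type*} [TopologicalSpace M] [ChartedSpace H M] [IsManifold I ∞ M] {p q : ℕ}

/-- The form `(α, β) ↦ α(B⁻¹ β)` on the dual space. -/
def inverseForm (B : E →L[ℝ] E →L[ℝ] ℝ) : (E →L[ℝ] ℝ) →L[ℝ] (E →L[ℝ] ℝ) →L[ℝ] ℝ :=
  (ContinuousLinearMap.compL ℝ (E →L[ℝ] ℝ) E ℝ).flip B.inverse

lemma inverseForm_apply (B : E →L[ℝ] E →L[ℝ] ℝ) (α β : E →L[ℝ] ℝ) :
    inverseForm B α β = α (B.inverse β) := rfl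

lemma eq_inverseForm_iff {B : E →L[ℝ] E →L[ℝ] ℝ} (hB : B.IsInvertible)
    (h : (E →L[ℝ] ℝ) →L[ℝ] (E →L[ℝ] ℝ) →L[ℝ] ℝ) :
    (∀ α v, h α (B v) = α v) ↔ h = inverseForm B := by
  constructor
  · intro hh
    ext α β
    rw [inverseForm_apply, ← hh, apply_inverse hB]
  · rintro rfl α v
    rw [inverseForm_apply, inverse_apply hB]

lemma inverseForm_symm {B : E →L[ℝ] E →L[ℝ] ℝ} (hB : B.IsInvertible)
    (hs : ∀ u v, B u v = B v u) (α β : E →L[ℝ] ℝ) : inverseForm B α β = inverseForm B β α := by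
  rw [inverseForm_apply, inverseForm_apply]
  conv_lhs => rw [← apply_inverse hB α]
  conv_rhs => rw [← apply_inverse hB β]
  exact hs _ _

lemma isInverse_iff_localRep {g : symBilin I M} (hg : g ∈ pseudoMetrics I M p q) {x₀ : M} {y : E}
    (hy : y ∈ (extChartAt I x₀).target)
    (h : ∀ x : M, (TangentSpace I x →L[ℝ] Bundle.Trivial M ℝ x) →L[ℝ]
      (TangentSpace I x →L[ℝ] Bundle.Trivial M ℝ x) →L[ℝ] Bundle.Trivial M ℝ x) :
    (∀ (α : TangentSpace I ((extChartAt I x₀).symm y) →L[ℝ] Bundle.Trivial M ℝ _)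
      (v : TangentSpace I ((extChartAt I x₀).symm y)), h _ α (g.1 _ v) = α v) ↔
    localRep (F := (E →L[ℝ] ℝ) →L[ℝ] (E →L[ℝ] ℝ) →L[ℝ] ℝ) I x₀ h y =
      inverseForm (metricRep x₀ g y) := by
  have hT := mem_localDomain (F := E) (V := fun x : M => TangentSpace I x) hy
  have hT' := mem_localDomain (F := E →L[ℝ] ℝ)
    (V := fun x : M => TangentSpace I x →L[ℝ] Bundle.Trivial M ℝ x) hy
  rw [← eq_inverseForm_iff ((isLocalMetric_metricRep hg x₀).isInvertible y hy),
    forall_fiber_iff hT']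
  refine forall_congr' fun α => ?_
  rw [forall_fiber_iff hT]
  refine forall_congr' fun v => ?_
  have h1 : g.1 ((extChartAt I x₀).symm y) (constSection x₀ v _) =
      constSection (F := E →L[ℝ] ℝ) (V := fun x : M => TangentSpace I x →L[ℝ] Bundle.Trivial M ℝ x)
        x₀ (metricRep x₀ g y v) ((extChartAt I x₀).symm y) :=
    (eq_constSection_iff hT' (fun x => g.1 x (constSection x₀ v x)) _).2
      (localRep_clm_constSection (F := E) (F₂ := E →L[ℝ] ℝ) (V := fun x : M => TangentSpace I x)
        (V₂ := fun x : M => TangentSpace I x →L[ℝ] Bundle.Trivial M ℝ x) hT hT'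
        (fun x => g.1 x) v).symm
  have h2 : (constSection (F := E →L[ℝ] ℝ)
      (V := fun x : M => TangentSpace I x →L[ℝ] Bundle.Trivial M ℝ x) x₀ α
      ((extChartAt I x₀).symm y) (constSection x₀ v _) : ℝ) = α v := by
    have := localRep_clm_constSection (F := E) (F₂ := ℝ) (V := fun x : M => TangentSpace I x)
      (V₂ := Bundle.Trivial M ℝ) hT (mem_localDomain hy) (constSection x₀ α) v
    rw [localRep_constSection hT'] at this
    exact this.symm
  have h3 := localRep_bilinear (F := E →L[ℝ] ℝ)
    (V := fun x : M => TangentSpace I x →L[ℝ] Bundle.Trivial M ℝ x) hy h α (metricRep x₀ g y v)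
  rw [← h1] at h3
  rw [h3, ← h2]

variable [CompactSpace M]

lemma isSmoothOperation_inverse (hpq : p + q = Module.finrank ℝ E) :
    IsSmoothOperation (Y := symCobilin I M) (pseudoMetrics I M p q)
      (fun g h => IsInverseMetric g.1 h.1) := by
  -- no parameter besides the jet is needed, so that `C := E` and `c := 0` will do
  have hΨ : ContDiffOn ℝ ∞ (fun z : E × Jet E => inverseForm z.2.1) (metricJets E E) :=
    (ContinuousLinearMap.contDiff _).comp_contDiffOn (contDiffOn_jet_inverse E)
  obtain ⟨f, hf, hf'⟩ := exists_isFrechetSmoothOn_of_jet' (I := I) (M := M) hpq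
    (F := (E →L[ℝ] ℝ) →L[ℝ] (E →L[ℝ] ℝ) →L[ℝ] ℝ)
    (V := fun x : M => (TangentSpace I x →L[ℝ] Bundle.Trivial M ℝ x) →L[ℝ]
      (TangentSpace I x →L[ℝ] Bundle.Trivial M ℝ x) →L[ℝ] Bundle.Trivial M ℝ x)
    (C := E) (ContinuousLinearEquiv.refl ℝ _) hΨ (fun _ _ => 0) (fun _ => contDiffOn_const)
    (P := fun g x h => ∀ (α : TangentSpace I x →L[ℝ] Bundle.Trivial M ℝ x)
      (v : TangentSpace I x), h α (g.1 x v) = α v)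
    fun g hg x₀ s y hy => isInverse_iff_localRep hg hy s
  obtain ⟨f', hff', hf''⟩ := hf'.codRestrict (eventually_add_smul_mem_pseudoMetrics hpq)
    (isClosed_symCobilin I M) fun g hg => by
      refine (symm_iff_localRep (I := I) (F := E →L[ℝ] ℝ)
        (V := fun x : M => TangentSpace I x →L[ℝ] Bundle.Trivial M ℝ x) (fun x => f g x)).2
        fun x α β => ?_
      have hy := mem_extChartAt_target (I := I) x
      rw [(isInverse_iff_localRep hg hy (fun x => f g x)).1 (hf g hg _)]
      exact inverseForm_symm (isInvertible_localRep hg hy) (localRep_bilin_symm g hy) α β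
  refine ⟨f', fun g hg => ?_, hf''⟩
  have := hf g hg
  rw [← hff' g hg] at this
  exact this

end Inverse

/-! ### The Christoffel symbols in a chart -/

section Christoffel

open Filter Set Bundle

universe u

variable {E : Type u} [NormedAddCommGroup E] [NormedSpace ℝ E] [FiniteDimensional ℝ E]
  {H : Type*} [TopologicalSpace H] {I : ModelWithCorners ℝ E H}
  {M : Type*} [TopologicalSpace M] [ChartedSpace H M] [IsManifold I ∞ M] {p q : ℕ}

lemma eq_christoffel_iff {B : E →L[ℝ] E →L[ℝ] ℝ} (hB : B.IsInvertible)
    (B' : E →L[ℝ] E →L[ℝ] E →L[ℝ] ℝ) (Γ : E →L[ℝ] E →L[ℝ] E) :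
    (∀ u v w, 2 * B (Γ u v) w = B' u v w + B' v u w - B' w u v) ↔ Γ = christoffel B B' := by
  have h : ∀ u v w, (2 * B (Γ u v) w = B' u v w + B' v u w - B' w u v ↔
      B (Γ u v) w = B (christoffel B B' u v) w) := by
    intro u v w
    rw [apply_christoffel hB, koszulForm_apply]
    constructor <;> intro h <;> linarith
  simp only [h]
  constructor
  · intro h
    ext u v
    exact eq_of_forall_apply_eq hB (h u v)
  · rintro rfl u v w
    rfl

/-- The trivial bundle with fibre `E →L[ℝ] E →L[ℝ] E` carries the bundle structure of a bundle of
homomorphisms of trivial bundles; its trivializations are the identity. -/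
lemma localRep_trivial_bilinear {x₀ : M} {y : E} (hy : y ∈ (extChartAt I x₀).target)
    (s : M → E →L[ℝ] E →L[ℝ] E) :
    localRep (F := E →L[ℝ] E →L[ℝ] E) (V := Bundle.Trivial M (E →L[ℝ] E →L[ℝ] E)) I x₀ s y =
      s ((extChartAt I x₀).symm y) := by
  have hc : ∀ u : E, constSection (F := E) (V := Bundle.Trivial M E) x₀ u
      ((extChartAt I x₀).symm y) = u := fun u =>
    localRep_constSection (mem_localDomain (F := E) (V := Bundle.Trivial M E) hy) u
  ext u v
  refine (congrArg (fun L : E →L[ℝ] E => L v) (localRep_clm_constSection (F := E)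
    (V := Bundle.Trivial M E) (F₂ := E →L[ℝ] E) (V₂ := Bundle.Trivial M (E →L[ℝ] E))
    (mem_localDomain hy) (mem_localDomain hy) s u)).trans ?_
  refine (localRep_clm_constSection (F := E) (V := Bundle.Trivial M E) (F₂ := E)
    (V₂ := Bundle.Trivial M E) (mem_localDomain hy) (mem_localDomain hy)
    (fun x => s x (constSection (F := E) (V := Bundle.Trivial M E) x₀ u x)) v).trans ?_
  rw [localRep_trivial, hc, hc]

variable [CompactSpace M]

/-- The result is defined on the chart domain `M'` at `x₀`. The charts of `M'` are restrictions of
charts of `M`, and have to be changed to the chart at `x₀`, in which the jets are taken. -/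
lemma isSmoothOperation_christoffel (hpq : p + q = Module.finrank ℝ E) (x₀ : M) :
    IsSmoothOperation (pseudoMetrics I M p q) (fun g Γ => IsChristoffel x₀ g.1 Γ) := by
  have hmem : ∀ x : chartDomain (H := H) x₀, (x : M) ∈ (extChartAt I x₀).source := fun x => by
    rw [extChartAt_source]; exact x.2
  obtain ⟨f, hf, hf'⟩ := exists_isFrechetSmoothOn_of_jet (I := I) (M := M) hpq
    (M' := chartDomain (H := H) x₀)
    (F := E →L[ℝ] E →L[ℝ] E)
    (V := Bundle.Trivial (chartDomain (H := H) x₀) (E →L[ℝ] E →L[ℝ] E))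
    (C := E) (ContinuousLinearEquiv.refl ℝ _)
    (Ψ := fun z => christoffel z.2.1 z.2.2.1)
    (contDiffOn_jet_christoffel _) (fun _ => x₀)
    (fun x y => extChartAt I x₀ ((extChartAt I x).symm y : chartDomain (H := H) x₀))
    (fun x => by
      rw [← contMDiffOn_iff_contDiffOn]
      exact (contMDiffOn_extChartAt (n := ∞) (I := I) (x := x₀)).comp
        (contMDiff_subtype_val.comp_contMDiffOn (contMDiffOn_extChartAt_symm x))
        fun y _ => by rw [← extChartAt_source I]; exact hmem _)
    (fun x y _ => (extChartAt I x₀).map_source (hmem _))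
    (fun _ _ => 0) (fun _ => contDiffOn_const)
    (P := fun g x Γ => ∀ u v w : E,
      2 * metricRep x₀ g (extChartAt I x₀ (x : M)) ((Γ : E →L[ℝ] E →L[ℝ] E) u v) w =
        metricRep₁ x₀ g (extChartAt I x₀ (x : M)) u v w +
          metricRep₁ x₀ g (extChartAt I x₀ (x : M)) v u w -
          metricRep₁ x₀ g (extChartAt I x₀ (x : M)) w u v)
    fun g hg x s y hy => by
    rw [localRep_trivial_bilinear hy]
    exact eq_christoffel_iff (B := metricRep x₀ g
        (extChartAt I x₀ ((extChartAt I x).symm y : chartDomain (H := H) x₀)))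
      ((isLocalMetric_metricRep hg x₀).isInvertible _ ((extChartAt I x₀).map_source (hmem _)))
      (metricRep₁ x₀ g
        (extChartAt I x₀ ((extChartAt I x).symm y : chartDomain (H := H) x₀)))
      (s ((extChartAt I x).symm y) : E →L[ℝ] E →L[ℝ] E)
  exact ⟨f, fun g hg x => hf g hg x, hf'⟩

end Christoffel

/-! ### Curvature -/

section Curvature

open Filter Set Bundle VectorField

universe u

variable {E : Type u} [NormedAddCommGroup E] [NormedSpace ℝ E] [FiniteDimensional ℝ E]
  {H : Type*} [TopologicalSpace H] {I : ModelWithCorners ℝ E H}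
  {M : Type*} [TopologicalSpace M] [ChartedSpace H M] [IsManifold I ∞ M] {p q : ℕ}

/-- The operator `∇_X ∇_Y Z - ∇_Y ∇_X Z - ∇_[X, Y] Z` of a connection. -/
def curvatureOperator (cov : TangentConnection I M) (X Y Z : ∀ x : M, TangentSpace I x) (x : M) :
    TangentSpace I x :=
  cov (fun x' => cov Z x' (Y x')) x (X x) - cov (fun x' => cov Z x' (X x')) x (Y x) -
    cov Z x (mlieBracket I X Y x)

lemma eventually_nhdsWithin_target {x₀ : M} {y : E} (hy : y ∈ (extChartAt I x₀).target)
    {p : M → Prop} (hp : ∀ᶠ x in 𝓝 ((extChartAt I x₀).symm y), p x) :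
    ∀ᶠ z in 𝓝[(extChartAt I x₀).target] y, p ((extChartAt I x₀).symm z) :=
  (continuousOn_extChartAt_symm x₀ y hy).eventually hp

/-- The curvature of the Levi-Civita connection in local coordinates. -/
lemma localRep_curvatureOperator {g : symBilin I M} (hg : g ∈ pseudoMetrics I M p q) {x₀ : M}
    {y : E} (hy : y ∈ (extChartAt I x₀).target) {X Y Z : ∀ x : M, TangentSpace I x}
    (hX : ContMDiffAt I I.tangent ∞ (T% X) ((extChartAt I x₀).symm y))
    (hY : ContMDiffAt I I.tangent ∞ (T% Y) ((extChartAt I x₀).symm y))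
    (hZ : ∀ᶠ x in 𝓝 ((extChartAt I x₀).symm y), ContMDiffAt I I.tangent ∞ (T% Z) x) :
    localRep (F := E) I x₀ (curvatureOperator (leviCivita g) X Y Z) y =
      jetRiem (metricJet x₀ g y) (localRep (F := E) I x₀ X y) (localRep (F := E) I x₀ Y y)
        (localRep (F := E) I x₀ Z y) := by
  have : CompleteSpace E := FiniteDimensional.complete ℝ E
  have hd : ∀ x₀ : M, localDomain I E (fun x : M => TangentSpace I x) x₀ =
    (extChartAt I x₀).target := localDomain_eq_target
  have hG := isLocalMetric_metricRep hg x₀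
  have hu := uniqueDiffOn_target (I := I) x₀
  have hc : ∀ {X : ∀ x : M, TangentSpace I x} {z : E}, z ∈ (extChartAt I x₀).target →
      ContMDiffAt I I.tangent ∞ (T% X) ((extChartAt I x₀).symm z) →
      ContDiffWithinAt ℝ ∞ (localRep (F := E) I x₀ X) (extChartAt I x₀).target z := by
    intro X z hz hX
    have := (contMDiffAt_iff_contDiffWithinAt_localRep_of_mem (F := E)
      (V := fun x : M => TangentSpace I x) (mem_localDomain hz)).1 hX
    rwa [hd] at this
  have hX' := hc hy hX
  have hY' := hc hy hY
  have hZ' := hc hy hZ.self_of_nhds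
  have hdX := hX.mdifferentiableAt (by simp)
  have hdY := hY.mdifferentiableAt (by simp)
  have hdZ := hZ.self_of_nhds.mdifferentiableAt (by simp)
  have hZ'' : ContDiffWithinAt ℝ ∞ (fderivWithin ℝ (localRep (F := E) I x₀ Z)
      (extChartAt I x₀).target) (extChartAt I x₀).target y :=
    hZ'.fderivWithin_right hu (by simp) hy
  -- the inner derivatives in local coordinates
  have key : ∀ {X Y : ∀ x : M, TangentSpace I x},
      ContDiffWithinAt ℝ ∞ (localRep (F := E) I x₀ Y) (extChartAt I x₀).target y →
      localRep (F := E) I x₀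
        (fun x => leviCivita g (fun x' => leviCivita g Z x' (Y x')) x (X x)) y =
      localCov (extChartAt I x₀).target (christoffelRep x₀ g)
        (fun z => localCov (extChartAt I x₀).target (christoffelRep x₀ g)
          (localRep (F := E) I x₀ Z) z (localRep (F := E) I x₀ Y z)) y
        (localRep (F := E) I x₀ X y) := by
    intro X Y hY
    have e : localRep (F := E) I x₀ (fun x' => leviCivita g Z x' (Y x'))
        =ᶠ[𝓝[(extChartAt I x₀).target] y] fun z => localCov (extChartAt I x₀).target
          (christoffelRep x₀ g) (localRep (F := E) I x₀ Z) z (localRep (F := E) I x₀ Y z) := by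
      filter_upwards [eventually_nhdsWithin_target hy hZ, self_mem_nhdsWithin] with z hz hzt
      exact localRep_leviCivita hg hzt (hz.mdifferentiableAt (by simp)) Y
    have e0 := e.self_of_nhdsWithin hy
    have hdiff : DifferentiableWithinAt ℝ (fun z => localCov (extChartAt I x₀).target
        (christoffelRep x₀ g) (localRep (F := E) I x₀ Z) z (localRep (F := E) I x₀ Y z))
        (extChartAt I x₀).target y := by
      have hYd := hY.differentiableWithinAt (by simp)
      exact ((hZ''.differentiableWithinAt (by simp)).clm_apply hYd).add
        (((hG.contDiffOn_christoffelOn.differentiableOn (by simp) y hy).clm_apply hYd).clm_apply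
          (hZ'.differentiableWithinAt (by simp)))
    have hm := (mdifferentiableAt_iff_localRep (F := E) (V := fun x : M => TangentSpace I x)
      (s := fun x' => leviCivita g Z x' (Y x')) hy).2 (hdiff.congr_of_eventuallyEq e e0)
    rw [localRep_leviCivita hg hy hm, localCov_apply, localCov_apply, e.fderivWithin_eq e0, e0]
  have h1 := hG.localCov_localCov hy hX' hY' hZ' hZ''
  rw [metricJet_eq_jetOn, ← h1]
  unfold curvatureOperator
  rw [localRep_sub (mem_localDomain hy)
      (fun x => leviCivita g (fun x' => leviCivita g Z x' (Y x')) x (X x) -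
        leviCivita g (fun x' => leviCivita g Z x' (X x')) x (Y x))
      (fun x => leviCivita g Z x (mlieBracket I X Y x)),
    localRep_sub (mem_localDomain hy), key hY', key hX', localRep_leviCivita hg hy hdZ,
    localRep_mlieBracket hy hdX hdY]
  rfl

lemma localRep_trilinear {x₀ : M} {y : E} (hy : y ∈ (extChartAt I x₀).target)
    (R : ∀ x : M, TangentSpace I x →L[ℝ] TangentSpace I x →L[ℝ] TangentSpace I x →L[ℝ]
      TangentSpace I x) (X Y Z : ∀ x : M, TangentSpace I x) :
    localRep (F := E) I x₀ (fun x => R x (X x) (Y x) (Z x)) y =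
      localRep (F := E →L[ℝ] E →L[ℝ] E →L[ℝ] E) I x₀ R y (localRep (F := E) I x₀ X y)
        (localRep (F := E) I x₀ Y y) (localRep (F := E) I x₀ Z y) := by
  rw [localRep_clm_apply (F := E) (V := fun x : M => TangentSpace I x) (mem_localDomain hy)
      (mem_localDomain hy),
    localRep_clm_apply (F := E) (V := fun x : M => TangentSpace I x) (F₂ := E →L[ℝ] E)
      (V₂ := fun x : M => TangentSpace I x →L[ℝ] TangentSpace I x) (mem_localDomain hy)
      (mem_localDomain hy),
    localRep_clm_apply (F := E) (V := fun x : M => TangentSpace I x) (F₂ := E →L[ℝ] E →L[ℝ] E)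
      (V₂ := fun x : M => TangentSpace I x →L[ℝ] TangentSpace I x →L[ℝ] TangentSpace I x)
      (mem_localDomain hy) (mem_localDomain hy)]

/-- The curvature tensor is determined by its values on vector fields which are smooth near the
point. Local vector fields are admitted in order to have those which are constant in the chart. -/
lemma isRiemAt_iff_localRep {g : symBilin I M} (hg : g ∈ pseudoMetrics I M p q) {x₀ : M} {y : E}
    (hy : y ∈ (extChartAt I x₀).target)
    (R : ∀ x : M, TangentSpace I x →L[ℝ] TangentSpace I x →L[ℝ] TangentSpace I x →L[ℝ]
      TangentSpace I x) :
    (∀ X Y Z : ∀ x : M, TangentSpace I x,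
      (∀ᶠ x in 𝓝 ((extChartAt I x₀).symm y), ContMDiffAt I I.tangent ∞ (T% X) x ∧
        ContMDiffAt I I.tangent ∞ (T% Y) x ∧ ContMDiffAt I I.tangent ∞ (T% Z) x) →
      R _ (X _) (Y _) (Z _) =
        curvatureOperator (leviCivita g) X Y Z ((extChartAt I x₀).symm y)) ↔
    localRep (F := E →L[ℝ] E →L[ℝ] E →L[ℝ] E) I x₀ R y = jetRiem (metricJet x₀ g y) := by
  constructor
  · intro h
    ext u v w
    have hs : ∀ u : E, ∀ x ∈ (chartAt H x₀).source, ContMDiffAt I I.tangent ∞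
        (T% (constSection (V := fun x : M => TangentSpace I x) x₀ u)) x :=
      fun u x hx => contMDiffAt_constSection hx u
    have hn := (chartAt H x₀).open_source.mem_nhds (symm_mem_chartAt_source hy)
    have h1 := h (constSection x₀ u) (constSection x₀ v) (constSection x₀ w) (by
      filter_upwards [hn] with x hx
      exact ⟨hs u x hx, hs v x hx, hs w x hx⟩)
    have hc : ∀ u : E, localRep (F := E) I x₀
        (constSection (V := fun x : M => TangentSpace I x) x₀ u) y = u :=
      localRep_constSection (mem_localDomain hy)
    have h2 := localRep_curvatureOperator hg hy (hs u _ (symm_mem_chartAt_source hy))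
      (hs v _ (symm_mem_chartAt_source hy)) (Z := constSection x₀ w) (by
        filter_upwards [hn] with x hx
        exact hs w x hx)
    have h3 := localRep_trilinear hy R (constSection x₀ u) (constSection x₀ v) (constSection x₀ w)
    rw [hc, hc, hc] at h2 h3
    rw [← h2, ← h3]
    unfold localRep
    beta_reduce
    rw [h1]
  · intro h X Y Z hXYZ
    refine localRep_injective (F := E) (V := fun x : M => TangentSpace I x) (mem_localDomain hy)
      (s := fun x => R x (X x) (Y x) (Z x)) (t := curvatureOperator (leviCivita g) X Y Z) ?_
    rw [localRep_trilinear hy, h, localRep_curvatureOperator hg hy hXYZ.self_of_nhds.1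
      hXYZ.self_of_nhds.2.1 (hXYZ.mono fun _ h => h.2.2)]

/-- The trace of an endomorphism of a tangent space in local coordinates. -/
lemma trace_eq_traceL {x₀ : M} {y : E} (hy : y ∈ (extChartAt I x₀).target)
    {T : TangentSpace I ((extChartAt I x₀).symm y) →ₗ[ℝ] TangentSpace I ((extChartAt I x₀).symm y)}
    {A : E →L[ℝ] E} (h : ∀ u : E, T (constSection x₀ u _) = constSection x₀ (A u) _) :
    LinearMap.trace ℝ _ T = traceL E A := by
  have hb := symm_mem_baseSet (F := E) (V := fun x : M => TangentSpace I x) hy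
  let e := (trivializationAt E (fun x : M => TangentSpace I x) x₀).continuousLinearEquivAt ℝ
    ((extChartAt I x₀).symm y) hb
  have hT : T = e.symm.toLinearEquiv.conj (A : E →ₗ[ℝ] E) := by
    ext v
    obtain ⟨u, rfl⟩ := e.symm.surjective v
    have h1 : T (e.symm u) = e.symm (A u) := h u
    rw [h1, LinearEquiv.conj_apply_apply]
    exact congrArg e.symm (congrArg A (e.apply_symm_apply u).symm)
  rw [hT, LinearMap.trace_conj']
  rfl

variable [CompactSpace M]

/-- The Riemann curvature of metrics is a smooth operation, given in charts by `jetRiem`. -/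
lemma exists_riem (hpq : p + q = Module.finrank ℝ E) :
    ∃ f : symBilin I M → CurvatureField I M,
      (∀ g ∈ pseudoMetrics I M p q, IsRiem g.1 (f g) ∧ ∀ x₀, ∀ y ∈ (extChartAt I x₀).target,
        localRep (F := E →L[ℝ] E →L[ℝ] E →L[ℝ] E) I x₀ (fun x => f g x) y =
          jetRiem (metricJet x₀ g y)) ∧
      IsFrechetSmoothOn f (pseudoMetrics I M p q) := by
  obtain ⟨f, hf, hf'⟩ := exists_isFrechetSmoothOn_of_jet' (I := I) (M := M) hpq
    (F := E →L[ℝ] E →L[ℝ] E →L[ℝ] E)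
    (V := fun x : M => TangentSpace I x →L[ℝ] TangentSpace I x →L[ℝ] TangentSpace I x →L[ℝ]
      TangentSpace I x)
    (C := E) (ContinuousLinearEquiv.refl ℝ _) (contDiffOn_jetRiem E) (fun _ _ => 0)
    (fun _ => contDiffOn_const)
    (P := fun g x R => ∀ X Y Z : ∀ x : M, TangentSpace I x,
      (∀ᶠ x in 𝓝 x, ContMDiffAt I I.tangent ∞ (T% X) x ∧
        ContMDiffAt I I.tangent ∞ (T% Y) x ∧ ContMDiffAt I I.tangent ∞ (T% Z) x) →
      R (X x) (Y x) (Z x) = curvatureOperator (leviCivita g) X Y Z x)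
    fun g hg x₀ s y hy => isRiemAt_iff_localRep hg hy s
  refine ⟨f, fun g hg => ⟨⟨leviCivita g, isLeviCivita_leviCivita hg, fun X Y Z x => ?_⟩,
    fun x₀ y hy => (isRiemAt_iff_localRep hg hy (fun x => f g x)).1 (hf g hg _)⟩, hf'⟩
  exact hf g hg x X Y Z (Eventually.of_forall fun x =>
    ⟨X.contMDiff.contMDiffAt, Y.contMDiff.contMDiffAt, Z.contMDiff.contMDiffAt⟩)

/-- The Ricci curvature of metrics is a smooth operation, given in charts by `jetRic`. -/
lemma exists_ric (hpq : p + q = Module.finrank ℝ E) :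
    ∃ f : symBilin I M → BilinField I M,
      (∀ g ∈ pseudoMetrics I M p q, IsRic g.1 (f g) ∧ ∀ x₀, ∀ y ∈ (extChartAt I x₀).target,
        localRep (F := E →L[ℝ] E →L[ℝ] ℝ) I x₀ (fun x => f g x) y = jetRic (metricJet x₀ g y)) ∧
      IsFrechetSmoothOn f (pseudoMetrics I M p q) := by
  obtain ⟨R, hR, -⟩ := exists_riem (I := I) (M := M) hpq
  have hP : ∀ g ∈ pseudoMetrics I M p q, ∀ (x₀ : M) (S : ∀ x : M, TangentSpace I x →L[ℝ]
      TangentSpace I x →L[ℝ] Bundle.Trivial M ℝ x), ∀ y ∈ (extChartAt I x₀).target,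
      (∀ v w : TangentSpace I ((extChartAt I x₀).symm y), (S _ v w : ℝ) =
        LinearMap.trace ℝ _ (ricciEndo (R g) _ v w)) ↔
      localRep (F := E →L[ℝ] E →L[ℝ] ℝ) I x₀ S y = jetRic (metricJet x₀ g y) := by
    intro g hg x₀ S y hy
    have hT := mem_localDomain (F := E) (V := fun x : M => TangentSpace I x) hy
    have h1 : ∀ v w : E, LinearMap.trace ℝ _ (ricciEndo (R g) ((extChartAt I x₀).symm y)
        (constSection x₀ v _) (constSection x₀ w _)) = jetRic (metricJet x₀ g y) v w := by
      intro v w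
      refine trace_eq_traceL hy fun u => ?_
      refine (eq_constSection_iff hT
        (fun x => R g x (constSection x₀ u x) (constSection x₀ v x) (constSection x₀ w x)) _).2 ?_
      have hc : ∀ u : E, localRep (F := E) I x₀
        (constSection (V := fun x : M => TangentSpace I x) x₀ u) y = u := localRep_constSection hT
      rw [localRep_trilinear hy (fun x => R g x), (hR g hg).2 x₀ y hy, hc, hc, hc]
      rfl
    rw [forall_fiber_iff hT]
    have h2 : (∀ v w : E, localRep (F := E →L[ℝ] E →L[ℝ] ℝ) I x₀ S y v w =
        jetRic (metricJet x₀ g y) v w) ↔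
        localRep (F := E →L[ℝ] E →L[ℝ] ℝ) I x₀ S y = jetRic (metricJet x₀ g y) :=
      ⟨fun h => by ext v w; exact h v w, fun h v w => by rw [h]⟩
    rw [← h2]
    refine forall_congr' fun v => ?_
    rw [forall_fiber_iff hT]
    refine forall_congr' fun w => ?_
    rw [h1, localRep_bilin_apply hy]
  obtain ⟨f, hf, hf'⟩ := exists_isFrechetSmoothOn_of_jet' (I := I) (M := M) hpq
    (F := E →L[ℝ] E →L[ℝ] ℝ)
    (V := fun x : M => TangentSpace I x →L[ℝ] TangentSpace I x →L[ℝ] Bundle.Trivial M ℝ x)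
    (C := E) (ContinuousLinearEquiv.refl ℝ _) (contDiffOn_jetRic E) (fun _ _ => 0)
    (fun _ => contDiffOn_const)
    (P := fun g x S => ∀ v w : TangentSpace I x, (S v w : ℝ) =
      LinearMap.trace ℝ _ (ricciEndo (R g) x v w)) hP
  exact ⟨f, fun g hg => ⟨⟨R g, (hR g hg).1, fun x v w => hf g hg x v w⟩,
    fun x₀ y hy => (hP g hg x₀ (fun x => f g x) y hy).1 (hf g hg _)⟩, hf'⟩

lemma isSmoothOperation_riem (hpq : p + q = Module.finrank ℝ E) :
    IsSmoothOperation (pseudoMetrics I M p q) (fun g R => IsRiem g.1 R) := by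
  obtain ⟨f, hf, hf'⟩ := exists_riem (I := I) (M := M) hpq
  exact ⟨f, fun g hg => (hf g hg).1, hf'⟩

lemma isSmoothOperation_ric (hpq : p + q = Module.finrank ℝ E) :
    IsSmoothOperation (Y := symBilin I M) (pseudoMetrics I M p q)
      (fun g S => IsRic g.1 S.1) := by
  obtain ⟨f, hf, hf'⟩ := exists_ric (I := I) (M := M) hpq
  obtain ⟨f', hff', hf''⟩ := hf'.codRestrict (eventually_add_smul_mem_pseudoMetrics hpq)
    (isClosed_symBilin I M) fun g hg => by
      refine (symm_iff_localRep (I := I) (F := E) (V := fun x : M => TangentSpace I x)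
        (fun x => f g x)).2 fun x v w => ?_
      have hy := mem_extChartAt_target (I := I) x
      rw [(hf g hg).2 x _ hy, metricJet_eq_jetOn]
      exact (isLocalMetric_metricRep hg x).jetRic_symm hy v w
  refine ⟨f', fun g hg => ?_, hf''⟩
  have := (hf g hg).1
  rw [← hff' g hg] at this
  exact this

lemma isSmoothOperation_scal (hpq : p + q = Module.finrank ℝ E) :
    IsSmoothOperation (pseudoMetrics I M p q) (fun g f => IsScal g.1 f) := by
  obtain ⟨S, hS, -⟩ := exists_ric (I := I) (M := M) hpq
  have hP : ∀ g ∈ pseudoMetrics I M p q, ∀ (x₀ : M) (f : ∀ x : M, Bundle.Trivial M ℝ x),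
      ∀ y ∈ (extChartAt I x₀).target,
      (∃ A : TangentSpace I ((extChartAt I x₀).symm y) →ₗ[ℝ] TangentSpace I _,
        (∀ u v : TangentSpace I ((extChartAt I x₀).symm y), g.1 _ (A u) v = S g _ u v) ∧
        f ((extChartAt I x₀).symm y) = LinearMap.trace ℝ _ A) ↔
      localRep (F := ℝ) (V := Bundle.Trivial M ℝ) I x₀ f y = jetScal (metricJet x₀ g y) := by
    intro g hg x₀ f y hy
    have hT := mem_localDomain (F := E) (V := fun x : M => TangentSpace I x) hy
    have hb := symm_mem_baseSet (F := E) (V := fun x : M => TangentSpace I x) hy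
    have hB := (isLocalMetric_metricRep hg x₀).isInvertible y hy
    set x := (extChartAt I x₀).symm y with hx
    set A' : E →L[ℝ] E := (metricRep x₀ g y).inverse.comp (jetRic (metricJet x₀ g y))
    have hg' : ∀ u v : E, (g.1 x (constSection x₀ u x) (constSection x₀ v x) : ℝ) =
        metricRep x₀ g y u v := fun u v => (localRep_bilin_apply hy (fun x => g.1 x) u v).symm
    have hS' : ∀ u v : E, (S g x (constSection x₀ u x) (constSection x₀ v x) : ℝ) =
        metricRep x₀ g y (A' u) v := by
      intro u v
      rw [← localRep_bilin_apply hy (fun x => S g x) u v, (hS g hg).2 x₀ y hy]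
      exact congrArg (fun L => L v) (apply_inverse hB _).symm
    -- `A'` is the Ricci endomorphism in local coordinates
    have hA : ∀ A : TangentSpace I x →ₗ[ℝ] TangentSpace I x,
        (∀ u v, g.1 x (A u) v = S g x u v) ↔
        ∀ u : E, A (constSection x₀ u x) = constSection x₀ (A' u) x := by
      intro A
      rw [forall_fiber_iff hT]
      refine forall_congr' fun u => ?_
      rw [forall_fiber_iff hT]
      obtain ⟨u', hu'⟩ := exists_constSection hT (A (constSection x₀ u x))
      rw [← hu']
      constructor
      · intro h
        rw [eq_of_forall_apply_eq hB (u := u') (v := A' u) fun w =>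
          (hg' u' w).symm.trans ((h w).trans (hS' u w))]
      · intro h v
        rw [h]
        exact (hg' _ _).trans (hS' _ _).symm
    constructor
    · rintro ⟨A, h1, h2⟩
      exact h2.trans (trace_eq_traceL hy ((hA A).1 h1))
    · intro h
      let e := (trivializationAt E
        (fun x : M => TangentSpace I x) x₀).continuousLinearEquivAt ℝ x hb
      have he : ∀ u : E, e.symm.toLinearEquiv.conj (A' : E →ₗ[ℝ] E) (constSection x₀ u x) =
          constSection x₀ (A' u) x := by
        intro u
        have h1 : e.symm u = constSection x₀ u x := rfl
        have h2 : e.symm (A' u) = constSection x₀ (A' u) x := rfl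
        rw [← h1, ← h2, LinearEquiv.conj_apply_apply]
        simp
      exact ⟨_, (hA _).2 he, h.trans (trace_eq_traceL hy he).symm⟩
  obtain ⟨f, hf, hf'⟩ := exists_isFrechetSmoothOn_of_jet' (I := I) (M := M) hpq
    (F := ℝ) (V := Bundle.Trivial M ℝ)
    (C := E) ContinuousLinearEquiv.ulift.symm (contDiffOn_jetScal E) (fun _ _ => 0)
    (fun _ => contDiffOn_const)
    (P := fun g x f => ∃ A : TangentSpace I x →ₗ[ℝ] TangentSpace I x,
        (∀ u v : TangentSpace I x, g.1 x (A u) v = S g x u v) ∧ f = LinearMap.trace ℝ _ A) hP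
  exact ⟨f, fun g hg => ⟨S g, (hS g hg).1, fun x => hf g hg x⟩, hf'⟩

end Curvature

/-! ### The volume form -/

section Gram

open Filter Set

universe u

variable {E : Type u} [NormedAddCommGroup E] [NormedSpace ℝ E] [FiniteDimensional ℝ E]

variable (E) in
/-- The determinant with respect to a basis of `E`. -/
def basisForm : E [⋀^Fin (Module.finrank ℝ E)]→L[ℝ] ℝ where
  toAlternatingMap := (Module.finBasis ℝ E).det
  cont := by
    have : Continuous fun v => ((Module.finBasis ℝ E).toMatrix v).det := by
      refine Continuous.matrix_det (continuous_matrix fun i j => ?_)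
      exact ((Module.finBasis ℝ E).coord i).continuous_of_finiteDimensional.comp
        (continuous_apply j)
    exact this

lemma basisForm_apply (v : Fin (Module.finrank ℝ E) → E) :
    basisForm E v = ((Module.finBasis ℝ E).toMatrix v).det := rfl

lemma basisForm_basis : basisForm E (Module.finBasis ℝ E) = 1 := by
  rw [basisForm_apply, Module.Basis.toMatrix_self, Matrix.det_one]

/-- The determinant of the matrix `(B(vᵢ, vⱼ))`. -/
def gramDet (B : E →L[ℝ] E →L[ℝ] ℝ) (v : Fin (Module.finrank ℝ E) → E) : ℝ :=
  Matrix.det (Matrix.of fun i j => B (v i) (v j))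

/-- The Gram determinant of a family of vectors is the one of the basis times the square of the
determinant of the transition matrix. -/
lemma gramDet_eq (B : E →L[ℝ] E →L[ℝ] ℝ) (v : Fin (Module.finrank ℝ E) → E) :
    gramDet B v = basisForm E v ^ 2 * gramDet B (Module.finBasis ℝ E) := by
  set b := Module.finBasis ℝ E
  have h : (Matrix.of fun i j => B (v i) (v j)) =
      (b.toMatrix v).transpose * (Matrix.of fun i j => B (b i) (b j)) * b.toMatrix v := by
    ext i j
    have hi := (b.sum_toMatrix_smul_self v i).symm
    have hj := (b.sum_toMatrix_smul_self v j).symm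
    rw [Matrix.of_apply, hi, hj]
    simp only [map_sum, map_smul, sum_apply, smul_apply, smul_eq_mul, Matrix.mul_apply,
      Matrix.transpose_apply, Matrix.of_apply, Finset.mul_sum, Finset.sum_mul]
    refine Finset.sum_congr rfl fun k _ => Finset.sum_congr rfl fun l _ => ?_
    ring
  rw [gramDet, h, Matrix.det_mul, Matrix.det_mul, Matrix.det_transpose, basisForm_apply, gramDet]
  ring

lemma gramDet_basis_ne_zero {B : E →L[ℝ] E →L[ℝ] ℝ} (hB : B.IsInvertible) :
    gramDet B (Module.finBasis ℝ E) ≠ 0 := by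
  set b := Module.finBasis ℝ E
  intro h
  obtain ⟨w, hw, hw0⟩ := Matrix.exists_vecMul_eq_zero_iff.2 h
  have h1 : ∑ i, w i • b i = 0 := by
    refine eq_of_forall_apply_eq hB fun v => ?_
    have h2 : B (∑ i, w i • b i) = 0 := by
      refine ContinuousLinearMap.coe_injective (b.ext fun j => ?_)
      have := congrFun hw0 j
      simpa [Matrix.vecMul, dotProduct] using this
    rw [h2, map_zero]
  exact hw (funext fun i => Fintype.linearIndependent_iff.1 b.linearIndependent w h1 i)

lemma contDiffOn_sqrt_gramDet (C : Type u) [NormedAddCommGroup C] [NormedSpace ℝ C] :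
    ContDiffOn ℝ ∞ (fun z : C × Jet E => √|gramDet z.2.1 (Module.finBasis ℝ E)|)
      (metricJets E C) := by
  have h : ContDiff ℝ ∞ (fun z : C × Jet E => gramDet z.2.1 (Module.finBasis ℝ E)) := by
    unfold gramDet
    simp only [Matrix.det_apply, Matrix.of_apply]
    refine ContDiff.sum fun σ _ => ContDiff.const_smul _ (contDiff_prod fun i _ => ?_)
    fun_prop
  intro z hz
  have h0 := gramDet_basis_ne_zero hz
  have ha : ContDiffAt ℝ ∞ (fun z : C × Jet E => |gramDet z.2.1 (Module.finBasis ℝ E)|) z :=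
    h.contDiffAt.abs h0
  exact (ha.sqrt (abs_ne_zero.2 h0)).contDiffWithinAt

end Gram

section Orientation

open Filter Set Bundle

universe u

section

variable {E : Type*} [NormedAddCommGroup E] [NormedSpace ℝ E]
  {H : Type*} [TopologicalSpace H] {I : ModelWithCorners ℝ E H}
  {M : Type*} [TopologicalSpace M] [ChartedSpace H M]
  {F : Type*} [NormedAddCommGroup F] [NormedSpace ℝ F]
  {V : M → Type*} [TopologicalSpace (TotalSpace F V)] [∀ x, TopologicalSpace (V x)]
  [FiberBundle F V]

lemma continuousOn_localRep {s : ∀ x, V x} (hs : Continuous fun x => TotalSpace.mk' F x (s x))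
    (x₀ : M) : ContinuousOn (localRep (F := F) I x₀ s) (localDomain I F V x₀) :=
  continuous_snd.comp_continuousOn ((trivializationAt F V x₀).continuousOn.comp
    (hs.comp_continuousOn ((continuousOn_extChartAt_symm x₀).mono fun _ hy => hy.1))
    fun _ hy => (trivializationAt F V x₀).mem_source.2 hy.2)

end

variable {E : Type u} [NormedAddCommGroup E] [NormedSpace ℝ E]
  {H : Type*} [TopologicalSpace H] {I : ModelWithCorners ℝ E H}
  {M : Type*} [TopologicalSpace M] [ChartedSpace H M] [IsManifold I ∞ M]

lemma Represents.smul {x : M} {vol : TangentSpace I x [⋀^Fin (Module.finrank ℝ E)]→L[ℝ] ℝ}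
    {o : Orientation ℝ (TangentSpace I x) (Fin (Module.finrank ℝ E))} (h : Represents vol o)
    {c : ℝ} (hc : 0 < c) : Represents (c • vol) o := by
  obtain ⟨h0, rfl⟩ := h
  have h0' : (c • vol).toAlternatingMap ≠ 0 := smul_ne_zero hc.ne' h0
  exact ⟨h0', (ray_eq_iff h0 h0').2 (SameRay.sameRay_pos_smul_right _ hc)⟩

lemma Represents.exists_pos {x : M}
    {vol vol' : TangentSpace I x [⋀^Fin (Module.finrank ℝ E)]→L[ℝ] ℝ}
    {o : Orientation ℝ (TangentSpace I x) (Fin (Module.finrank ℝ E))} (h : Represents vol o)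
    (h' : Represents vol' o) : ∃ c : ℝ, 0 < c ∧ vol' = c • vol := by
  obtain ⟨h0, rfl⟩ := h
  obtain ⟨h0', ho⟩ := h'
  obtain ⟨r, s, hr, hs, hrs⟩ := ((ray_eq_iff h0 h0').1 ho).exists_pos h0 h0'
  refine ⟨s⁻¹ * r, by positivity, ContinuousAlternatingMap.toAlternatingMap_injective ?_⟩
  have : vol'.toAlternatingMap = (s⁻¹ * r) • vol.toAlternatingMap := by
    rw [mul_smul, hrs, smul_smul, inv_mul_cancel₀ hs.ne', one_smul]
  exact this

variable [FiniteDimensional ℝ E]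

lemma represents_or_neg {x : M} {vol : TangentSpace I x [⋀^Fin (Module.finrank ℝ E)]→L[ℝ] ℝ}
    (h0 : vol.toAlternatingMap ≠ 0)
    (o : Orientation ℝ (TangentSpace I x) (Fin (Module.finrank ℝ E))) :
    Represents vol o ∨ Represents (-vol) o := by
  have : FiniteDimensional ℝ (TangentSpace I x) := inferInstanceAs (FiniteDimensional ℝ E)
  rcases o.eq_or_eq_neg (rayOfNeZero ℝ vol.toAlternatingMap h0) (Fintype.card_fin _) with h | h
  · exact Or.inl ⟨h0, h⟩
  · exact Or.inr ⟨neg_ne_zero.2 h0, h.trans (neg_rayOfNeZero ℝ _ h0)⟩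

/-- The volume form `dx¹ ∧ … ∧ dxⁿ` of the chart at `x₀`. -/
def chartForm (x₀ x : M) : TangentSpace I x [⋀^Fin (Module.finrank ℝ E)]→L[ℝ] ℝ :=
  constSection (F := E [⋀^Fin (Module.finrank ℝ E)]→L[ℝ] ℝ)
    (V := fun x : M => TangentSpace I x [⋀^Fin (Module.finrank ℝ E)]→L[ℝ] Bundle.Trivial M ℝ x)
    x₀ (basisForm E) x

lemma chartForm_apply {x₀ : M} {y : E} (hy : y ∈ (extChartAt I x₀).target)
    (v : Fin (Module.finrank ℝ E) → E) :
    chartForm (I := I) x₀ ((extChartAt I x₀).symm y) (fun i => constSection x₀ (v i) _) =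
      basisForm E v := by
  have h := localRep_alternating (F := E) (V := fun x : M => TangentSpace I x) (F₂ := ℝ)
    (V₂ := Bundle.Trivial M ℝ) (mem_localDomain hy) (mem_localDomain hy)
    (fun x => chartForm (I := I) x₀ x) v
  have h1 : localRep (F := E [⋀^Fin (Module.finrank ℝ E)]→L[ℝ] ℝ)
      (V := fun x : M => TangentSpace I x [⋀^Fin (Module.finrank ℝ E)]→L[ℝ] Bundle.Trivial M ℝ x)
      I x₀ (fun x => chartForm (I := I) x₀ x) y = basisForm E :=
    localRep_constSection (mem_localDomain hy) _
  rw [h1] at h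
  exact h.symm

lemma chartForm_ne_zero {x₀ : M} {y : E} (hy : y ∈ (extChartAt I x₀).target) :
    (chartForm (I := I) x₀ ((extChartAt I x₀).symm y)).toAlternatingMap ≠ 0 := by
  intro h
  have h1 := chartForm_apply (I := I) hy (Module.finBasis ℝ E)
  have h2 := congrArg (fun η => η fun i =>
    constSection (V := fun x : M => TangentSpace I x) x₀ (Module.finBasis ℝ E i) _) h
  rw [basisForm_basis] at h1
  exact one_ne_zero (h1.symm.trans h2)

open Classical in
/-- The sign `±1` of the chart at `x₀` with respect to the orientation `o`, at the point with
coordinates `y`. -/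
def chartSign (o : (x : M) → Orientation ℝ (TangentSpace I x) (Fin (Module.finrank ℝ E)))
    (x₀ : M) (y : E) : ℝ :=
  if Represents (chartForm (I := I) x₀ ((extChartAt I x₀).symm y)) (o _) then 1 else -1

variable {o : (x : M) → Orientation ℝ (TangentSpace I x) (Fin (Module.finrank ℝ E))}

lemma chartSign_sq (x₀ : M) (y : E) : chartSign o x₀ y ^ 2 = 1 := by
  unfold chartSign
  split_ifs <;> norm_num

lemma represents_chartSign {x₀ : M} {y : E} (hy : y ∈ (extChartAt I x₀).target) :
    Represents (chartSign o x₀ y • chartForm (I := I) x₀ ((extChartAt I x₀).symm y)) (o _) := by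
  unfold chartSign
  split_ifs with h
  · rwa [one_smul]
  · rw [neg_one_smul]
    exact (represents_or_neg (chartForm_ne_zero hy) _).resolve_left h

/-- The sign of the chart is locally constant: it is the sign of the coefficient of a continuous
form which represents the orientation. -/
lemma eventually_chartSign_eq (ho : IsOrientation o) {x₀ : M} {y : E}
    (hy : y ∈ (extChartAt I x₀).target) :
    ∀ᶠ z in 𝓝[(extChartAt I x₀).target] y, chartSign o x₀ z = chartSign o x₀ y := by
  obtain ⟨vol, hvol⟩ := ho ((extChartAt I x₀).symm y)
  let c : E → ℝ := fun z => localRep (F := E [⋀^Fin (Module.finrank ℝ E)]→L[ℝ] ℝ) I x₀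
    (fun x => vol x) z (Module.finBasis ℝ E)
  have hc : ContinuousWithinAt c (extChartAt I x₀).target y := by
    have h := continuousOn_localRep (I := I) (F := E [⋀^Fin (Module.finrank ℝ E)]→L[ℝ] ℝ)
      (s := fun x => vol x) vol.contMDiff.continuous x₀
    have h' := (ContinuousAlternatingMap.apply ℝ E ℝ
      (Module.finBasis ℝ E)).continuous.comp_continuousOn h
    rw [localDomain_eq_target] at h'
    exact h' y hy
  have key : ∀ z ∈ (extChartAt I x₀).target,
      Represents (vol ((extChartAt I x₀).symm z)) (o _) → 0 < c z * chartSign o x₀ z := by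
    intro z hz h
    obtain ⟨k, hk, hkv⟩ := (represents_chartSign (o := o) hz).exists_pos h
    have h1 := localRep_alternating (F := E) (V := fun x : M => TangentSpace I x) (F₂ := ℝ)
      (V₂ := Bundle.Trivial M ℝ) (mem_localDomain hz) (mem_localDomain hz)
      (fun x => vol x) (Module.finBasis ℝ E)
    have h2 : c z = k * (chartSign o x₀ z * 1) := by
      rw [← basisForm_basis (E := E), ← chartForm_apply (I := I) hz]
      refine h1.trans ?_
      exact congrArg (fun η => η fun i =>
        constSection (V := fun x : M => TangentSpace I x) x₀ (Module.finBasis ℝ E i) _) hkv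
    have h3 := chartSign_sq (o := o) x₀ z
    rw [h2]
    nlinarith
  have h0 := key y hy hvol.self_of_nhds
  have h1 : ∀ᶠ z in 𝓝[(extChartAt I x₀).target] y, 0 < c z * chartSign o x₀ y :=
    (hc.mul continuousWithinAt_const).eventually (lt_mem_nhds h0)
  filter_upwards [h1, eventually_nhdsWithin_target hy hvol, self_mem_nhdsWithin] with z hz hz' hzt
  have h2 := key z hzt hz'
  have h3 : 0 < chartSign o x₀ z * chartSign o x₀ y := by
    refine pos_of_mul_pos_left ?_ (sq_nonneg (c z))
    calc 0 < (c z * chartSign o x₀ z) * (c z * chartSign o x₀ y) := mul_pos h2 hz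
      _ = _ := by ring
  rcases sq_eq_sq_iff_eq_or_eq_neg.1 ((chartSign_sq (o := o) x₀ z).trans
    (chartSign_sq (o := o) x₀ y).symm) with h | h
  · exact h
  · rw [h] at h3
    nlinarith

variable (I M) in
/-- In the chart at `x₀`, the volume form is `ε √|det gᵢⱼ| dx¹ ∧ … ∧ dxⁿ`, where `ε` is the sign of
the chart. The locally constant function `ε` is a smooth parameter of the local formula. -/
lemma isSmoothOperation_volumeForm {p q : ℕ} [T2Space M] [CompactSpace M]
    (hpq : p + q = Module.finrank ℝ E)
    {o : (x : M) → Orientation ℝ (TangentSpace I x) (Fin (Module.finrank ℝ E))}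
    (ho : IsOrientation o) :
    IsSmoothOperation (pseudoMetrics I M p q) (fun g vol => IsVolumeForm o g.1 vol) := by
  have hc : ∀ x₀ : M, ContDiffOn ℝ ∞ (fun y => chartSign o x₀ y • basisForm E)
      (extChartAt I x₀).target := fun x₀ y hy =>
    (contDiffWithinAt_const (c := chartSign o x₀ y • basisForm E)).congr_of_eventuallyEq
      ((eventually_chartSign_eq ho hy).mono fun z hz => congrArg (· • basisForm E) hz) rfl
  have hP : ∀ g ∈ pseudoMetrics I M p q, ∀ (x₀ : M)
      (s : ∀ x : M, TangentSpace I x [⋀^Fin (Module.finrank ℝ E)]→L[ℝ] Bundle.Trivial M ℝ x),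
      ∀ y ∈ (extChartAt I x₀).target,
      (Represents (s ((extChartAt I x₀).symm y)) (o _) ∧
        ∀ v : Fin (Module.finrank ℝ E) → TangentSpace I ((extChartAt I x₀).symm y),
        (s ((extChartAt I x₀).symm y) v) ^ 2 =
          |Matrix.det (Matrix.of fun i j => (g.1 _ (v i) (v j) : ℝ))|) ↔
      localRep (F := E [⋀^Fin (Module.finrank ℝ E)]→L[ℝ] ℝ)
        (V := fun x : M => TangentSpace I x [⋀^Fin (Module.finrank ℝ E)]→L[ℝ]
          Bundle.Trivial M ℝ x) I x₀ s y =
        √|gramDet (metricRep x₀ g y) (Module.finBasis ℝ E)| •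
          (chartSign o x₀ y • basisForm E) := by
    intro g hg x₀ s y hy
    have hd := mem_localDomain (F := E [⋀^Fin (Module.finrank ℝ E)]→L[ℝ] ℝ)
      (V := fun x : M => TangentSpace I x [⋀^Fin (Module.finrank ℝ E)]→L[ℝ]
          Bundle.Trivial M ℝ x) hy
    have hT := mem_localDomain (F := E) (V := fun x : M => TangentSpace I x) hy
    have hB := gramDet_basis_ne_zero ((isLocalMetric_metricRep hg x₀).isInvertible y hy)
    have hgram : ∀ v : Fin (Module.finrank ℝ E) → E,
        Matrix.det (Matrix.of fun i j => (g.1 _ (constSection x₀ (v i)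
          ((extChartAt I x₀).symm y)) (constSection x₀ (v j) _) : ℝ)) =
        basisForm E v ^ 2 * gramDet (metricRep x₀ g y) (Module.finBasis ℝ E) := by
      intro v
      rw [← gramDet_eq, gramDet]
      congr 1
      ext i j
      exact (localRep_bilin_apply hy (fun x => g.1 x) (v i) (v j)).symm
    rw [← eq_constSection_iff hd, constSection_smul hd.2, constSection_smul hd.2]
    constructor
    -- evaluation at the basis determines the positive factor between two positive forms
    · rintro ⟨h1, h2⟩
      obtain ⟨k, hk, hks⟩ := (represents_chartSign (o := o) hy).exists_pos h1
      have h3 := (h2 fun i => constSection x₀ (Module.finBasis ℝ E i) _).symm.trans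
        (congrArg (fun η => (η fun i => constSection (V := fun x : M => TangentSpace I x) x₀
          (Module.finBasis ℝ E i) _) ^ 2) hks)
      rw [hgram, basisForm_basis, one_pow, one_mul] at h3
      have h4 : |gramDet (metricRep x₀ g y) (Module.finBasis ℝ E)| =
          (k * (chartSign o x₀ y * 1)) ^ 2 := by
        rw [← basisForm_basis (E := E), ← chartForm_apply (I := I) hy]
        exact h3
      rw [mul_one, mul_pow, chartSign_sq, mul_one] at h4
      rw [h4, Real.sqrt_sq hk.le]
      exact hks
    · intro h
      rw [h]
      refine ⟨(represents_chartSign (o := o) hy).smul (Real.sqrt_pos.2 (abs_pos.2 hB)),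
        fun v => ?_⟩
      choose v' hv' using fun i => exists_constSection hT (v i)
      obtain rfl : (fun i => constSection x₀ (v' i) _) = v := funext hv'
      rw [hgram, abs_mul, abs_sq]
      have h5 : √|gramDet (metricRep x₀ g y) (Module.finBasis ℝ E)| ^ 2 = _ :=
        Real.sq_sqrt (abs_nonneg _)
      have h6 : (√|gramDet (metricRep x₀ g y) (Module.finBasis ℝ E)| *
          (chartSign o x₀ y * basisForm E v')) ^ 2 =
          basisForm E v' ^ 2 * |gramDet (metricRep x₀ g y) (Module.finBasis ℝ E)| := by
        rw [mul_pow, mul_pow, h5, chartSign_sq]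
        ring
      rw [← h6, ← chartForm_apply (I := I) hy]
      rfl
  obtain ⟨f, hf, hf'⟩ := exists_isFrechetSmoothOn_of_jet' (I := I) (M := M) hpq
    (F := E [⋀^Fin (Module.finrank ℝ E)]→L[ℝ] ℝ)
    (V := fun x : M => TangentSpace I x [⋀^Fin (Module.finrank ℝ E)]→L[ℝ] Bundle.Trivial M ℝ x)
    (C := E [⋀^Fin (Module.finrank ℝ E)]→L[ℝ] ℝ) (ContinuousLinearEquiv.refl ℝ _)
    ((contDiffOn_sqrt_gramDet _).smul contDiffOn_fst) _ hc
    (P := fun g x vol => Represents vol (o x) ∧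
      ∀ v : Fin (Module.finrank ℝ E) → TangentSpace I x, (vol v) ^ 2 =
        |Matrix.det (Matrix.of fun i j => (g.1 x (v i) (v j) : ℝ))|) hP
  exact ⟨f, hf, hf'⟩

end Orientation

end MetricOps

end

theorem mainTheorem8
    {E : Type*} [NormedAddCommGroup E] [NormedSpace ℝ E] [FiniteDimensional ℝ E]
    {H : Type*} [TopologicalSpace H] (I : ModelWithCorners ℝ E H)
    (M : Type*) [TopologicalSpace M] [ChartedSpace H M] [IsManifold I ∞ M]
    [T2Space M] [CompactSpace M]
    (p q : ℕ) (hpq : p + q = Module.finrank ℝ E) :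
    -- the inverse metric in `Γ(S²TM)`
    MetricOps.IsSmoothOperation (Y := MetricOps.symCobilin I M) (MetricOps.pseudoMetrics I M p q)
      (fun g h => MetricOps.IsInverseMetric g.1 h.1) ∧
    -- the volume form in `Γ(ΛⁿT*M)`, for each orientation of `M`
    (∀ o : (x : M) → Orientation ℝ (TangentSpace I x) (Fin (Module.finrank ℝ E)),
      MetricOps.IsOrientation o →
      MetricOps.IsSmoothOperation (MetricOps.pseudoMetrics I M p q)
        (fun g vol => MetricOps.IsVolumeForm o g.1 vol)) ∧
    -- the Christoffel symbols in the chart at each point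
    (∀ x₀ : M, MetricOps.IsSmoothOperation (MetricOps.pseudoMetrics I M p q)
      (fun g Γ => MetricOps.IsChristoffel x₀ g.1 Γ)) ∧
    -- the Christoffel symbols in `Γ(T*M ⊗ End(TM))`, with respect to any smooth background connection
    (∀ cov₀ : MetricOps.TangentConnection I M, cov₀.ContMDiffCovariantDerivative ∞ →
      MetricOps.IsSmoothOperation (MetricOps.pseudoMetrics I M p q)
        (fun g A => MetricOps.IsLeviCivitaTangent cov₀ g.1 A)) ∧
    -- the Levi-Civita connection on `T*M` in `Γ(T*M ⊗ End(T*M))`, likewise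
    (∀ cov₀ : MetricOps.CotangentConnection I M, cov₀.ContMDiffCovariantDerivative ∞ →
      MetricOps.IsSmoothOperation (MetricOps.pseudoMetrics I M p q)
        (fun g A => MetricOps.IsLeviCivitaCotangent cov₀ g.1 A)) ∧
    -- the Riemann, Ricci and scalar curvatures
    MetricOps.IsSmoothOperation (MetricOps.pseudoMetrics I M p q)
      (fun g R => MetricOps.IsRiem g.1 R) ∧
    MetricOps.IsSmoothOperation (Y := MetricOps.symBilin I M) (MetricOps.pseudoMetrics I M p q)
      (fun g S => MetricOps.IsRic g.1 S.1) ∧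
    MetricOps.IsSmoothOperation (MetricOps.pseudoMetrics I M p q)
      (fun g f => MetricOps.IsScal g.1 f) := by
  exact ⟨MetricOps.isSmoothOperation_inverse hpq,
    fun o ho => MetricOps.isSmoothOperation_volumeForm I M hpq ho,
    fun x₀ => MetricOps.isSmoothOperation_christoffel hpq x₀,
    fun cov₀ h => MetricOps.isSmoothOperation_leviCivitaTangent hpq cov₀ h,
    fun cov₀ h => MetricOps.isSmoothOperation_leviCivitaCotangent hpq cov₀ h,
    MetricOps.isSmoothOperation_riem hpq, MetricOps.isSmoothOperation_ric hpq,
    MetricOps.isSmoothOperation_scal hpq⟩
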